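/- **Theorem 2 (sequential case).** *Setting.* For every $n$ let $\mu_1,\dots,\mu_n$ be (possibly random) states, observed as $Y_i=\mu_i+\varepsilon_i$, where $\varepsilon_1,\dots,\varepsilon_n$ are i.i.d. $N(0,1)$ and independent of $(\mu_1,\dots,\mu_n)$; all objects may depend on $n$. Let $\mathcal F_i=\sigma(Y_1,\dots,Y_{i-1})$, let $\tilde\mu_i$ be $\mathcal F_i$-measurable and let $\hat\mu_i$ be $\sigma(Y_1,\dots,Y_i)$-measurable. Put $Z_i=Y_i-\tilde\mu_i$ and $\nu_i=\mu_i-\tilde\mu_i$, and let $F^n_\nu=n^{-1}\sum_{i=1}^n\delta_{\nu_i}$ be the (random) empirical distribution of $\nu_1,\dots,\nu_n$. *Sequential estimators.* Let $K(x)=2(e^x+e^{-x})^{-2}$ and $\sigma_n=1/\log n$. For $i\ge 2$ let $\hat f_i(z)=\frac1{i-1}\sum_{j<i}\sigma_n^{-1}K\bigl((Z_j-z)/\sigma_n\bigr)$ and $\hat\delta^i(z)=z+\hat f_i'(z)/\hat f_i(z)$, and let $\hat\delta^1(z)=z$. Put $\hat\mu^{IS}_i=\tilde\mu_i+\hat\delta^i(Z_i)$.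 The oracle is $\mu^{IS}_i=\tilde\mu_i+\delta^i(Z_i)$, where, with $\eta\sim N(0,1)$ and with $\nu_1,\dots,\nu_i$ held fixed, $\delta^i$ minimizes $\sum_{j\le i}E_\eta\bigl(\delta(\nu_j+\eta)-\nu_j\bigr)^2$ over $\delta:\mathbb R\to\mathbb R$; that is, $\delta^i(z)=z+f_i'(z)/f_i(z)$ with $f_i(z)=\frac1i\sum_{j\le i}\varphi(z-\nu_j)$ and $\varphi$ the standard normal density. *Assumptions.* 1. There are constants $\rho_M$, $M\ge1$, not depending on $n$, with $\limsup_{M\to\infty}M^2\rho_M<1$, such that for all $j<i\le n$, replacing $Y_j$ by $Y_j+d$ changes $\tilde\mu_i$ by at most $\rho_{i-j}|d|$. 2. There are $\mathcal F_n$-measurable $\alpha_n<1$ such that $\hat\mu_i=\alpha_n\tilde\mu_i+(1-\alpha_n)Y_i+\zeta_i$, where $E\zeta_i^2\to0$ as $n\to\infty$ with $i/n$ bounded away from $0$ and $1$. 3. $\frac1n\sum_{i=1}^nP(|Y_i-\tilde\mu_i|>\log n)\le(\log n)^{-8}$ for all large $n$. *Conclusion.* (i) Under Assumptions 1 and 3,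 $$E\|\hat{\boldsymbol\mu}^{IS}-\boldsymbol\mu\|^2\le E\|\boldsymbol\mu^{IS}-\boldsymbol\mu\|^2+o(n),$$ and, if the benchmark $\hat{\boldsymbol\mu}$ satisfies Assumption 2, also $$E\|\boldsymbol\mu^{IS}-\boldsymbol\mu\|^2+o(n)\le E\|\hat{\boldsymbol\mu}-\boldsymbol\mu\|^2+o(n).$$ (ii) Under Assumptions 1–3, if $\alpha_n\to\alpha\in(0,1)$ in probability, and $F^n_\nu$ converges weakly, in probability, to a (deterministic) probability distribution different from $N(0,(1-\alpha)/\alpha)$, then there is $c<1$ such that for all large enough $n$ $$E\|\hat{\boldsymbol\mu}^{IS}-\boldsymbol\mu\|^2\le c\,E\|\hat{\boldsymbol\mu}-\boldsymbol\mu\|^2.$$ -/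

import Mathlib

open MeasureTheory ProbabilityTheory Filter Topology
open scoped ENNReal NNReal BoundedContinuousFunction

namespace SeqEB

noncomputable section

/-! Time points `1, …, n` are the elements of `Fin n`. All objects form triangular arrays: they may
depend on the horizon `n`. Estimators are functions of the data vector `y = (Y_1, …, Y_n)`. -/

/-- The observation model at one horizon: `ε_1, …, ε_n` are i.i.d. standard normal and independent
of the (arbitrary, possibly random) vector of states `μ_1, …, μ_n`. -/
structure NoiseModel {Ω : Type*} [MeasurableSpace Ω] (P : Measure Ω) {n : ℕ}
    (μ ε : Fin n → Ω → ℝ) : Prop where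
  measurable_state : ∀ i, Measurable (μ i)
  measurable_noise : ∀ i, Measurable (ε i)
  law_noise : ∀ i, P.map (ε i) = gaussianReal 0 1
  iIndep_noise : iIndepFun ε P
  indep_state : IndepFun (fun ω i => ε i ω) (fun ω i => μ i ω) P

/-- The data vector `Y_i = μ_i + ε_i`. -/
def obs {Ω : Type*} {n : ℕ} (μ ε : Fin n → Ω → ℝ) (ω : Ω) : Fin n → ℝ :=
  fun i => μ i ω + ε i ω

/-- The residuals `Z_i = Y_i - μ̃_i`, as functions of the data. -/
def resid {n : ℕ} (m : Fin n → (Fin n → ℝ) → ℝ) (y : Fin n → ℝ) : Fin n → ℝ :=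
  fun i => y i - m i y

/-- The centred states `ν_i = μ_i - μ̃_i`. -/
def centred {Ω : Type*} {n : ℕ} (μ ε : Fin n → Ω → ℝ) (m : Fin n → (Fin n → ℝ) → ℝ) (ω : Ω) :
    Fin n → ℝ :=
  fun i => μ i ω - m i (obs μ ε ω)

/-! ### The assumptions -/

/-- `μ̃_i` is a measurable function of `Y_1, …, Y_{i-1}`, and is Lipschitz in `Y_j` with constant
`ρ_{i-j}` for `j < i`, where `ρ` does not depend on `n` and `limsup_M M² ρ_M < 1`. -/
structure LipschitzPredictor (m : ∀ n, Fin n → (Fin n → ℝ) → ℝ) (ρ : ℕ → ℝ) : Prop where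
  measurable : ∀ n i, Measurable (m n i)
  dependsOn : ∀ n i, DependsOn (m n i) (Set.Iio i)
  lipschitz : ∀ n (i j : Fin n), j < i → ∀ (y : Fin n → ℝ) (d : ℝ),
    |m n i (Function.update y j (y j + d)) - m n i y| ≤ ρ ((i : ℕ) - (j : ℕ)) * |d|
  limsup_lt : limsup (fun M : ℕ => (((M : ℝ) ^ 2 * ρ M : ℝ) : EReal)) atTop < 1

/-- `μ̂_i` is a measurable function of `Y_1, …, Y_i`. -/
structure SequentialFilter (h : ∀ n, Fin n → (Fin n → ℝ) → ℝ) : Prop where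
  measurable : ∀ n i, Measurable (h n i)
  dependsOn : ∀ n i, DependsOn (h n i) (Set.Iic i)

/-- `μ̂_i = α_n μ̃_i + (1 - α_n) Y_i + ζ_i`, where `α_n < 1` is a measurable function of
`Y_1, …, Y_{n-1}` and `E ζ_i² → 0` as `n → ∞`, as long as `i / n` stays away from `0` and `1`. -/
structure AsympWeightedAverage {Ω : Type*} [MeasurableSpace Ω] (P : Measure Ω)
    (μ ε : ∀ n, Fin n → Ω → ℝ) (m h : ∀ n, Fin n → (Fin n → ℝ) → ℝ)
    (α : ∀ n, (Fin n → ℝ) → ℝ) : Prop where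
  measurable : ∀ n, Measurable (α n)
  dependsOn : ∀ n, DependsOn (α n) {j : Fin n | (j : ℕ) + 1 < n}
  lt_one : ∀ n y, α n y < 1
  remainder : ∀ κ : ℝ, 0 < κ → ∀ r : ℝ≥0∞, 0 < r → ∀ᶠ n : ℕ in atTop, ∀ i : Fin n,
    κ * n ≤ (i : ℕ) + 1 → ((i : ℕ) + 1 : ℝ) ≤ (1 - κ) * n →
      ∫⁻ ω, ENNReal.ofReal ((h n i (obs (μ n) (ε n) ω)
        - (α n (obs (μ n) (ε n) ω) * m n i (obs (μ n) (ε n) ω)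
          + (1 - α n (obs (μ n) (ε n) ω)) * obs (μ n) (ε n) ω i)) ^ 2) ∂P ≤ r

/-- `n⁻¹ ∑ᵢ P(|Y_i - μ̃_i| > log n) ≤ (log n)⁻⁸` for all large `n`. -/
def TightResiduals {Ω : Type*} [MeasurableSpace Ω] (P : Measure Ω)
    (μ ε : ∀ n, Fin n → Ω → ℝ) (m : ∀ n, Fin n → (Fin n → ℝ) → ℝ) : Prop :=
  ∀ᶠ n : ℕ in atTop,
    (1 / (n : ℝ)) * ∑ i : Fin n,
        P.real {ω | Real.log n < |resid (m n) (obs (μ n) (ε n) ω) i|}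
      ≤ 1 / Real.log n ^ 8

/-! ### The sequential empirical Bayes estimator -/

/-- The logistic kernel, the derivative of the distribution function `(1 + e^{-2x})⁻¹`. -/
def kern (x : ℝ) : ℝ := 2 / (Real.exp x + Real.exp (-x)) ^ 2

/-- The kernel density estimate with bandwidth `σ` from the points `x_j`, `j ∈ s`. -/
def kernelDensity {ι : Type*} (σ : ℝ) (s : Finset ι) (x : ι → ℝ) (z : ℝ) : ℝ :=
  (s.card : ℝ)⁻¹ * ∑ j ∈ s, σ⁻¹ * kern ((x j - z) / σ)

/-- The decision function estimated from the points `x_j`, `j ∈ s`. It is the identity when there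
are no points. -/
def estDecision {ι : Type*} (σ : ℝ) (s : Finset ι) (x : ι → ℝ) (z : ℝ) : ℝ :=
  z + deriv (kernelDensity σ s x) z / kernelDensity σ s x z

/-- `μ̂^{IS}_i = μ̃_i + δ̂^i(Z_i)`, with `δ̂^i` estimated from `Z_1, …, Z_{i-1}` with bandwidth
`1 / log n`. -/
def estimIS {n : ℕ} (m : Fin n → (Fin n → ℝ) → ℝ) (i : Fin n) (y : Fin n → ℝ) : ℝ :=
  m i y + estDecision (1 / Real.log n) (Finset.Iio i) (resid m y) (resid m y i)

/-! ### The sequential oracle -/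

/-- The density `|s|⁻¹ ∑_{j ∈ s} φ(z - ν_j)`, with `φ` the standard normal density. -/
def mixDensity {ι : Type*} (s : Finset ι) (ν : ι → ℝ) (z : ℝ) : ℝ :=
  (s.card : ℝ)⁻¹ * ∑ j ∈ s, gaussianPDFReal 0 1 (z - ν j)

/-- The Bayes decision function for the prior that is uniform on the `ν_j`, `j ∈ s`, for one
observation with standard normal noise. -/
def oracleDecision {ι : Type*} (s : Finset ι) (ν : ι → ℝ) (z : ℝ) : ℝ :=
  z + deriv (mixDensity s ν) z / mixDensity s ν z

/-- The risk `R(δ, ν) = E (δ(ν + η) - ν)²`, `η ∼ N(0,1)`. -/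
def normalRisk (δ : ℝ → ℝ) (v : ℝ) : ℝ≥0∞ :=
  ∫⁻ e, ENNReal.ofReal ((δ (v + e) - v) ^ 2) ∂(gaussianReal 0 1)

lemma mixDensity_hasDerivAt {ι : Type*} (s : Finset ι) (ν : ι → ℝ) (z : ℝ) :
    HasDerivAt (mixDensity s ν)
      ((s.card : ℝ)⁻¹ * ∑ j ∈ s, gaussianPDFReal 0 1 (z - ν j) * (ν j - z)) z := by
  unfold mixDensity
  refine HasDerivAt.const_mul _ (HasDerivAt.fun_sum fun j _ => ?_)
  simp only [gaussianPDFReal]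
  have h1 : HasDerivAt (fun x : ℝ => -(x - ν j - 0) ^ 2 / (2 * ((1 : ℝ≥0) : ℝ))) (ν j - z) z := by
    have h2 : HasDerivAt (fun x : ℝ => x - ν j - 0) 1 z :=
      ((hasDerivAt_id z).sub_const _).sub_const _
    have := ((h2.pow 2).neg).div_const (2 * ((1 : ℝ≥0) : ℝ))
    refine this.congr_deriv ?_
    simp
    ring
  have := (h1.exp).const_mul (√(2 * Real.pi * ((1 : ℝ≥0) : ℝ)))⁻¹
  exact this.congr_deriv (by ring)

lemma sum_weight_oracle {ι : Type*} (s : Finset ι) (ν : ι → ℝ) (z : ℝ) :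
    ∑ j ∈ s, gaussianPDFReal 0 1 (z - ν j) * (oracleDecision s ν z - ν j) = 0 := by
  rcases s.eq_empty_or_nonempty with rfl | hs
  · simp
  have hc : (s.card : ℝ)⁻¹ ≠ 0 := by
    simpa using hs.ne_empty
  have hw : ∑ j ∈ s, gaussianPDFReal 0 1 (z - ν j) ≠ 0 :=
    (Finset.sum_pos (fun j _ => gaussianPDFReal_pos 0 1 _ one_ne_zero) hs).ne'
  have h : oracleDecision s ν z - z
      = (∑ j ∈ s, gaussianPDFReal 0 1 (z - ν j) * (ν j - z))
        / ∑ j ∈ s, gaussianPDFReal 0 1 (z - ν j) := by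
    rw [oracleDecision, (mixDensity_hasDerivAt s ν z).deriv, mixDensity,
      mul_div_mul_left _ _ hc]
    ring
  have h2 : ∑ j ∈ s, gaussianPDFReal 0 1 (z - ν j) * (oracleDecision s ν z - ν j)
      = (oracleDecision s ν z - z) * ∑ j ∈ s, gaussianPDFReal 0 1 (z - ν j)
        - ∑ j ∈ s, gaussianPDFReal 0 1 (z - ν j) * (ν j - z) := by
    rw [Finset.mul_sum, ← Finset.sum_sub_distrib]
    exact Finset.sum_congr rfl fun j _ => by ring
  rw [h2, h, div_mul_cancel₀ _ hw, sub_self]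

lemma normalRisk_eq {δ : ℝ → ℝ} (hδ : Measurable δ) (v : ℝ) :
    normalRisk δ v
      = ∫⁻ z, ENNReal.ofReal (gaussianPDFReal 0 1 (z - v) * (δ z - v) ^ 2) := by
  have hm : Measurable fun z : ℝ => ENNReal.ofReal ((δ z - v) ^ 2) := by fun_prop
  have h1 : normalRisk δ v = ∫⁻ z, ENNReal.ofReal ((δ z - v) ^ 2) ∂(gaussianReal v 1) := by
    have : gaussianReal v 1 = (gaussianReal 0 1).map (fun e => v + e) := by
      rw [gaussianReal_map_const_add, zero_add]
    rw [this, lintegral_map hm (measurable_const_add v), normalRisk]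
  rw [h1, gaussianReal_of_var_ne_zero v one_ne_zero,
    lintegral_withDensity_eq_lintegral_mul _ (measurable_gaussianPDF v 1) hm]
  refine lintegral_congr fun z => ?_
  rw [Pi.mul_apply, gaussianPDF, ENNReal.ofReal_mul (gaussianPDFReal_nonneg _ _ _),
    gaussianPDFReal_sub, zero_add]

/-- The oracle decision function minimizes `∑_{j ∈ s} R(δ, ν_j)` over all decision functions. -/
theorem oracleDecision_isMin {ι : Type*} (s : Finset ι) (ν : ι → ℝ) (δ : ℝ → ℝ)
    (hδ : Measurable δ) :
    ∑ j ∈ s, normalRisk (oracleDecision s ν) (ν j) ≤ ∑ j ∈ s, normalRisk δ (ν j) := by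
  have hmix : Measurable (mixDensity s ν) := by
    unfold mixDensity
    exact measurable_const.mul (Finset.measurable_fun_sum s fun j _ =>
      (measurable_gaussianPDFReal 0 1).comp (measurable_id.sub_const _))
  have ho : Measurable (oracleDecision s ν) :=
    measurable_id.add ((measurable_deriv _).div hmix)
  have key : ∀ g : ℝ → ℝ, Measurable g → ∑ j ∈ s, normalRisk g (ν j)
      = ∫⁻ z, ENNReal.ofReal (∑ j ∈ s, gaussianPDFReal 0 1 (z - ν j) * (g z - ν j) ^ 2) := by
    intro g hg
    rw [Finset.sum_congr rfl fun j _ => normalRisk_eq hg (ν j), ← lintegral_finsetSum]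
    · refine lintegral_congr fun z => ?_
      rw [ENNReal.ofReal_sum_of_nonneg]
      exact fun j _ => mul_nonneg (gaussianPDFReal_nonneg _ _ _) (sq_nonneg _)
    · intro j _
      exact (((measurable_gaussianPDFReal 0 1).comp (measurable_id.sub_const _)).mul
        ((hg.sub_const _).pow_const 2)).ennreal_ofReal
  rw [key _ ho, key _ hδ]
  refine lintegral_mono fun z => ENNReal.ofReal_le_ofReal ?_
  have h0 := sum_weight_oracle s ν z
  have hexp : ∑ j ∈ s, gaussianPDFReal 0 1 (z - ν j) * (δ z - ν j) ^ 2
      = ∑ j ∈ s, gaussianPDFReal 0 1 (z - ν j) * (oracleDecision s ν z - ν j) ^ 2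
        + 2 * (δ z - oracleDecision s ν z)
          * ∑ j ∈ s, gaussianPDFReal 0 1 (z - ν j) * (oracleDecision s ν z - ν j)
        + (δ z - oracleDecision s ν z) ^ 2 * ∑ j ∈ s, gaussianPDFReal 0 1 (z - ν j) := by
    rw [Finset.mul_sum, Finset.mul_sum, ← Finset.sum_add_distrib, ← Finset.sum_add_distrib]
    exact Finset.sum_congr rfl fun j _ => by ring
  rw [hexp, h0, mul_zero, add_zero]
  exact le_add_of_nonneg_right (mul_nonneg (sq_nonneg _)
    (Finset.sum_nonneg fun j _ => gaussianPDFReal_nonneg _ _ _))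

/-- `μ^{IS}_i = μ̃_i + δ^i(Z_i)`, with `δ^i` the minimizer of `∑_{j ≤ i} R(δ, ν_j)`. -/
def oracleIS {Ω : Type*} {n : ℕ} (μ ε : Fin n → Ω → ℝ) (m : Fin n → (Fin n → ℝ) → ℝ)
    (i : Fin n) (ω : Ω) : ℝ :=
  m i (obs μ ε ω)
    + oracleDecision (Finset.Iic i) (centred μ ε m ω) (resid m (obs μ ε ω) i)

/-! ### Risks, little-o and the empirical distribution of the `ν_i` -/

/-- `E ‖estimate - μ‖²`, possibly infinite. -/
def risk {Ω : Type*} [MeasurableSpace Ω] (P : Measure Ω) {n : ℕ} (μ est : Fin n → Ω → ℝ) :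
    ℝ≥0∞ :=
  ∫⁻ ω, ENNReal.ofReal (∑ i, (est i ω - μ i ω) ^ 2) ∂P

/-- `A_n ≤ B_n + o(n)`. -/
def LeUpToLittleO (A B : ℕ → ℝ≥0∞) : Prop :=
  ∃ r : ℕ → ℝ, r =o[atTop] (fun n : ℕ => (n : ℝ)) ∧
    ∀ᶠ n in atTop, A n ≤ B n + ENNReal.ofReal (r n)

/-- The empirical distribution `n⁻¹ ∑ᵢ δ_{v_i}`. -/
def empirical {n : ℕ} (v : Fin n → ℝ) : Measure ℝ :=
  (n : ℝ≥0∞)⁻¹ • ∑ i, Measure.dirac (v i)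

/-- The random empirical distributions of the rows of `v` converge weakly to `G`, in probability. -/
def EmpiricalTendsto {Ω : Type*} [MeasurableSpace Ω] (P : Measure Ω)
    (v : ∀ n, Ω → Fin n → ℝ) (G : Measure ℝ) : Prop :=
  ∀ f : ℝ →ᵇ ℝ, TendstoInMeasure P (fun (n : ℕ) ω => ∫ x, f x ∂(empirical (v n ω))) atTop
    (fun _ => ∫ x, f x ∂G)

end

end SeqEB

namespace SeqEB

local notation "φ" => gaussianPDFReal 0 1
local notation "γ" => gaussianReal 0 1

/-! ### The standard normal density -/

/-! Everything rests on one fact. Given the states and the noise before time `i`, the centred state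
`ν_i` is fixed and `Z_i` is `N(ν_i, 1)`. `StdNormalNoise` expresses this as invariance of the joint
law under redrawing one noise coordinate. Sums of conditionally centred terms are then martingales,
with second moments given by `StdNormalNoise.lintegral_sq_sum_le`.

Estimator against oracle. Put `x = (log n)^(1/4)`, so that the bandwidth is `x⁻⁴`. The kernel
averages over `j < i` estimate `f_i` and its derivative. Their bias is small relative to the density
itself (`exists_smoothing_bias`), and their fluctuation is a martingale. Where `f_i(Z_i) ≥ x⁻¹⁶` and
the fluctuations are at most `x⁻¹⁹`, the two decisions differ by `O(x⁻²)` while the oracle moves its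
argument by `O(x)` (`exists_decision_bound`), so the losses differ by `O(x⁻¹)` times a factor with
bounded mean. Elsewhere the estimated decision still moves its argument by at most `2 x⁴`, because
`|K'| ≤ 2K`, and the exceptional events have total probability `O(n x⁻⁹ + x⁸⁰)`
(`StdNormalNoise.sum_measure_badEvent_le`). That `f_i(Z_i)` is rarely small comes from a pathwise
bound at each `z`, `sum_stdPDF_small_le`. The excess risk is `O(n x⁻¹ + x⁸⁸) = o(n)`.

Oracle against benchmark. Each `δ^i` minimizes a growing sum of risks, so following these minimizers
costs no more than using the last of them throughout (`sum_normalRisk_sequential_le`), and the last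
one beats every fixed rule. Up to `ζ_i`, the benchmark is the linear rule `z ↦ βz` with `β = 1 -
α_n`, but `β` depends on the data. The realized loss of a linear rule is quadratic in `β`, and its
randomness enters only through `∑ ν_i ε_i` and `∑ (ε_i² - 1)`, two martingales free of `β`. Hence
`sum_linear_risk_le` holds for all `β` at once. Times near the ends, or with large `ν_i`, are
discarded at a bounded cost each and a small cost overall (`sum_normalRisk_oracle_le`).

Strict improvement. The rule `z ↦ (1 - a)z` is Bayes for `G` only if the density `f` of `G ∗ N(0,1)`
satisfies `f' = -a z f`, which forces `G = N(0, (1-a)/a)`. Otherwise a compactly supported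
perturbation lowers the risk, and the reduction is the integral of a bounded continuous function of
the state (`exists_linear_improvement`). Weak convergence transfers it to the empirical distribution
of the `ν_i`, which gives a gain proportional to `n`. Since the oracle risk is at most `n`, this
additive gain becomes a ratio below one (`exists_ratio_lt_one`). -/

lemma stdPDF_eq (u : ℝ) : φ u = (√(2 * Real.pi))⁻¹ * Real.exp (-u ^ 2 / 2) := by
  simp [gaussianPDFReal]

lemma stdPDF_const_pos : 0 < (√(2 * Real.pi))⁻¹ := by positivity

lemma stdPDF_const_le_one : (√(2 * Real.pi))⁻¹ ≤ 1 := by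
  apply inv_le_one_of_one_le₀
  rw [Real.one_le_sqrt]
  nlinarith [Real.pi_gt_three]

lemma stdPDF_pos (u : ℝ) : 0 < φ u := gaussianPDFReal_pos 0 1 u one_ne_zero

lemma stdPDF_le_one (u : ℝ) : φ u ≤ 1 := by
  rw [stdPDF_eq]
  have h1 : Real.exp (-u ^ 2 / 2) ≤ 1 := Real.exp_le_one_iff.2 (by nlinarith [sq_nonneg u])
  exact mul_le_one₀ stdPDF_const_le_one (Real.exp_pos _).le h1

lemma continuous_stdPDF : Continuous φ := by
  have : (φ : ℝ → ℝ) = fun u => (√(2 * Real.pi))⁻¹ * Real.exp (-u ^ 2 / 2) := funext stdPDF_eq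
  rw [this]; fun_prop

lemma hasDerivAt_stdPDF (u : ℝ) : HasDerivAt φ (-u * φ u) u := by
  have : (φ : ℝ → ℝ) = fun u => (√(2 * Real.pi))⁻¹ * Real.exp (-u ^ 2 / 2) := funext stdPDF_eq
  rw [this]
  have h : HasDerivAt (fun u : ℝ => -u ^ 2 / 2) (-u) u := by
    have := ((hasDerivAt_id u).pow 2).neg.div_const 2
    exact this.congr_deriv (by simp; ring)
  exact (h.exp.const_mul _).congr_deriv (by ring)

lemma hasDerivAt_stdPDF_deriv (u : ℝ) :
    HasDerivAt (fun u => -u * φ u) ((u ^ 2 - 1) * φ u) u := by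
  have := (hasDerivAt_id u).neg.mul (hasDerivAt_stdPDF u)
  exact this.congr_deriv (by simp; ring)

/-- With `q = exp(-u²/32)` the density at `u` is a multiple of `q¹⁶`. Giving up one of the sixteen
factors pays for the polynomial and for the shift from `u` to `v`. -/
lemma exp_poly_le_of_near {u v : ℝ} (h : |v - u| ≤ 1) :
    (v ^ 2 + 1) * Real.exp (-v ^ 2 / 2) ≤ 64 * Real.exp 15 * Real.exp (-u ^ 2 / 32) ^ 15 := by
  -- Young's inequality `2|v| ≤ v²/30 + 30`. The weight fits because `15/32 · 31/30 = 31/64 = 1/2 -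
  -- 1/64`, the exponent left after `v²/64` has absorbed the polynomial.
  have hu : u ^ 2 ≤ 31 / 30 * v ^ 2 + 31 := by
    have h1 : |u| ≤ |v| + 1 := by
      have := abs_sub_abs_le_abs_sub u v
      rw [abs_sub_comm] at this
      linarith
    have h2 : u ^ 2 ≤ (|v| + 1) ^ 2 := by
      rw [← sq_abs u]; exact pow_le_pow_left₀ (abs_nonneg _) h1 2
    nlinarith [sq_abs v, sq_nonneg (|v| - 30)]
  have h1 : v ^ 2 + 1 ≤ 64 * Real.exp (v ^ 2 / 64) := by
    have := Real.add_one_le_exp (v ^ 2 / 64)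
    nlinarith [sq_nonneg v]
  have h2 : Real.exp (v ^ 2 / 64) * Real.exp (-v ^ 2 / 2)
      ≤ Real.exp 15 * Real.exp (-u ^ 2 / 32) ^ 15 := by
    rw [← Real.exp_nat_mul, ← Real.exp_add, ← Real.exp_add]
    apply Real.exp_le_exp.2
    push_cast
    nlinarith
  calc (v ^ 2 + 1) * Real.exp (-v ^ 2 / 2)
      ≤ 64 * Real.exp (v ^ 2 / 64) * Real.exp (-v ^ 2 / 2) := by gcongr
    _ = 64 * (Real.exp (v ^ 2 / 64) * Real.exp (-v ^ 2 / 2)) := by ring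
    _ ≤ 64 * (Real.exp 15 * Real.exp (-u ^ 2 / 32) ^ 15) := by gcongr
    _ = _ := by ring

/-- Splitting at `q = 1/x` restores the missing factor `q` for a factor `x`, at the price of an
absolute error `x⁻¹⁵`. -/
lemma pow_fifteen_le {q x : ℝ} (hq : 0 ≤ q) (hx : 0 < x) :
    q ^ 15 ≤ x * q ^ 16 + (x ^ 15)⁻¹ := by
  rcases le_total 1 (x * q) with h | h
  · have : q ^ 15 ≤ x * q ^ 16 := by
      calc q ^ 15 = 1 * q ^ 15 := by ring
        _ ≤ (x * q) * q ^ 15 := by gcongr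
        _ = x * q ^ 16 := by ring
    have h2 : 0 ≤ (x ^ 15)⁻¹ := by positivity
    linarith
  · have h1 : q ≤ x⁻¹ := by
      rw [← one_div, le_div_iff₀ hx]; linarith
    have h2 : q ^ 15 ≤ (x ^ 15)⁻¹ := by
      rw [← inv_pow]; gcongr
    have h3 : 0 ≤ x * q ^ 16 := by positivity
    linarith

/-- The derivatives of the normal density are bounded, near `u`, by a multiple of `φ(u)` that grows
slowly, up to a remainder that is a high power of the same scale. -/
lemma exists_stdPDF_deriv_bound : ∃ C : ℝ, 1 ≤ C ∧ ∀ x u v : ℝ, 1 ≤ x → |v - u| ≤ 1 →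
    (v ^ 2 + 1) * φ v ≤ C * (x * φ u + (x ^ 15)⁻¹) := by
  set c := (√(2 * Real.pi))⁻¹ with hc
  have hc0 : 0 < c := stdPDF_const_pos
  have hc1 : c ≤ 1 := stdPDF_const_le_one
  refine ⟨64 * Real.exp 15, ?_, fun x u v hx h => ?_⟩
  · have : 1 ≤ Real.exp 15 := Real.one_le_exp (by norm_num)
    linarith
  have h1 := exp_poly_le_of_near h
  have h2 := pow_fifteen_le (Real.exp_pos (-u ^ 2 / 32)).le (by linarith : 0 < x)
  have h3 : φ u = c * Real.exp (-u ^ 2 / 32) ^ 16 := by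
    rw [stdPDF_eq, ← Real.exp_nat_mul]; congr 2; push_cast; ring
  have h4 : 0 ≤ (x ^ 15)⁻¹ := by positivity
  calc (v ^ 2 + 1) * φ v = c * ((v ^ 2 + 1) * Real.exp (-v ^ 2 / 2)) := by rw [stdPDF_eq]; ring
    _ ≤ c * (64 * Real.exp 15 * (x * Real.exp (-u ^ 2 / 32) ^ 16 + (x ^ 15)⁻¹)) := by
        refine mul_le_mul_of_nonneg_left (h1.trans ?_) hc0.le
        exact mul_le_mul_of_nonneg_left h2 (by positivity)
    _ = 64 * Real.exp 15 * (x * φ u + c * (x ^ 15)⁻¹) := by rw [h3]; ring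
    _ ≤ _ := by
        gcongr
        exact mul_le_of_le_one_left h4 hc1

lemma abs_le_sq_add_one (v : ℝ) : |v| ≤ v ^ 2 + 1 := by
  rw [← sq_abs]; nlinarith [sq_nonneg (|v| - 1)]

lemma abs_stdPDF_deriv_le_one (u : ℝ) : |-u * φ u| ≤ 1 := by
  rw [abs_mul, abs_neg, abs_of_pos (stdPDF_pos u), stdPDF_eq]
  have h1 : |u| ≤ Real.exp (u ^ 2 / 2) := by
    have := Real.add_one_le_exp (u ^ 2 / 2)
    nlinarith [sq_abs u, sq_nonneg (|u| - 1)]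
  have h2 : |u| * Real.exp (-u ^ 2 / 2) ≤ 1 := by
    calc |u| * Real.exp (-u ^ 2 / 2) ≤ Real.exp (u ^ 2 / 2) * Real.exp (-u ^ 2 / 2) := by gcongr
      _ = 1 := by rw [← Real.exp_add]; simp [neg_div]
  calc |u| * ((√(2 * Real.pi))⁻¹ * Real.exp (-u ^ 2 / 2))
      = (√(2 * Real.pi))⁻¹ * (|u| * Real.exp (-u ^ 2 / 2)) := by ring
    _ ≤ 1 := mul_le_one₀ stdPDF_const_le_one (by positivity) h2

/-- Increments of the normal density and of its derivative. -/
lemma exists_stdPDF_increment_bound : ∃ C : ℝ, 1 ≤ C ∧ ∀ x u : ℝ, 1 ≤ x →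
    |-u * φ u| ≤ C * (x * φ u + (x ^ 15)⁻¹) ∧ ∀ s : ℝ,
    |φ (u + s) - φ u| ≤ C * |s| * (x * φ u + (x ^ 15)⁻¹) + 2 * |s| ^ 5 ∧
    |-(u + s) * φ (u + s) - -u * φ u| ≤ C * |s| * (x * φ u + (x ^ 15)⁻¹) + 2 * |s| ^ 5 := by
  obtain ⟨C, hC1, hC⟩ := exists_stdPDF_deriv_bound
  have hd : ∀ v, |-v * φ v| ≤ (v ^ 2 + 1) * φ v := fun v => by
    rw [abs_mul, abs_neg, abs_of_pos (stdPDF_pos v)]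
    exact mul_le_mul_of_nonneg_right (abs_le_sq_add_one v) (stdPDF_pos v).le
  have hd2 : ∀ v, |(v ^ 2 - 1) * φ v| ≤ (v ^ 2 + 1) * φ v := fun v => by
    rw [abs_mul, abs_of_pos (stdPDF_pos v)]
    refine mul_le_mul_of_nonneg_right ?_ (stdPDF_pos v).le
    rw [abs_le]; constructor <;> nlinarith [sq_nonneg v]
  refine ⟨C, hC1, fun x u hx => ⟨(hd u).trans (hC x u u hx (by simp)), fun s => ?_⟩⟩
  have hw : 0 ≤ x * φ u + (x ^ 15)⁻¹ := by have := stdPDF_pos u; positivity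
  -- Short increments use the mean value theorem. For long ones both functions are bounded by one,
  -- so the difference is at most `2 ≤ 2|s|⁵`. The fifth power becomes `σ⁵ = x⁻²⁰` after smoothing,
  -- below the tolerance `x⁻¹⁹`.
  rcases le_or_gt |s| 1 with hs | hs
  · have hmvt : ∀ (f f' : ℝ → ℝ), (∀ v, HasDerivAt f (f' v) v) →
        (∀ v, |f' v| ≤ (v ^ 2 + 1) * φ v) →
        |f (u + s) - f u| ≤ C * |s| * (x * φ u + (x ^ 15)⁻¹) + 2 * |s| ^ 5 := by
      intro f f' hf hf'
      have := (convex_Icc (u - 1) (u + 1)).norm_image_sub_le_of_norm_hasDerivWithin_le (f := f)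
        (f' := f') (C := C * (x * φ u + (x ^ 15)⁻¹)) (x := u) (y := u + s)
        (fun v _ => (hf v).hasDerivWithinAt)
        (fun v hv => (hf' v).trans (hC x u v hx (abs_le.2 ⟨by linarith [hv.1], by linarith [hv.2]⟩)))
        ⟨by linarith, by linarith⟩ ⟨by linarith [(abs_le.1 hs).1], by linarith [(abs_le.1 hs).2]⟩
      simp only [Real.norm_eq_abs, add_sub_cancel_left] at this
      have h5 : 0 ≤ 2 * |s| ^ 5 := by positivity
      linarith
    exact ⟨hmvt _ _ hasDerivAt_stdPDF hd, hmvt _ _ hasDerivAt_stdPDF_deriv hd2⟩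
  · have h5 : 1 ≤ |s| ^ 5 := one_le_pow₀ hs.le
    have h6 : 0 ≤ C * |s| * (x * φ u + (x ^ 15)⁻¹) := by positivity
    constructor
    · have h1 := abs_sub (φ (u + s)) (φ u)
      rw [abs_of_pos (stdPDF_pos _), abs_of_pos (stdPDF_pos _)] at h1
      linarith [stdPDF_le_one (u + s), stdPDF_le_one u]
    · have h1 := abs_sub (-(u + s) * φ (u + s)) (-u * φ u)
      linarith [abs_stdPDF_deriv_le_one (u + s), abs_stdPDF_deriv_le_one u]

/-! ### The logistic kernel -/

/-- The derivative of the logistic kernel. -/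
noncomputable def kernDeriv (x : ℝ) : ℝ :=
  -4 * (Real.exp x - Real.exp (-x)) / (Real.exp x + Real.exp (-x)) ^ 3

lemma kern_pos (x : ℝ) : 0 < kern x := by unfold kern; positivity

lemma two_le_exp_add_exp_neg (x : ℝ) : 2 ≤ Real.exp x + Real.exp (-x) := by
  have h : Real.exp x * Real.exp (-x) = 1 := by rw [← Real.exp_add]; simp
  nlinarith [sq_nonneg (Real.exp x - Real.exp (-x)), Real.exp_pos x, Real.exp_pos (-x)]

lemma kern_le_half (x : ℝ) : kern x ≤ 1 / 2 := by
  unfold kern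
  rw [div_le_div_iff₀ (by positivity) (by norm_num)]
  nlinarith [two_le_exp_add_exp_neg x]

lemma continuous_kern : Continuous kern := by
  unfold kern
  exact continuous_const.div (by fun_prop) fun x => pow_ne_zero 2 (by positivity)

lemma continuous_kernDeriv : Continuous kernDeriv := by
  unfold kernDeriv
  exact Continuous.div (by fun_prop) (by fun_prop) fun x => by positivity

lemma hasDerivAt_kern (x : ℝ) : HasDerivAt kern (kernDeriv x) x := by
  have h1 : HasDerivAt (fun x => Real.exp x + Real.exp (-x)) (Real.exp x - Real.exp (-x)) x := by
    have := (Real.hasDerivAt_exp x).add ((hasDerivAt_neg x).exp)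
    exact this.congr_deriv (by ring)
  have h2 := (hasDerivAt_const x (2 : ℝ)).div (h1.pow 2) (by simp only [Pi.pow_apply]; positivity)
  refine h2.congr_deriv ?_
  unfold kernDeriv
  have : Real.exp x + Real.exp (-x) ≠ 0 := by positivity
  simp
  field_simp
  ring

lemma abs_kernDeriv_le (x : ℝ) : |kernDeriv x| ≤ 2 * kern x := by
  have hp : 0 < Real.exp x + Real.exp (-x) := by positivity
  have h1 : |Real.exp x - Real.exp (-x)| ≤ Real.exp x + Real.exp (-x) := by
    rw [abs_le]; constructor <;> linarith [Real.exp_pos x, Real.exp_pos (-x)]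
  unfold kernDeriv kern
  rw [abs_div, abs_mul, abs_of_pos (pow_pos hp 3)]
  calc |(-4 : ℝ)| * |Real.exp x - Real.exp (-x)| / (Real.exp x + Real.exp (-x)) ^ 3
      ≤ 4 * (Real.exp x + Real.exp (-x)) / (Real.exp x + Real.exp (-x)) ^ 3 := by
        gcongr; norm_num
    _ = _ := by field_simp; norm_num

lemma kern_le_exp (x : ℝ) : kern x ≤ 2 * Real.exp (-|x|) := by
  have h : Real.exp |x| ≤ (Real.exp x + Real.exp (-x)) ^ 2 := by
    have h2 := two_le_exp_add_exp_neg x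
    have : Real.exp |x| ≤ Real.exp x + Real.exp (-x) := by
      rcases abs_cases x with ⟨h, _⟩ | ⟨h, _⟩ <;> rw [h] <;>
        linarith [Real.exp_pos x, Real.exp_pos (-x)]
    nlinarith
  unfold kern
  rw [Real.exp_neg |x|, ← div_eq_mul_inv]
  gcongr

/-- Integrable domination for kernel moments up to the fifth, the order in the increment bound. Two
further powers make the majorant integrable, hence the seventh term of the exponential series and
`5040 = 7!`. -/
lemma kern_mul_poly_le (y : ℝ) : kern y * (1 + |y| ^ 5) ≤ 8 * (1 + 5040) * (1 + y ^ 2)⁻¹ := by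
  have ht : 0 ≤ |y| := abs_nonneg y
  have h1 : |y| ^ 7 ≤ 5040 * Real.exp |y| := by
    have := Real.pow_div_factorial_le_exp _ ht 7
    rw [div_le_iff₀ (by positivity)] at this
    norm_num [Nat.factorial] at this
    linarith
  have h2 : 1 ≤ Real.exp |y| := Real.one_le_exp ht
  have h3 : (1 + |y| ^ 5) * (1 + y ^ 2) ≤ 4 * (1 + |y| ^ 7) := by
    rw [← sq_abs y]
    generalize |y| = t at *
    rcases le_total t 1 with h | h
    · have a1 : t ^ 5 ≤ 1 := pow_le_one₀ ht h
      have a2 : t ^ 2 ≤ 1 := pow_le_one₀ ht h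
      have a3 : 0 ≤ t ^ 7 := by positivity
      nlinarith [pow_nonneg ht 5, pow_nonneg ht 2]
    · have a1 : t ^ 5 ≤ t ^ 7 := pow_le_pow_right₀ h (by norm_num)
      have a2 : t ^ 2 ≤ t ^ 7 := pow_le_pow_right₀ h (by norm_num)
      nlinarith
  rw [← div_eq_mul_inv, le_div_iff₀ (by positivity)]
  calc kern y * (1 + |y| ^ 5) * (1 + y ^ 2) = kern y * ((1 + |y| ^ 5) * (1 + y ^ 2)) := by ring
    _ ≤ (2 * Real.exp (-|y|)) * (4 * (1 + |y| ^ 7)) := by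
        gcongr
        exact kern_le_exp y
    _ ≤ (2 * Real.exp (-|y|)) * (4 * (Real.exp |y| + 5040 * Real.exp |y|)) := by gcongr
    _ = 8 * (1 + 5040) * (Real.exp (-|y|) * Real.exp |y|) := by ring
    _ = _ := by rw [← Real.exp_add]; simp

lemma integrable_kern_mul {f : ℝ → ℝ} (hf : Continuous f) (C : ℝ)
    (hb : ∀ y, |f y| ≤ C * (1 + |y| ^ 5)) : Integrable fun y => kern y * f y := by
  refine ((integrable_inv_one_add_sq.const_mul (8 * (1 + 5040))).const_mul C).mono'
    (continuous_kern.mul hf).aestronglyMeasurable (ae_of_all _ fun y => ?_)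
  have hC : 0 ≤ C := by
    have := (abs_nonneg _).trans (hb 0)
    simpa using this
  rw [Real.norm_eq_abs, abs_mul, abs_of_pos (kern_pos y)]
  calc kern y * |f y| ≤ kern y * (C * (1 + |y| ^ 5)) := by
        gcongr
        · exact (kern_pos y).le
        · exact hb y
    _ = C * (kern y * (1 + |y| ^ 5)) := by ring
    _ ≤ _ := mul_le_mul_of_nonneg_left (kern_mul_poly_le y) hC

lemma integrable_kern : Integrable kern := by
  simpa using integrable_kern_mul (continuous_const (y := (1 : ℝ))) 1 (fun y => by
    simp)

lemma integrable_kernDeriv : Integrable kernDeriv :=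
  (integrable_kern.const_mul 2).mono' continuous_kernDeriv.aestronglyMeasurable
    (ae_of_all _ fun y => by simpa using abs_kernDeriv_le y)

lemma integral_kern : ∫ y, kern y = 1 := by
  have hd : ∀ x, HasDerivAt (fun x : ℝ => (1 + Real.exp (-2 * x))⁻¹) (kern x) x := by
    intro x
    have h1 : HasDerivAt (fun x : ℝ => 1 + Real.exp (-2 * x)) (Real.exp (-2 * x) * (-2)) x := by
      have := (((hasDerivAt_id x).const_mul (-2 : ℝ)).exp).const_add 1
      exact this.congr_deriv (by simp)
    refine (h1.inv (by positivity)).congr_deriv ?_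
    unfold kern
    have e1 : Real.exp (-2 * x) = Real.exp (-x) ^ 2 := by
      rw [← Real.exp_nat_mul]; congr 1; push_cast; ring
    have e2 : Real.exp (-x) = (Real.exp x)⁻¹ := Real.exp_neg x
    have e3 : 0 < Real.exp x := Real.exp_pos x
    rw [e1, e2]
    field_simp
  have ht : Tendsto (fun x : ℝ => (1 + Real.exp (-2 * x))⁻¹) atTop (𝓝 1) := by
    have h : Tendsto (fun x : ℝ => Real.exp (-2 * x)) atTop (𝓝 0) :=
      Real.tendsto_exp_atBot.comp (tendsto_id.const_mul_atTop_of_neg (by norm_num))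
    simpa using (h.const_add 1).inv₀ (by norm_num)
  have hb : Tendsto (fun x : ℝ => (1 + Real.exp (-2 * x))⁻¹) atBot (𝓝 0) := by
    have h : Tendsto (fun x : ℝ => Real.exp (-2 * x)) atBot atTop :=
      Real.tendsto_exp_atTop.comp (tendsto_id.const_mul_atBot_of_neg (by norm_num))
    exact (tendsto_atTop_add_const_left _ 1 h).inv_tendsto_atTop
  have := integral_of_hasDerivAt_of_tendsto hd integrable_kern hb ht
  simpa using this

/-! ### Smoothing the normal density with the kernel -/

/-- The density `φ` smoothed by the kernel at bandwidth `σ`. -/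
noncomputable def smoothPDF (σ u : ℝ) : ℝ := ∫ y, kern y * φ (u + σ * y)

/-- The derivative of `φ` smoothed by the kernel at bandwidth `σ`. -/
noncomputable def smoothPDFDeriv (σ u : ℝ) : ℝ :=
  ∫ y, kern y * (-(u + σ * y) * φ (u + σ * y))

lemma integrable_kern_mul_of_bounded {f : ℝ → ℝ} (hf : Continuous f) (C : ℝ)
    (hb : ∀ y, |f y| ≤ C) : Integrable fun y => kern y * f y :=
  integrable_kern_mul hf C fun y => by
    have hC : 0 ≤ C := (abs_nonneg _).trans (hb 0)
    have : 0 ≤ C * |y| ^ 5 := by positivity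
    linarith [hb y]

/-- The bias of kernel smoothing is a small multiple of the density, up to a small remainder. -/
lemma exists_smoothing_bias : ∃ C : ℝ, 1 ≤ C ∧ ∀ x u : ℝ, 1 ≤ x →
    |-u * φ u| ≤ C * (x * φ u + (x ^ 15)⁻¹) ∧ ∀ σ : ℝ, 0 ≤ σ →
    |smoothPDF σ u - φ u| ≤ C * σ * (x * φ u + (x ^ 15)⁻¹) + C * σ ^ 5 ∧
    |smoothPDFDeriv σ u - -u * φ u| ≤ C * σ * (x * φ u + (x ^ 15)⁻¹) + C * σ ^ 5 := by
  obtain ⟨C, hC1, hC⟩ := exists_stdPDF_increment_bound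
  set m1 := ∫ y, kern y * |y| with hm1
  set m5 := ∫ y, kern y * |y| ^ 5 with hm5
  have i1 : Integrable fun y => kern y * |y| := integrable_kern_mul continuous_abs 1 fun y => by
    rw [abs_abs, one_mul]
    rcases le_total |y| 1 with h | h
    · have : 0 ≤ |y| ^ 5 := by positivity
      linarith
    · have : |y| ≤ |y| ^ 5 := le_self_pow₀ h (by norm_num)
      linarith
  have i5 : Integrable fun y => kern y * |y| ^ 5 :=
    integrable_kern_mul (continuous_abs.pow 5) 1 fun y => by
      rw [abs_pow, abs_abs, one_mul]; linarith
  have n1 : 0 ≤ m1 := integral_nonneg fun y => mul_nonneg (kern_pos y).le (abs_nonneg _)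
  have n5 : 0 ≤ m5 := integral_nonneg fun y => mul_nonneg (kern_pos y).le (by positivity)
  refine ⟨C * (1 + m1) + 2 * m5, by nlinarith, fun x u hx => ?_⟩
  obtain ⟨h1, h2⟩ := hC x u hx
  have hw : 0 ≤ x * φ u + (x ^ 15)⁻¹ := by have := stdPDF_pos u; positivity
  refine ⟨h1.trans ?_, fun σ hσ => ?_⟩
  · gcongr; nlinarith
  have main : ∀ f : ℝ → ℝ, Continuous f → (∀ v, |f v| ≤ 1) →
      (∀ s, |f (u + s) - f u| ≤ C * |s| * (x * φ u + (x ^ 15)⁻¹) + 2 * |s| ^ 5) →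
      |(∫ y, kern y * f (u + σ * y)) - f u| ≤
        (C * (1 + m1) + 2 * m5) * σ * (x * φ u + (x ^ 15)⁻¹) +
          (C * (1 + m1) + 2 * m5) * σ ^ 5 := by
    intro f hf hb hs
    have e1 : (∫ y, kern y * f (u + σ * y)) - f u
        = ∫ y, kern y * (f (u + σ * y) - f u) := by
      have : (fun y => kern y * (f (u + σ * y) - f u))
          = fun y => kern y * f (u + σ * y) - kern y * f u := by ext y; ring
      rw [this, integral_sub, integral_mul_const, integral_kern, one_mul]
      · exact integrable_kern_mul_of_bounded (by fun_prop) 1 fun y => hb _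
      · exact integrable_kern.mul_const _
    rw [e1]
    have e2 : ∫ y, (C * σ * (x * φ u + (x ^ 15)⁻¹) * (kern y * |y|)
        + 2 * σ ^ 5 * (kern y * |y| ^ 5))
        = C * σ * (x * φ u + (x ^ 15)⁻¹) * m1 + 2 * σ ^ 5 * m5 := by
      rw [integral_add (i1.const_mul _) (i5.const_mul _), integral_const_mul, integral_const_mul]
    calc |∫ y, kern y * (f (u + σ * y) - f u)|
        ≤ ∫ y, (C * σ * (x * φ u + (x ^ 15)⁻¹) * (kern y * |y|)
          + 2 * σ ^ 5 * (kern y * |y| ^ 5)) := by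
          rw [← Real.norm_eq_abs]
          refine norm_integral_le_of_norm_le ((i1.const_mul _).add (i5.const_mul _))
            (ae_of_all _ fun y => ?_)
          rw [Real.norm_eq_abs, abs_mul, abs_of_pos (kern_pos y)]
          have := hs (σ * y)
          rw [abs_mul, abs_of_nonneg hσ] at this
          calc kern y * |f (u + σ * y) - f u|
              ≤ kern y * (C * (σ * |y|) * (x * φ u + (x ^ 15)⁻¹) + 2 * (σ * |y|) ^ 5) := by
                have := (kern_pos y).le
                gcongr
            _ = _ := by ring
      _ = C * σ * (x * φ u + (x ^ 15)⁻¹) * m1 + 2 * σ ^ 5 * m5 := e2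
      _ ≤ _ := by
          have a1 : 0 ≤ σ * (x * φ u + (x ^ 15)⁻¹) := by positivity
          have a2 : 0 ≤ σ ^ 5 := by positivity
          have a3 : 0 ≤ C * σ * (x * φ u + (x ^ 15)⁻¹) + 2 * m5 * (σ * (x * φ u + (x ^ 15)⁻¹)) := by
            positivity
          have a4 : 0 ≤ C * (1 + m1) * σ ^ 5 := by positivity
          linarith
  exact ⟨main φ continuous_stdPDF
      (fun v => by rw [abs_of_pos (stdPDF_pos v)]; exact stdPDF_le_one v) (fun s => (h2 s).1),
    main (fun v => -v * φ v) (continuous_neg.mul continuous_stdPDF) abs_stdPDF_deriv_le_one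
      (fun s => (h2 s).2)⟩

/-- The mean of the kernel density estimate from one observation. -/
lemma integral_kern_stdNormal {σ : ℝ} (hσ : 0 < σ) (v z : ℝ) :
    ∫ e, σ⁻¹ * kern ((v + e - z) / σ) ∂γ = smoothPDF σ (z - v) := by
  rw [integral_gaussianReal_eq_integral_smul one_ne_zero]
  have h := Measure.integral_comp_mul_left
    (fun e => φ (z - v + e) * kern (e / σ)) σ
  have h2 := integral_sub_right_eq_self
    (fun e => φ (z - v + e) * kern (e / σ)) (z - v) (μ := (volume : Measure ℝ))
  unfold smoothPDF
  rw [abs_of_pos (inv_pos.2 hσ), smul_eq_mul, ← h2] at h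
  rw [← integral_const_mul] at h
  calc _ = ∫ y, φ (z - v + σ * y) * kern (σ * y / σ) := by
        rw [h]; congr 1; ext e; simp only [smul_eq_mul]
        rw [show z - v + (e - (z - v)) = e by ring, show e - (z - v) = v + e - z by ring]; ring
    _ = _ := by
        congr 1; ext y; rw [mul_div_cancel_left₀ _ hσ.ne', mul_comm]

lemma integral_kernDeriv_stdNormal {σ : ℝ} (hσ : 0 < σ) (v z : ℝ) :
    ∫ e, -(σ⁻¹ * σ⁻¹ * kernDeriv ((v + e - z) / σ)) ∂γ = smoothPDFDeriv σ (z - v) := by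
  rw [integral_gaussianReal_eq_integral_smul one_ne_zero]
  have h := Measure.integral_comp_mul_left
    (fun e => φ (z - v + e) * -(σ⁻¹ * kernDeriv (e / σ))) σ
  have h2 := integral_sub_right_eq_self
    (fun e => φ (z - v + e) * -(σ⁻¹ * kernDeriv (e / σ))) (z - v) (μ := (volume : Measure ℝ))
  rw [abs_of_pos (inv_pos.2 hσ), smul_eq_mul, ← h2] at h
  rw [← integral_const_mul] at h
  -- Integration by parts moves the derivative from the kernel to the normal density. The mean of
  -- the derivative of the estimate is thus the smoothed derivative of `φ`.
  have h3 : ∫ y, φ (z - v + σ * y) * kernDeriv y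
      = -∫ y, (-(z - v + σ * y) * φ (z - v + σ * y) * σ) * kern y := by
    refine integral_mul_deriv_eq_deriv_mul_of_integrable (u := fun y => φ (z - v + σ * y))
      (u' := fun y => -(z - v + σ * y) * φ (z - v + σ * y) * σ) (v := kern) (v' := kernDeriv)
      (fun y _ => ?_) (fun y _ => hasDerivAt_kern y) ?_ ?_ ?_
    · have h1 : HasDerivAt (fun y : ℝ => z - v + σ * y) σ y := by
        simpa using ((hasDerivAt_id y).const_mul σ).const_add (z - v)
      exact (hasDerivAt_stdPDF _).comp y h1
    · refine integrable_kernDeriv.bdd_mul (c := 1)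
        (continuous_stdPDF.comp (by fun_prop)).aestronglyMeasurable (ae_of_all _ fun y => ?_)
      rw [Real.norm_eq_abs, abs_of_pos (stdPDF_pos _)]
      exact stdPDF_le_one _
    · have : Continuous fun y => -(z - v + σ * y) * φ (z - v + σ * y) * σ :=
        ((continuous_neg.mul continuous_stdPDF).comp (g := fun v : ℝ => -v * φ v)
          (f := fun y => z - v + σ * y) (by fun_prop)).mul continuous_const
      refine integrable_kern.bdd_mul (c := σ) this.aestronglyMeasurable (ae_of_all _ fun y => ?_)
      rw [Real.norm_eq_abs, abs_mul, abs_of_pos hσ]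
      exact mul_le_of_le_one_left hσ.le (abs_stdPDF_deriv_le_one _)
    · refine integrable_kern.bdd_mul (c := 1)
        (continuous_stdPDF.comp (by fun_prop)).aestronglyMeasurable (ae_of_all _ fun y => ?_)
      rw [Real.norm_eq_abs, abs_of_pos (stdPDF_pos _)]
      exact stdPDF_le_one _
  unfold smoothPDFDeriv
  calc _ = ∫ y, φ (z - v + σ * y) * -(σ⁻¹ * kernDeriv (σ * y / σ)) := by
        rw [h]; congr 1; ext e; simp only [smul_eq_mul]
        rw [show z - v + (e - (z - v)) = e by ring, show e - (z - v) = v + e - z by ring]; ring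
    _ = -(σ⁻¹) * ∫ y, φ (z - v + σ * y) * kernDeriv y := by
        rw [← integral_const_mul]
        congr 1; ext y; rw [mul_div_cancel_left₀ _ hσ.ne']; ring
    _ = _ := by
        rw [h3, neg_mul_neg, ← integral_const_mul]
        congr 1; ext y; field_simp

end SeqEB

namespace SeqEB

local notation "φ" => gaussianPDFReal 0 1
local notation "γ" => gaussianReal 0 1

/-! ### The estimated and the oracle decision function -/

lemma hasDerivAt_kernelDensity {ι : Type*} {σ : ℝ} (hσ : 0 < σ) (s : Finset ι) (x : ι → ℝ)
    (z : ℝ) : HasDerivAt (kernelDensity σ s x)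
      ((s.card : ℝ)⁻¹ * ∑ j ∈ s, -(σ⁻¹ * σ⁻¹ * kernDeriv ((x j - z) / σ))) z := by
  unfold kernelDensity
  refine HasDerivAt.const_mul _ (HasDerivAt.fun_sum fun j _ => ?_)
  have h1 : HasDerivAt (fun z : ℝ => (x j - z) / σ) (-1 / σ) z :=
    ((hasDerivAt_id z).const_sub (x j)).div_const σ
  exact (((hasDerivAt_kern _).comp z h1).const_mul σ⁻¹).congr_deriv (by field_simp)

/-- The bound `|K'| ≤ 2K` passes to the ratio of the two kernel sums. It needs no lower bound on the
density and so controls the loss on exceptional events. For empty `s` the quotient is `0/0 = 0`. -/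
lemma abs_estDecision_sub_le {ι : Type*} {σ : ℝ} (hσ : 0 < σ) (s : Finset ι) (x : ι → ℝ)
    (z : ℝ) : |estDecision σ s x z - z| ≤ 2 / σ := by
  unfold estDecision
  rw [add_sub_cancel_left, (hasDerivAt_kernelDensity hσ s x z).deriv, kernelDensity]
  have h0 : 0 ≤ (s.card : ℝ)⁻¹ * ∑ j ∈ s, σ⁻¹ * kern ((x j - z) / σ) :=
    mul_nonneg (by positivity) (Finset.sum_nonneg fun j _ =>
      mul_nonneg (by positivity) (kern_pos _).le)
  rw [abs_div, abs_of_nonneg h0]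
  refine div_le_of_le_mul₀ h0 (by positivity) ?_
  rw [abs_mul, abs_of_nonneg (by positivity : 0 ≤ (s.card : ℝ)⁻¹)]
  rw [show 2 / σ * ((s.card : ℝ)⁻¹ * ∑ j ∈ s, σ⁻¹ * kern ((x j - z) / σ))
    = (s.card : ℝ)⁻¹ * ∑ j ∈ s, 2 / σ * (σ⁻¹ * kern ((x j - z) / σ)) by
      rw [mul_left_comm, Finset.mul_sum]]
  refine mul_le_mul_of_nonneg_left ((Finset.abs_sum_le_sum_abs _ _).trans
    (Finset.sum_le_sum fun j _ => ?_)) (by positivity)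
  rw [abs_neg, abs_mul, abs_of_nonneg (by positivity : 0 ≤ σ⁻¹ * σ⁻¹)]
  calc σ⁻¹ * σ⁻¹ * |kernDeriv ((x j - z) / σ)|
      ≤ σ⁻¹ * σ⁻¹ * (2 * kern ((x j - z) / σ)) := by gcongr; exact abs_kernDeriv_le _
    _ = _ := by field_simp

/-- Stability of a quotient when both errors are measured relative to `F`; `d ≤ 1/2` keeps `A` above
`F/2`. -/
lemma abs_div_sub_div_le {F F' A A' d k : ℝ} (hF : 0 < F) (hA : |A - F| ≤ d * F)
    (hA' : |A' - F'| ≤ d * F) (hF' : |F'| ≤ k * F) (hd : d ≤ 1 / 2) (hk : 0 ≤ k) :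
    |A' / A - F' / F| ≤ 2 * d * (1 + k) := by
  have hd0 : 0 ≤ d := by
    by_contra h
    push Not at h
    have := (abs_nonneg _).trans hA
    nlinarith
  have hAF : F / 2 ≤ A := by nlinarith [(abs_le.1 hA).1]
  have hA0 : 0 < A := by linarith
  have e : A' / A - F' / F = ((A' - F') * F - F' * (A - F)) / (A * F) := by field_simp; ring
  rw [e, abs_div, abs_of_pos (mul_pos hA0 hF), div_le_iff₀ (mul_pos hA0 hF)]
  calc |(A' - F') * F - F' * (A - F)| ≤ |(A' - F') * F| + |F' * (A - F)| := abs_sub _ _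
    _ = |A' - F'| * F + |F'| * |A - F| := by rw [abs_mul, abs_mul, abs_of_pos hF]
    _ ≤ d * F * F + k * F * (d * F) := by gcongr
    _ = (d * (1 + k)) * (F * F) := by ring
    _ ≤ (d * (1 + k)) * ((2 * A) * F) := by gcongr; linarith
    _ = _ := by ring

/-- The estimator averages over `j < i` and the oracle over `j ≤ i`. The extra point changes a
bounded average by the order of the reciprocal sample size. -/
lemma abs_average_insert_sub_le {ι : Type*} [DecidableEq ι] {s : Finset ι} {i : ι} (hi : i ∉ s)
    (hs : s.Nonempty) (g : ι → ℝ) (hg : ∀ j, |g j| ≤ 1) :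
    |(s.card : ℝ)⁻¹ * ∑ j ∈ s, g j - ((insert i s).card : ℝ)⁻¹ * ∑ j ∈ insert i s, g j|
      ≤ 2 * (s.card : ℝ)⁻¹ := by
  have hN : 0 < (s.card : ℝ) := by exact_mod_cast hs.card_pos
  rw [Finset.card_insert_of_notMem hi, Finset.sum_insert hi]
  set N := (s.card : ℝ)
  have hS : |∑ j ∈ s, g j| ≤ N := by
    calc |∑ j ∈ s, g j| ≤ ∑ j ∈ s, |g j| := Finset.abs_sum_le_sum_abs _ _
      _ ≤ ∑ j ∈ s, (1 : ℝ) := Finset.sum_le_sum fun j _ => hg j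
      _ = N := by simp [N]
  push_cast
  have e : N⁻¹ * ∑ j ∈ s, g j - (N + 1)⁻¹ * (g i + ∑ j ∈ s, g j)
      = (∑ j ∈ s, g j - N * g i) / (N * (N + 1)) := by field_simp; ring
  rw [e, abs_div, abs_of_pos (by positivity : 0 < N * (N + 1)), div_le_iff₀ (by positivity)]
  have h1 : |N * g i| ≤ N := by
    rw [abs_mul, abs_of_pos hN]; exact mul_le_of_le_one_right hN.le (hg i)
  calc |∑ j ∈ s, g j - N * g i| ≤ |∑ j ∈ s, g j| + |N * g i| := abs_sub _ _
    _ ≤ 2 * (N + 1) := by linarith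
    _ = _ := by field_simp

lemma average_affine {ι : Type*} {s : Finset ι} (hs : s.Nonempty) (f : ι → ℝ) (a b c d : ℝ) :
    (s.card : ℝ)⁻¹ * ∑ j ∈ s, (a * (b * f j + c) + d)
      = a * (b * ((s.card : ℝ)⁻¹ * ∑ j ∈ s, f j) + c) + d := by
  have hN : (s.card : ℝ) ≠ 0 := by exact_mod_cast hs.card_pos.ne'
  rw [Finset.sum_add_distrib, ← Finset.mul_sum, Finset.sum_add_distrib,
    ← Finset.mul_sum, Finset.sum_const, Finset.sum_const, nsmul_eq_mul, nsmul_eq_mul]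
  field_simp

set_option maxHeartbeats 800000 in
/-- Pathwise comparison of the estimated with the oracle decision function, at a point where the
oracle density is not small and the kernel sums are close to their conditional means. -/
lemma exists_decision_bound : ∃ C : ℝ, 1 ≤ C ∧ ∀ {ι : Type*} [DecidableEq ι] (s : Finset ι) (i : ι)
    (ν Z : ι → ℝ) (x z : ℝ), i ∉ s → C ≤ x → x ^ 80 ≤ s.card →
    (x ^ 16)⁻¹ ≤ mixDensity (insert i s) ν z →
    |(s.card : ℝ)⁻¹ * ∑ j ∈ s, ((x ^ 4)⁻¹⁻¹ * kern ((Z j - z) / (x ^ 4)⁻¹)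
      - smoothPDF (x ^ 4)⁻¹ (z - ν j))| ≤ (x ^ 19)⁻¹ →
    |(s.card : ℝ)⁻¹ * ∑ j ∈ s, (-((x ^ 4)⁻¹⁻¹ * (x ^ 4)⁻¹⁻¹ * kernDeriv ((Z j - z) / (x ^ 4)⁻¹))
      - smoothPDFDeriv (x ^ 4)⁻¹ (z - ν j))| ≤ (x ^ 19)⁻¹ →
    |estDecision (x ^ 4)⁻¹ s Z z - oracleDecision (insert i s) ν z| ≤ C * (x ^ 2)⁻¹ ∧
    |oracleDecision (insert i s) ν z - z| ≤ C * x := by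
  obtain ⟨C, hC1, hC⟩ := exists_smoothing_bias
  -- `48 = 16 + 32` collects the two parts of the quotient error at the end. The requirement `x ≥ 48
  -- C²` also makes the relative error `8C x⁻³` at most `1/2`.
  refine ⟨48 * C ^ 2, by nlinarith, ?_⟩
  intro ι _ s i ν Z x z hi hCx hcard hF hM hM'
  have hx1 : 1 ≤ x := by nlinarith
  have hx0 : 0 < x := by linarith
  set σ := (x ^ 4)⁻¹ with hσdef
  have hσ : 0 < σ := by positivity
  have hN : 0 < (s.card : ℝ) := lt_of_lt_of_le (by positivity) hcard
  have hs : s.Nonempty := Finset.card_pos.1 (by exact_mod_cast hN)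
  have hiN : 0 ≤ (s.card : ℝ)⁻¹ := by positivity
  set y := x⁻¹ with hy
  have hy0 : 0 < y := by positivity
  have hxy : x * y = 1 := mul_inv_cancel₀ hx0.ne'
  have hy1 : y ≤ 1 := inv_le_one_of_one_le₀ hx1
  simp only [← inv_pow] at *
  rw [← hy] at *
  have hcard' : (s.card : ℝ)⁻¹ ≤ y ^ 19 := by
    calc (s.card : ℝ)⁻¹ ≤ (x ^ 80)⁻¹ := by gcongr
      _ = y ^ 80 := by rw [← inv_pow]
      _ ≤ y ^ 19 := pow_le_pow_of_le_one hy0.le hy1 (by norm_num)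
  set F := mixDensity (insert i s) ν z with hFdef
  have hF0 : 0 < F := lt_of_lt_of_le (by positivity) hF
  set F' := ((insert i s).card : ℝ)⁻¹ * ∑ j ∈ insert i s, φ (z - ν j) * (ν j - z) with hF'def
  have horacle : oracleDecision (insert i s) ν z = z + F' / F := by
    rw [oracleDecision, (mixDensity_hasDerivAt _ ν z).deriv]
  set A := kernelDensity σ s Z z with hA
  set A' := (s.card : ℝ)⁻¹ * ∑ j ∈ s, -(σ⁻¹ * σ⁻¹ * kernDeriv ((Z j - z) / σ)) with hA'
  have hest : estDecision σ s Z z = z + A' / A := by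
    rw [estDecision, (hasDerivAt_kernelDensity hσ s Z z).deriv]
  set F0 := (s.card : ℝ)⁻¹ * ∑ j ∈ s, φ (z - ν j) with hF0def
  have hg1 : |F0 - F| ≤ 2 * y ^ 19 := by
    have := abs_average_insert_sub_le hi hs (fun j => φ (z - ν j)) fun j => by
      rw [abs_of_pos (stdPDF_pos _)]; exact stdPDF_le_one _
    exact this.trans (by linarith)
  have hF'eq : F' = ((insert i s).card : ℝ)⁻¹ * ∑ j ∈ insert i s, -(z - ν j) * φ (z - ν j) := by
    rw [hF'def]; congr 1; exact Finset.sum_congr rfl fun j _ => by ring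
  have hg2 : |(s.card : ℝ)⁻¹ * ∑ j ∈ s, (-(z - ν j) * φ (z - ν j)) - F'| ≤ 2 * y ^ 19 := by
    have := abs_average_insert_sub_le hi hs (fun j => -(z - ν j) * φ (z - ν j))
      fun j => abs_stdPDF_deriv_le_one _
    rw [← hF'eq] at this
    exact this.trans (by linarith)
  have hpow : σ = y ^ 4 := hσdef
  have hbias : ∀ f g : ℝ → ℝ, (∀ u, |g u - f u| ≤ C * σ * (x * φ u + y ^ 15) + C * σ ^ 5) →
      |(s.card : ℝ)⁻¹ * ∑ j ∈ s, g (z - ν j) - (s.card : ℝ)⁻¹ * ∑ j ∈ s, f (z - ν j)|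
        ≤ C * y ^ 3 * F + 4 * C * y ^ 19 := by
    intro f g h
    rw [← mul_sub, ← Finset.sum_sub_distrib, abs_mul, abs_of_nonneg hiN]
    have h1 : (s.card : ℝ)⁻¹ * |∑ j ∈ s, (g (z - ν j) - f (z - ν j))|
        ≤ C * σ * (x * F0 + y ^ 15) + C * σ ^ 5 := by
      calc (s.card : ℝ)⁻¹ * |∑ j ∈ s, (g (z - ν j) - f (z - ν j))|
          ≤ (s.card : ℝ)⁻¹ * ∑ j ∈ s, (C * σ * (x * φ (z - ν j) + y ^ 15) + C * σ ^ 5) :=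
            mul_le_mul_of_nonneg_left ((Finset.abs_sum_le_sum_abs _ _).trans
              (Finset.sum_le_sum fun j _ => h _)) hiN
        _ = _ := by
            rw [average_affine hs]
    refine h1.trans ?_
    have h2 : F0 ≤ F + 2 * y ^ 19 := by linarith [(abs_le.1 hg1).2]
    rw [hpow]
    have a1 : y ^ 22 ≤ y ^ 19 := pow_le_pow_of_le_one hy0.le hy1 (by norm_num)
    have a2 : y ^ 20 ≤ y ^ 19 := pow_le_pow_of_le_one hy0.le hy1 (by norm_num)
    have e1 : C * y ^ 4 * (x * F0 + y ^ 15) + C * (y ^ 4) ^ 5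
        = C * y ^ 3 * (x * y) * F0 + C * y ^ 19 + C * y ^ 20 := by ring
    rw [e1, hxy]
    have h3 : C * y ^ 3 * 1 * F0 ≤ C * y ^ 3 * 1 * (F + 2 * y ^ 19) := by gcongr
    have h4 : C * y ^ 22 ≤ C * y ^ 19 := by gcongr
    have h5 : C * y ^ 20 ≤ C * y ^ 19 := by gcongr
    linarith
  -- Here the lower bound `F ≥ x⁻¹⁶` turns all absolute errors of order `x⁻¹⁹` into relative errors
  -- of order `x⁻³`.
  have hy19 : y ^ 19 ≤ y ^ 3 * F := by
    calc y ^ 19 = y ^ 3 * y ^ 16 := by ring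
      _ ≤ _ := by gcongr
  have hCy : 1 * y ^ 19 ≤ C * y ^ 19 := by gcongr
  have hCy2 : C * y ^ 19 ≤ C * (y ^ 3 * F) := by gcongr
  -- The three comparisons are fluctuation, bias, and the extra point. Their absolute errors add up
  -- to `(1 + 4C + 2) x⁻¹⁹ ≤ 7C x⁻³ F`, and the relative part of the bias contributes one more `C
  -- x⁻³ F`.
  have key : ∀ a b c d : ℝ, |a - b| ≤ y ^ 19 → |b - c| ≤ C * y ^ 3 * F + 4 * C * y ^ 19 →
      |c - d| ≤ 2 * y ^ 19 → |a - d| ≤ 8 * C * y ^ 3 * F := by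
    intro a b c d h1 h2 h3
    have := abs_sub_le a b d
    have := abs_sub_le b c d
    linarith
  have hAF : |A - F| ≤ 8 * C * y ^ 3 * F := by
    refine key A _ F0 F ?_ (hbias φ (smoothPDF σ) fun u => ((hC x u hx1).2 σ hσ.le).1) hg1
    rw [Finset.sum_sub_distrib, mul_sub] at hM
    exact hM
  have hAF' : |A' - F'| ≤ 8 * C * y ^ 3 * F := by
    refine key A' _ _ F' ?_ (hbias (fun u => -u * φ u) (smoothPDFDeriv σ)
      fun u => ((hC x u hx1).2 σ hσ.le).2) hg2
    rw [Finset.sum_sub_distrib, mul_sub] at hM'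
    exact hM'
  have hF'b : |F'| ≤ 2 * C * x * F := by
    have hc0 : 0 ≤ ((insert i s).card : ℝ)⁻¹ := inv_nonneg.2 (Nat.cast_nonneg _)
    rw [hF'eq, abs_mul, abs_of_nonneg hc0]
    have h1 : ((insert i s).card : ℝ)⁻¹ * |∑ j ∈ insert i s, -(z - ν j) * φ (z - ν j)|
        ≤ C * (x * F + y ^ 15) := by
      calc _ ≤ ((insert i s).card : ℝ)⁻¹ * ∑ j ∈ insert i s, C * (x * φ (z - ν j) + y ^ 15) :=
            mul_le_mul_of_nonneg_left ((Finset.abs_sum_le_sum_abs _ _).trans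
              (Finset.sum_le_sum fun j _ => (hC x (z - ν j) hx1).1)) hc0
        _ = _ := by
            have := average_affine (Finset.insert_nonempty i s) (fun j => φ (z - ν j)) C x
              (y ^ 15) 0
            simp only [add_zero] at this
            exact this
    have h2 : y ^ 15 ≤ x * F := by
      calc y ^ 15 = (x * y) * y ^ 15 := by rw [hxy, one_mul]
        _ = x * y ^ 16 := by ring
        _ ≤ _ := by gcongr
    have h3 : C * y ^ 15 ≤ C * (x * F) := by gcongr
    linarith
  have hxy2 : x * y ^ 3 = y ^ 2 := by
    calc x * y ^ 3 = (x * y) * y ^ 2 := by ring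
      _ = _ := by rw [hxy, one_mul]
  have hd : 8 * C * y ^ 3 ≤ 1 / 2 := by
    have h1 : 16 * C * y ≤ 1 := by
      have : 16 * C ≤ x := by nlinarith
      calc 16 * C * y ≤ x * y := by gcongr
        _ = 1 := hxy
    have h2 : y ^ 3 ≤ y := by
      calc y ^ 3 ≤ y ^ 1 := pow_le_pow_of_le_one hy0.le hy1 (by norm_num)
        _ = y := pow_one y
    nlinarith
  constructor
  · rw [hest, horacle, add_sub_add_left_eq_sub]
    refine (abs_div_sub_div_le hF0 hAF hAF' hF'b hd (by positivity)).trans ?_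
    have h1 : y ^ 3 ≤ y ^ 2 := pow_le_pow_of_le_one hy0.le hy1 (by norm_num)
    have h2 : 2 * (8 * C * y ^ 3) * (1 + 2 * C * x) = 16 * C * y ^ 3 + 32 * C ^ 2 * (x * y ^ 3) := by
      ring
    rw [h2, hxy2]
    have h3 : 16 * C * y ^ 3 ≤ 16 * C ^ 2 * y ^ 2 := by
      have : C ≤ C ^ 2 := by nlinarith
      gcongr
    linarith
  · rw [horacle, add_sub_cancel_left, abs_div, abs_of_pos hF0, div_le_iff₀ hF0]
    refine hF'b.trans ?_
    have : 2 * C ≤ 48 * C ^ 2 := by nlinarith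
    gcongr

/-- The oracle error `b` may be as large as `x`, so the cross term `2b(a - b)` is of order `x⁻¹`
only because the decisions agree to within `x⁻²`. -/
lemma sq_le_sq_add_of_close {C x a b e : ℝ} (hC : 1 ≤ C) (hx : 1 ≤ x)
    (h1 : |a - b| ≤ C * (x ^ 2)⁻¹) (h2 : |b| ≤ C * x + |e|) :
    a ^ 2 ≤ b ^ 2 + 3 * C ^ 2 * x⁻¹ * (1 + |e|) := by
  have hx0 : 0 < x := by linarith
  set y := x⁻¹ with hy
  have hy0 : 0 < y := by positivity
  have hxy : x * y = 1 := mul_inv_cancel₀ hx0.ne'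
  have hy1 : y ≤ 1 := inv_le_one_of_one_le₀ hx
  rw [← inv_pow, ← hy] at h1
  have e1 : a ^ 2 = b ^ 2 + 2 * b * (a - b) + (a - b) ^ 2 := by ring
  have h3 : 2 * b * (a - b) ≤ 2 * (C * x + |e|) * (C * y ^ 2) := by
    calc 2 * b * (a - b) ≤ |2 * b * (a - b)| := le_abs_self _
      _ = 2 * |b| * |a - b| := by rw [abs_mul, abs_mul]; norm_num
      _ ≤ _ := by gcongr
  have h4 : (a - b) ^ 2 ≤ (C * y ^ 2) ^ 2 := by
    rw [← sq_abs]; exact pow_le_pow_left₀ (abs_nonneg _) h1 2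
  have h5 : 2 * (C * x + |e|) * (C * y ^ 2) = 2 * C ^ 2 * y + 2 * C * |e| * y ^ 2 := by
    calc _ = 2 * C ^ 2 * y * (x * y) + 2 * C * |e| * y ^ 2 := by ring
      _ = _ := by rw [hxy, mul_one]
  have h6 : y ^ 2 ≤ y := by nlinarith
  have h7 : 2 * C * |e| * y ^ 2 ≤ 2 * C ^ 2 * |e| * y := by
    have : C ≤ C ^ 2 := by nlinarith
    have := abs_nonneg e
    gcongr
  have h8 : (C * y ^ 2) ^ 2 ≤ C ^ 2 * y := by
    have : y ^ 4 ≤ y := by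
      calc y ^ 4 ≤ y ^ 1 := pow_le_pow_of_le_one hy0.le hy1 (by norm_num)
        _ = y := pow_one y
    calc (C * y ^ 2) ^ 2 = C ^ 2 * y ^ 4 := by ring
      _ ≤ _ := by gcongr
  have h9 : 0 ≤ C ^ 2 * |e| * y := by positivity
  nlinarith

end SeqEB

namespace SeqEB

local notation "φ" => gaussianPDFReal 0 1
local notation "γ" => gaussianReal 0 1

/-! ### Pairs of a state vector and a noise vector -/

/-- A state vector together with a noise vector. -/
abbrev Pair (n : ℕ) := (Fin n → ℝ) × (Fin n → ℝ)

/-- Replace the noise at time `i`. -/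
def resample {n : ℕ} (i : Fin n) (p : Pair n) (x : ℝ) : Pair n := (p.1, Function.update p.2 i x)

/-- Under `Q`, the noise at each time is standard normal and independent of everything else. -/
def StdNormalNoise {n : ℕ} (Q : Measure (Pair n)) : Prop :=
  ∀ i, (Q.prod γ).map (fun q => resample i q.1 q.2) = Q

lemma measurable_resample {n : ℕ} (i : Fin n) :
    Measurable fun q : Pair n × ℝ => resample i q.1 q.2 := by
  unfold resample
  refine Measurable.prodMk (by fun_prop) (measurable_pi_lambda _ fun j => ?_)
  rcases eq_or_ne j i with rfl | h
  · simpa using measurable_snd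
  · simp only [Function.update_of_ne h]; fun_prop

lemma map_update_pi_stdNormal {n : ℕ} (i : Fin n) :
    ((Measure.pi fun _ : Fin n => γ).prod γ).map (fun q => Function.update q.1 i q.2)
      = Measure.pi fun _ => γ := by
  have hm : Measurable fun q : (Fin n → ℝ) × ℝ => Function.update q.1 i q.2 := by
    refine measurable_pi_lambda _ fun j => ?_
    rcases eq_or_ne j i with rfl | h
    · simpa using measurable_snd
    · simp only [Function.update_of_ne h]; fun_prop
  refine (Measure.pi_eq fun s hs => ?_).symm
  rw [Measure.map_apply hm (MeasurableSet.univ_pi hs)]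
  have : (fun q : (Fin n → ℝ) × ℝ => Function.update q.1 i q.2) ⁻¹' (Set.univ.pi s)
      = (Set.univ.pi (Function.update s i Set.univ)) ×ˢ (s i) := by
    ext q
    simp only [Set.mem_preimage, Set.mem_pi, Set.mem_univ, true_imp_iff, Set.mem_prod]
    constructor
    · intro h
      refine ⟨fun j => ?_, by simpa using h i⟩
      rcases eq_or_ne j i with rfl | hj
      · simp
      · simpa [hj] using h j
    · rintro ⟨h1, h2⟩ j
      rcases eq_or_ne j i with rfl | hj
      · simpa using h2
      · simpa [hj] using h1 j
  rw [this, Measure.prod_prod, Measure.pi_pi, mul_comm]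
  rw [← Finset.mul_prod_erase Finset.univ (fun j => γ (s j)) (Finset.mem_univ i),
    ← Finset.mul_prod_erase Finset.univ (fun j => γ (Function.update s i Set.univ j))
      (Finset.mem_univ i)]
  simp only [Function.update_self, measure_univ, one_mul]
  congr 1
  refine Finset.prod_congr rfl fun j hj => ?_
  rw [Function.update_of_ne (Finset.ne_of_mem_erase hj)]

lemma NoiseModel.measurable_pair {Ω : Type*} [MeasurableSpace Ω] {P : Measure Ω} {n : ℕ}
    {μ ε : Fin n → Ω → ℝ} (h : NoiseModel P μ ε) :
    Measurable fun ω => ((fun i => μ i ω, fun i => ε i ω) : Pair n) :=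
  (measurable_pi_lambda _ h.measurable_state).prodMk (measurable_pi_lambda _ h.measurable_noise)

/-- Independence makes the joint law a product of the law of the states and a standard Gaussian
product measure. Replacing one coordinate of the latter by a fresh draw leaves it unchanged. -/
lemma NoiseModel.stdNormalNoise {Ω : Type*} [MeasurableSpace Ω] {P : Measure Ω}
    [IsProbabilityMeasure P] {n : ℕ} {μ ε : Fin n → Ω → ℝ} (h : NoiseModel P μ ε) :
    StdNormalNoise (P.map fun ω => ((fun i => μ i ω, fun i => ε i ω) : Pair n)) := by
  have hε : Measurable fun ω => fun i => ε i ω := measurable_pi_lambda _ h.measurable_noise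
  have hμ : Measurable fun ω => fun i => μ i ω := measurable_pi_lambda _ h.measurable_state
  have hprod := (indepFun_iff_map_prod_eq_prod_map_map hμ.aemeasurable hε.aemeasurable).1
    h.indep_state.symm
  have hpi := (iIndepFun_iff_map_fun_eq_pi_map fun i => (h.measurable_noise i).aemeasurable).1
    h.iIndep_noise
  simp only [h.law_noise] at hpi
  have : IsProbabilityMeasure (P.map fun ω => fun i => μ i ω) :=
    Measure.isProbabilityMeasure_map hμ.aemeasurable
  rw [hprod, hpi]
  set R := P.map fun ω => fun i => μ i ω
  intro i
  have hm : Measurable fun q : (Fin n → ℝ) × ℝ => Function.update q.1 i q.2 := by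
    refine measurable_pi_lambda _ fun j => ?_
    rcases eq_or_ne j i with rfl | h
    · simpa using measurable_snd
    · simp only [Function.update_of_ne h]; fun_prop
  have e : (fun q : Pair n × ℝ => resample i q.1 q.2)
      = (Prod.map id fun q : (Fin n → ℝ) × ℝ => Function.update q.1 i q.2)
        ∘ MeasurableEquiv.prodAssoc := rfl
  rw [e, ← Measure.map_map (measurable_id.prodMap hm) MeasurableEquiv.prodAssoc.measurable,
    (measurePreserving_prodAssoc R (Measure.pi fun _ => γ) γ).map_eq,
    ← Measure.map_prod_map R _ measurable_id hm, Measure.map_id, map_update_pi_stdNormal]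

/-! ### Integrating out the noise at one time. -/

section Resample

variable {n : ℕ} {Q : Measure (Pair n)}

lemma StdNormalNoise.lintegral_eq (hQ : StdNormalNoise Q) (i : Fin n) {F : Pair n → ℝ≥0∞}
    (hF : Measurable F) : ∫⁻ p, F p ∂Q = ∫⁻ p, ∫⁻ x, F (resample i p x) ∂γ ∂Q := by
  conv_lhs => rw [← hQ i]
  rw [lintegral_map hF (measurable_resample i)]
  exact lintegral_prod _ (hF.comp (measurable_resample i)).aemeasurable

variable [IsProbabilityMeasure Q]

lemma StdNormalNoise.integral_eq (hQ : StdNormalNoise Q) (i : Fin n) {F : Pair n → ℝ}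
    (hF : Measurable F) (hi : Integrable F Q) :
    ∫ p, F p ∂Q = ∫ p, ∫ x, F (resample i p x) ∂γ ∂Q := by
  conv_lhs => rw [← hQ i]
  have hi' : Integrable (fun q : Pair n × ℝ => F (resample i q.1 q.2)) (Q.prod γ) := by
    rw [← hQ i] at hi
    exact hi.comp_measurable (measurable_resample i)
  rw [integral_map (measurable_resample i).aemeasurable hF.aestronglyMeasurable,
    integral_prod _ hi']

/-- The second moment of a sum of martingale differences. -/
lemma StdNormalNoise.lintegral_sq_sum_le (hQ : StdNormalNoise Q) {D : Fin n → Pair n → ℝ}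
    (hD : ∀ k, Measurable (D k))
    (hdep : ∀ j k, j < k → ∀ p x, D j (resample k p x) = D j p)
    (hmean : ∀ k p, ∫ x, D k (resample k p x) ∂γ = 0) {c : Fin n → ℝ}
    (hc : ∀ k, ∫⁻ p, ENNReal.ofReal (D k p ^ 2) ∂Q ≤ ENNReal.ofReal (c k))
    (hc0 : ∀ k, 0 ≤ c k) :
    ∫⁻ p, ENNReal.ofReal ((∑ k, D k p) ^ 2) ∂Q ≤ ENNReal.ofReal (∑ k, c k) := by
  have hL : ∀ k, MemLp (D k) 2 Q := fun k => by
    rw [memLp_two_iff_integrable_sq (hD k).aestronglyMeasurable]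
    refine ⟨((hD k).pow_const 2).aestronglyMeasurable, ?_⟩
    rw [hasFiniteIntegral_iff_ofReal (ae_of_all _ fun p => sq_nonneg _)]
    exact (hc k).trans_lt ENNReal.ofReal_lt_top
  have hint : ∀ j k, Integrable (fun p => D j p * D k p) Q := fun j k =>
    (hL j).integrable_mul (hL k)
  -- The noise at the later time is integrated first: the earlier factor does not see it, and the
  -- later factor then has mean zero.
  have hlt : ∀ j k, j < k → ∫ p, D j p * D k p ∂Q = 0 := by
    intro j k hjk
    rw [hQ.integral_eq k (F := fun p => D j p * D k p) ((hD j).mul (hD k)) (hint j k)]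
    simp only [hdep j k hjk, integral_const_mul, hmean, mul_zero, integral_zero]
  have hne : ∀ j k, j ≠ k → ∫ p, D j p * D k p ∂Q = 0 := by
    intro j k hjk
    rcases lt_or_gt_of_ne hjk with h | h
    · exact hlt j k h
    · simp only [mul_comm (D j _)]
      exact hlt k j h
  have hsum : ∀ p, (∑ k, D k p) ^ 2 = ∑ j, ∑ k, D j p * D k p := fun p => by
    rw [sq, Finset.sum_mul_sum]
  have hi : Integrable (fun p => (∑ k, D k p) ^ 2) Q := by
    simp only [hsum]
    exact integrable_finsetSum _ fun j _ => integrable_finsetSum _ fun k _ => hint j k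
  rw [← ofReal_integral_eq_lintegral_ofReal hi (ae_of_all _ fun p => sq_nonneg _)]
  refine ENNReal.ofReal_le_ofReal ?_
  simp only [hsum]
  rw [integral_finsetSum _ fun j _ => integrable_finsetSum _ fun k _ => hint j k]
  refine Finset.sum_le_sum fun j _ => ?_
  rw [integral_finsetSum _ fun k _ => hint j k, Finset.sum_eq_single j
    (fun k _ hk => hne j k hk.symm) (by simp)]
  rw [← ENNReal.ofReal_le_ofReal_iff (hc0 j), ofReal_integral_eq_lintegral_ofReal (hint j j)
    (ae_of_all _ fun p => mul_self_nonneg _)]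
  simpa only [sq] using hc j

end Resample

/-! ### Centred states as functions of a pair -/

/-- The data vector of a pair. -/
def pairObs {n : ℕ} (p : Pair n) : Fin n → ℝ := fun i => p.1 i + p.2 i

/-- The centred states of a pair. -/
def pairCentred {n : ℕ} (m : Fin n → (Fin n → ℝ) → ℝ) (p : Pair n) : Fin n → ℝ :=
  fun i => p.1 i - m i (pairObs p)

section Centred

variable {n : ℕ} {m : Fin n → (Fin n → ℝ) → ℝ}

lemma measurable_pairObs : Measurable (pairObs : Pair n → Fin n → ℝ) := by
  unfold pairObs; fun_prop

lemma measurable_pairCentred (hm : ∀ i, Measurable (m i)) : Measurable (pairCentred m) :=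
  measurable_pi_lambda _ fun i => ((measurable_pi_apply i).comp measurable_fst).sub
    ((hm i).comp measurable_pairObs)

lemma measurable_pairCentred_apply (hm : ∀ i, Measurable (m i)) (i : Fin n) :
    Measurable fun p => pairCentred m p i :=
  (measurable_pi_apply i).comp (measurable_pairCentred hm)

lemma resid_pairObs (p : Pair n) (i : Fin n) :
    resid m (pairObs p) i = pairCentred m p i + p.2 i := by
  simp only [resid, pairCentred, pairObs]; ring

/-- Predictability: `ν_j` involves the noise strictly before `j` only. The case `j = i` is included,
so `ν_i` acts as a constant when the noise at `i` is integrated out. -/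
lemma pairCentred_resample (hm : ∀ i, DependsOn (m i) (Set.Iio i)) {i j : Fin n} (h : j ≤ i)
    (p : Pair n) (x : ℝ) : pairCentred m (resample i p x) j = pairCentred m p j := by
  simp only [pairCentred]
  congr 1
  refine hm j fun k hk => ?_
  have : k ≠ i := ((Set.mem_Iio.1 hk).trans_le h).ne
  simp [pairObs, resample, this]

lemma resample_noise_of_ne {i j : Fin n} (h : j ≠ i) (p : Pair n) (x : ℝ) :
    (resample i p x).2 j = p.2 j := by
  simp [resample, h]

lemma resample_noise_self (i : Fin n) (p : Pair n) (x : ℝ) : (resample i p x).2 i = x := by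
  simp [resample]

lemma lintegral_stdNormal_add {G : ℝ → ℝ≥0∞} (hG : Measurable G) (v : ℝ) :
    ∫⁻ x, G (v + x) ∂γ = ∫⁻ z, ENNReal.ofReal (φ (z - v)) * G z := by
  have h1 : ∫⁻ x, G (v + x) ∂γ = ∫⁻ z, G z ∂(gaussianReal v 1) := by
    rw [← zero_add v, ← gaussianReal_map_const_add v, lintegral_map hG (measurable_const_add v)]
    simp
  rw [h1, gaussianReal_of_var_ne_zero v one_ne_zero,
    lintegral_withDensity_eq_lintegral_mul _ (measurable_gaussianPDF v 1) hG]
  refine lintegral_congr fun z => ?_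
  rw [Pi.mul_apply, gaussianPDF, gaussianPDFReal_sub, zero_add]

variable {Q : Measure (Pair n)}

/-- Integrating out the noise at time `i` from a function of the residual at time `i`. -/
lemma StdNormalNoise.lintegral_resid_eq (hQ : StdNormalNoise Q) (hm : ∀ i, Measurable (m i))
    (hdep : ∀ i, DependsOn (m i) (Set.Iio i)) (i : Fin n) {H : Pair n → ℝ → ℝ≥0∞}
    (hH : Measurable (Function.uncurry H)) (hHi : ∀ p x, H (resample i p x) = H p) :
    ∫⁻ p, H p (pairCentred m p i + p.2 i) ∂Q
      = ∫⁻ p, (∫⁻ z, ENNReal.ofReal (φ (z - pairCentred m p i)) * H p z) ∂Q := by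
  have h1 : Measurable fun p : Pair n => H p (pairCentred m p i + p.2 i) :=
    hH.comp (measurable_id.prodMk ((measurable_pairCentred_apply hm i).add (by fun_prop)))
  rw [hQ.lintegral_eq i h1]
  refine lintegral_congr fun p => ?_
  simp only [hHi, pairCentred_resample hdep le_rfl, resample_noise_self]
  exact lintegral_stdNormal_add (hH.comp measurable_prodMk_left) _

end Centred

end SeqEB

namespace SeqEB

local notation "φ" => gaussianPDFReal 0 1
local notation "γ" => gaussianReal 0 1

/-! ### The density is rarely small at the residuals -/

/-- Let `k` be the last time with `f_k(z) < θ`. All times that count lie in `{1, …, k}`, so the sum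
is at most `k f_k(z) < kθ`. No union bound over times is needed. -/
lemma sum_stdPDF_small_le {n : ℕ} (ν : Fin n → ℝ) (z : ℝ) {θ : ℝ} (hθ : 0 ≤ θ) :
    ∑ i, (if mixDensity (Finset.Iic i) ν z < θ then φ (z - ν i) else 0) ≤ n * θ := by
  rw [← Finset.sum_filter]
  set S := Finset.univ.filter fun i => mixDensity (Finset.Iic i) ν z < θ with hS
  rcases S.eq_empty_or_nonempty with h | h
  · rw [h]; simp; positivity
  set k := S.max' h with hk
  have hkS : mixDensity (Finset.Iic k) ν z < θ := (Finset.mem_filter.1 (S.max'_mem h)).2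
  have hcard : ((Finset.Iic k).card : ℝ) ≤ n := by
    exact_mod_cast (Finset.card_le_univ _).trans (by simp)
  have hpos : (0 : ℝ) < (Finset.Iic k).card := by
    exact_mod_cast Finset.card_pos.2 ⟨k, Finset.mem_Iic.2 le_rfl⟩
  calc ∑ i ∈ S, φ (z - ν i) ≤ ∑ i ∈ Finset.Iic k, φ (z - ν i) :=
        Finset.sum_le_sum_of_subset_of_nonneg
          (fun i hi => Finset.mem_Iic.2 (S.le_max' i hi)) fun i _ _ => (stdPDF_pos _).le
    _ = (Finset.Iic k).card * mixDensity (Finset.Iic k) ν z := by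
        rw [mixDensity, mul_inv_cancel_left₀ hpos.ne']
    _ ≤ (Finset.Iic k).card * θ := by gcongr
    _ ≤ n * θ := by gcongr

section

variable {n : ℕ} {m : Fin n → (Fin n → ℝ) → ℝ}

lemma measurable_mixDensity_pair (hm : ∀ i, Measurable (m i)) (s : Finset (Fin n)) :
    Measurable fun q : Pair n × ℝ => mixDensity s (pairCentred m q.1) q.2 := by
  unfold mixDensity
  refine measurable_const.mul (Finset.measurable_fun_sum s fun j _ =>
    (measurable_gaussianPDFReal 0 1).comp (measurable_snd.sub
      ((measurable_pairCentred_apply hm j).comp measurable_fst)))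

lemma measurable_pair_resid (hm : ∀ i, Measurable (m i)) (i : Fin n) :
    Measurable fun p : Pair n => (p, pairCentred m p i + p.2 i) :=
  measurable_id.prodMk ((measurable_pairCentred_apply hm i).add (by fun_prop))

lemma mixDensity_resample (hdep : ∀ i, DependsOn (m i) (Set.Iio i)) (i : Fin n) (p : Pair n)
    (x z : ℝ) : mixDensity (Finset.Iic i) (pairCentred m (resample i p x)) z
      = mixDensity (Finset.Iic i) (pairCentred m p) z := by
  unfold mixDensity
  congr 1
  refine Finset.sum_congr rfl fun j hj => ?_
  rw [pairCentred_resample hdep (Finset.mem_Iic.1 hj)]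

variable {Q : Measure (Pair n)} [IsProbabilityMeasure Q]

/-- Given the past, `Z_i` has density `φ(z - ν_i)`, while `f_i` is already determined. The
probabilities therefore sum to an integral over `|z| ≤ L` of the expression bounded pathwise in
`sum_stdPDF_small_le`. -/
lemma StdNormalNoise.sum_measure_small_density_le (hQ : StdNormalNoise Q)
    (hm : ∀ i, Measurable (m i)) (hdep : ∀ i, DependsOn (m i) (Set.Iio i)) {L θ : ℝ}
    (hθ : 0 ≤ θ) :
    ∑ i, Q {p | |pairCentred m p i + p.2 i| ≤ L ∧
        mixDensity (Finset.Iic i) (pairCentred m p) (pairCentred m p i + p.2 i) < θ}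
      ≤ ENNReal.ofReal (2 * L * (n * θ)) := by
  set S : Fin n → Set (Pair n × ℝ) := fun i =>
    {q | |q.2| ≤ L ∧ mixDensity (Finset.Iic i) (pairCentred m q.1) q.2 < θ} with hSdef
  have hS : ∀ i, MeasurableSet (S i) := fun i => by
    have h1 : MeasurableSet {q : Pair n × ℝ | |q.2| ≤ L} :=
      measurableSet_le measurable_snd.abs measurable_const
    exact h1.inter (measurableSet_lt (measurable_mixDensity_pair hm _) measurable_const)
  set H : Fin n → Pair n → ℝ → ℝ≥0∞ := fun i p z => (S i).indicator 1 (p, z) with hHdef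
  have hH : ∀ i, Measurable (Function.uncurry (H i)) := fun i =>
    measurable_one.indicator (hS i)
  have h1 : ∀ i, Q {p | |pairCentred m p i + p.2 i| ≤ L ∧
        mixDensity (Finset.Iic i) (pairCentred m p) (pairCentred m p i + p.2 i) < θ}
      = ∫⁻ p, (∫⁻ z, ENNReal.ofReal (φ (z - pairCentred m p i)) * H i p z) ∂Q := by
    intro i
    rw [← hQ.lintegral_resid_eq hm hdep i (hH i)]
    · exact (lintegral_indicator_one (μ := Q) ((measurable_pair_resid hm i) (hS i))).symm
    · intro p x
      ext z
      simp only [hHdef, hSdef, Set.indicator, Set.mem_ofPred_eq, mixDensity_resample hdep, Pi.one_apply]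
  simp only [h1]
  have hφ : ∀ i, Measurable fun q : Pair n × ℝ =>
      ENNReal.ofReal (φ (q.2 - pairCentred m q.1 i)) := fun i =>
    ((measurable_gaussianPDFReal 0 1).comp (measurable_snd.sub
      ((measurable_pairCentred_apply hm i).comp measurable_fst))).ennreal_ofReal
  have hmul : ∀ i, Measurable fun q : Pair n × ℝ =>
      ENNReal.ofReal (φ (q.2 - pairCentred m q.1 i)) * H i q.1 q.2 := fun i => (hφ i).mul (hH i)
  rw [← lintegral_finsetSum _ fun i _ => (hmul i).lintegral_prod_right']
  have h2 : ∀ p, ∑ i, (∫⁻ z, ENNReal.ofReal (φ (z - pairCentred m p i)) * H i p z)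
      ≤ ENNReal.ofReal (2 * L * (n * θ)) := by
    intro p
    have hp : ∀ i, Measurable fun z =>
        ENNReal.ofReal (φ (z - pairCentred m p i)) * H i p z := fun i =>
      ((measurable_gaussianPDFReal 0 1).comp (measurable_id.sub_const _)).ennreal_ofReal.mul
        ((hH i).comp measurable_prodMk_left)
    rw [← lintegral_finsetSum _ fun i _ => hp i]
    have h3 : ∀ z, ∑ i, ENNReal.ofReal (φ (z - pairCentred m p i)) * H i p z
        ≤ (Set.Icc (-L) L).indicator (fun _ => ENNReal.ofReal (n * θ)) z := by
      intro z
      by_cases hz : z ∈ Set.Icc (-L) L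
      · rw [Set.indicator_of_mem hz]
        refine le_trans (le_of_eq ?_)
          (ENNReal.ofReal_le_ofReal (sum_stdPDF_small_le (pairCentred m p) z hθ))
        rw [ENNReal.ofReal_sum_of_nonneg fun i _ => by
          split_ifs
          exacts [(stdPDF_pos _).le, le_rfl]]
        refine Finset.sum_congr rfl fun i _ => ?_
        have : |z| ≤ L := abs_le.2 hz
        simp only [hHdef, hSdef, Set.indicator, Set.mem_ofPred_eq, this, true_and]
        split_ifs <;> simp
      · rw [Set.indicator_of_notMem hz]
        have : ¬ |z| ≤ L := fun h => hz (abs_le.1 h)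
        simp [hHdef, hSdef, Set.indicator, this]
    refine (lintegral_mono h3).trans ?_
    rw [lintegral_indicator measurableSet_Icc, setLIntegral_const, Real.volume_Icc]
    rw [← ENNReal.ofReal_mul (by positivity)]
    exact ENNReal.ofReal_le_ofReal (by ring_nf; rfl)
  calc _ ≤ ∫⁻ _, ENNReal.ofReal (2 * L * (n * θ)) ∂Q := lintegral_mono h2
    _ = _ := by simp

/-! ### Kernel sums are close to their conditional means -/

/-- The deviation of the average of `g(Z_j - z)`, `j < i`, from its predictable counterpart. -/
noncomputable def kernelDev (m : Fin n → (Fin n → ℝ) → ℝ) (g : ℝ → ℝ) (i : Fin n) (p : Pair n)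
    (z : ℝ) : ℝ :=
  ((Finset.Iio i).card : ℝ)⁻¹ * ∑ j ∈ Finset.Iio i,
    (g (pairCentred m p j + p.2 j - z) - ∫ e, g (e - (z - pairCentred m p j)) ∂γ)

lemma measurable_stdNormal_smoothing {g : ℝ → ℝ} (hg : Measurable g) :
    Measurable fun u : ℝ => ∫ e, g (e - u) ∂γ := by
  have : Measurable fun q : ℝ × ℝ => g (q.2 - q.1) := hg.comp (by fun_prop)
  exact this.stronglyMeasurable.integral_prod_right'.measurable

lemma measurable_kernelDev (hm : ∀ i, Measurable (m i)) {g : ℝ → ℝ} (hg : Measurable g)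
    (i : Fin n) : Measurable fun q : Pair n × ℝ => kernelDev m g i q.1 q.2 := by
  unfold kernelDev
  refine measurable_const.mul (Finset.measurable_fun_sum _ fun j _ => ?_)
  have h1 : Measurable fun q : Pair n × ℝ => pairCentred m q.1 j :=
    (measurable_pairCentred_apply hm j).comp measurable_fst
  refine (hg.comp ((h1.add (by fun_prop)).sub measurable_snd)).sub ?_
  exact (measurable_stdNormal_smoothing hg).comp (measurable_snd.sub h1)

lemma kernelDev_resample (hdep : ∀ i, DependsOn (m i) (Set.Iio i)) (g : ℝ → ℝ) (i : Fin n)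
    (p : Pair n) (x z : ℝ) : kernelDev m g i (resample i p x) z = kernelDev m g i p z := by
  unfold kernelDev
  congr 1
  refine Finset.sum_congr rfl fun j hj => ?_
  have hj' := Finset.mem_Iio.1 hj
  rw [pairCentred_resample hdep hj'.le, resample_noise_of_ne hj'.ne]

/-- At a fixed `z` the summands are martingale differences bounded by `2B`, so the variance of the
average is of order `1/i` although the `ν_j` depend on the past. -/
lemma StdNormalNoise.lintegral_kernelDev_sq_le (hQ : StdNormalNoise Q)
    (hm : ∀ i, Measurable (m i)) (hdep : ∀ i, DependsOn (m i) (Set.Iio i)) {g : ℝ → ℝ}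
    (hg : Measurable g) {B : ℝ} (hB : ∀ t, |g t| ≤ B) (i : Fin n) (z : ℝ) :
    ∫⁻ p, ENNReal.ofReal (kernelDev m g i p z ^ 2) ∂Q
      ≤ ENNReal.ofReal (4 * B ^ 2 * ((Finset.Iio i).card : ℝ)⁻¹) := by
  set D : Fin n → Pair n → ℝ := fun j p => if j < i then
    g (pairCentred m p j + p.2 j - z) - ∫ e, g (e - (z - pairCentred m p j)) ∂γ else 0 with hD
  have hB0 : 0 ≤ B := (abs_nonneg _).trans (hB 0)
  have hint : ∀ u, Integrable (fun e => g (e - u)) γ := fun u =>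
    Integrable.of_bound (hg.comp (by fun_prop)).aestronglyMeasurable B (ae_of_all _ fun e => hB _)
  have hsm : ∀ u, |∫ e, g (e - u) ∂γ| ≤ B := fun u => by
    have := norm_integral_le_of_norm_le_const (μ := γ) (f := fun e => g (e - u)) (C := B)
      (ae_of_all _ fun e => hB _)
    simpa using this
  have hDm : ∀ j, Measurable (D j) := fun j => by
    simp only [hD]
    split_ifs
    · have h1 := measurable_pairCentred_apply hm j
      refine (hg.comp ((h1.add (by fun_prop)).sub measurable_const)).sub ?_
      exact (measurable_stdNormal_smoothing hg).comp (measurable_const.sub h1)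
    · exact measurable_const
  have hDb : ∀ j p, |D j p| ≤ 2 * B := fun j p => by
    simp only [hD]
    split_ifs
    · refine (abs_sub _ _).trans ?_
      linarith [hB (pairCentred m p j + p.2 j - z), hsm (z - pairCentred m p j)]
    · simpa using hB0
  have h := hQ.lintegral_sq_sum_le (D := D) (c := fun j => if j < i then 4 * B ^ 2 else 0) hDm
    (fun j k hjk p x => by
      simp only [hD]
      rw [pairCentred_resample hdep hjk.le, resample_noise_of_ne hjk.ne])
    (fun k p => by
      simp only [hD, pairCentred_resample hdep le_rfl, resample_noise_self]
      split_ifs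
      · have : ∀ x, pairCentred m p k + x - z = x - (z - pairCentred m p k) := fun x => by ring
        simp only [this]
        rw [integral_sub (hint _) (integrable_const _)]
        simp
      · simp)
    (fun k => by
      by_cases hk : k < i
      · simp only [hk, if_true]
        calc ∫⁻ p, ENNReal.ofReal (D k p ^ 2) ∂Q ≤ ∫⁻ _, ENNReal.ofReal (4 * B ^ 2) ∂Q := by
              refine lintegral_mono fun p => ENNReal.ofReal_le_ofReal ?_
              rw [← sq_abs]
              calc |D k p| ^ 2 ≤ (2 * B) ^ 2 := pow_le_pow_left₀ (abs_nonneg _) (hDb k p) 2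
                _ = _ := by ring
          _ = _ := by simp
      · simp [hD, hk])
    (fun k => by split_ifs <;> positivity)
  have hsum : ∀ p, kernelDev m g i p z = ((Finset.Iio i).card : ℝ)⁻¹ * ∑ k, D k p := fun p => by
    simp only [kernelDev, hD]
    rw [← Finset.sum_filter]
    congr 2
    ext j; simp
  have hcs : ∑ k : Fin n, (if k < i then 4 * B ^ 2 else 0)
      = ((Finset.Iio i).card : ℝ) * (4 * B ^ 2) := by
    rw [← Finset.sum_filter, Finset.sum_const, nsmul_eq_mul]
    congr 3
    ext j; simp
  simp only [hsum, mul_pow]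
  set N := ((Finset.Iio i).card : ℝ)
  have hN : 0 ≤ N := Nat.cast_nonneg _
  calc ∫⁻ p, ENNReal.ofReal (N⁻¹ ^ 2 * (∑ k, D k p) ^ 2) ∂Q
      = ENNReal.ofReal (N⁻¹ ^ 2) * ∫⁻ p, ENNReal.ofReal ((∑ k, D k p) ^ 2) ∂Q := by
        rw [← lintegral_const_mul _ (((Finset.measurable_fun_sum _ fun k _ => hDm k).pow_const
          2).ennreal_ofReal)]
        refine lintegral_congr fun p => ENNReal.ofReal_mul (by positivity)
    _ ≤ ENNReal.ofReal (N⁻¹ ^ 2) * ENNReal.ofReal (N * (4 * B ^ 2)) := by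
        rw [hcs] at h; gcongr
    _ = ENNReal.ofReal (N⁻¹ ^ 2 * (N * (4 * B ^ 2))) := (ENNReal.ofReal_mul (by positivity)).symm
    _ ≤ _ := by
        refine ENNReal.ofReal_le_ofReal (le_of_eq ?_)
        rcases hN.eq_or_lt with h0 | h0
        · rw [← h0]; simp
        · field_simp

/-- The deviation involves only times before `i`, so `Z_i` may be integrated out with its density,
which is at most one. Fubini and Chebyshev at each fixed `z` in `[-L, L]` suffice; no uniform bound
in `z` is required. -/
lemma StdNormalNoise.measure_kernelDev_large_le (hQ : StdNormalNoise Q)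
    (hm : ∀ i, Measurable (m i)) (hdep : ∀ i, DependsOn (m i) (Set.Iio i)) {g : ℝ → ℝ}
    (hg : Measurable g) {B : ℝ} (hB : ∀ t, |g t| ≤ B) (i : Fin n) {L η : ℝ} (hη : 0 < η) :
    Q {p | |pairCentred m p i + p.2 i| ≤ L ∧
        η < |kernelDev m g i p (pairCentred m p i + p.2 i)|}
      ≤ ENNReal.ofReal (2 * L * (4 * B ^ 2 * ((Finset.Iio i).card : ℝ)⁻¹) / η ^ 2) := by
  have hdev := measurable_kernelDev hm hg i
  set S : Set (Pair n × ℝ) := {q | |q.2| ≤ L ∧ η < |kernelDev m g i q.1 q.2|} with hSdef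
  have hS : MeasurableSet S := by
    have h1 : MeasurableSet {q : Pair n × ℝ | |q.2| ≤ L} :=
      measurableSet_le measurable_snd.abs measurable_const
    exact h1.inter (measurableSet_lt measurable_const hdev.abs)
  set H : Pair n → ℝ → ℝ≥0∞ := fun p z => S.indicator 1 (p, z) with hHdef
  have hH : Measurable (Function.uncurry H) := measurable_one.indicator hS
  have h1 : Q {p | |pairCentred m p i + p.2 i| ≤ L ∧
        η < |kernelDev m g i p (pairCentred m p i + p.2 i)|}
      = ∫⁻ p, (∫⁻ z, ENNReal.ofReal (φ (z - pairCentred m p i)) * H p z) ∂Q := by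
    rw [← hQ.lintegral_resid_eq hm hdep i hH]
    · exact (lintegral_indicator_one (μ := Q) ((measurable_pair_resid hm i) hS)).symm
    · intro p x
      ext z
      simp only [hHdef, hSdef, Set.indicator, Set.mem_ofPred_eq, kernelDev_resample hdep, Pi.one_apply]
  have h2 : ∀ p z, ENNReal.ofReal (φ (z - pairCentred m p i)) * H p z
      ≤ (Set.Icc (-L) L).indicator
        (fun z => ENNReal.ofReal ((η ^ 2)⁻¹) * ENNReal.ofReal (kernelDev m g i p z ^ 2)) z := by
    intro p z
    by_cases hz : (p, z) ∈ S
    · have hz' : z ∈ Set.Icc (-L) L := abs_le.1 hz.1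
      rw [Set.indicator_of_mem hz', ← ENNReal.ofReal_mul (by positivity)]
      simp only [hHdef, Set.indicator_of_mem hz, Pi.one_apply, mul_one]
      refine ENNReal.ofReal_le_ofReal ((stdPDF_le_one _).trans ?_)
      rw [← div_eq_inv_mul, one_le_div (by positivity), ← sq_abs (kernelDev m g i p z)]
      exact pow_le_pow_left₀ hη.le hz.2.le 2
    · simp only [hHdef, Set.indicator_of_notMem hz, mul_zero]
      exact zero_le
  have hmeas : Measurable fun q : Pair n × ℝ => ENNReal.ofReal (kernelDev m g i q.1 q.2 ^ 2) :=
    (hdev.pow_const 2).ennreal_ofReal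
  rw [h1]
  calc _ ≤ ∫⁻ p, (∫⁻ z in Set.Icc (-L) L,
          ENNReal.ofReal ((η ^ 2)⁻¹) * ENNReal.ofReal (kernelDev m g i p z ^ 2)) ∂Q := by
        refine lintegral_mono fun p => ?_
        rw [← lintegral_indicator measurableSet_Icc]
        exact lintegral_mono (h2 p)
    _ = ∫⁻ z in Set.Icc (-L) L, (∫⁻ p,
          ENNReal.ofReal ((η ^ 2)⁻¹) * ENNReal.ofReal (kernelDev m g i p z ^ 2) ∂Q) :=
        lintegral_lintegral_swap (hmeas.const_mul _).aemeasurable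
    _ ≤ ∫⁻ z in Set.Icc (-L) L, ENNReal.ofReal ((η ^ 2)⁻¹)
          * ENNReal.ofReal (4 * B ^ 2 * ((Finset.Iio i).card : ℝ)⁻¹) := by
        refine lintegral_mono fun z => ?_
        rw [lintegral_const_mul' _ _ ENNReal.ofReal_ne_top]
        gcongr
        exact hQ.lintegral_kernelDev_sq_le hm hdep hg hB i z
    _ ≤ _ := by
        rw [setLIntegral_const, Real.volume_Icc, ← ENNReal.ofReal_mul (by positivity),
          ← ENNReal.ofReal_mul (by positivity)]
        refine ENNReal.ofReal_le_ofReal (le_of_eq ?_)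
        field_simp
        ring

end

end SeqEB

namespace SeqEB

local notation "φ" => gaussianPDFReal 0 1
local notation "γ" => gaussianReal 0 1

/-! ### Moments of the noise -/

lemma integrable_pow_stdNormal (k : ℕ) : Integrable (fun x : ℝ => x ^ k) γ := by
  have := (memLp_id_gaussianReal (μ := 0) (v := 1) (k : ℝ≥0)).integrable_norm_pow'
  refine this.mono' (by fun_prop) (ae_of_all _ fun x => by simp)

lemma integral_sq_stdNormal : ∫ x, x ^ 2 ∂γ = 1 := by
  have h := variance_fun_id_gaussianReal (μ := 0) (v := 1)
  rw [variance_eq_integral aemeasurable_id', integral_id_gaussianReal] at h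
  simpa using h

lemma integral_self_stdNormal : ∫ x, x ∂γ = 0 := integral_id_gaussianReal

lemma lintegral_sq_stdNormal : ∫⁻ x, ENNReal.ofReal (x ^ 2) ∂γ = 1 := by
  rw [← ofReal_integral_eq_lintegral_ofReal (integrable_pow_stdNormal 2)
    (ae_of_all _ fun x => sq_nonneg x), integral_sq_stdNormal, ENNReal.ofReal_one]

/-- The fourth moment of the standard normal distribution. -/
noncomputable def stdNormalFourth : ℝ := ∫ x, x ^ 4 ∂γ

lemma stdNormalFourth_nonneg : 0 ≤ stdNormalFourth :=
  integral_nonneg fun x => by positivity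

lemma lintegral_fourth_stdNormal :
    ∫⁻ x, ENNReal.ofReal (x ^ 4) ∂γ = ENNReal.ofReal stdNormalFourth := by
  rw [stdNormalFourth, ofReal_integral_eq_lintegral_ofReal (integrable_pow_stdNormal 4)
    (ae_of_all _ fun x => by positivity)]

variable {n : ℕ} {m : Fin n → (Fin n → ℝ) → ℝ} {Q : Measure (Pair n)}

lemma StdNormalNoise.lintegral_noise [IsProbabilityMeasure Q] (hQ : StdNormalNoise Q) (i : Fin n) {G : ℝ → ℝ≥0∞}
    (hG : Measurable G) : ∫⁻ p, G (p.2 i) ∂Q = ∫⁻ x, G x ∂γ := by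
  rw [hQ.lintegral_eq i (F := fun p => G (p.2 i)) (by fun_prop)]
  simp [resample_noise_self]

/-! ### The sequential estimator is nearly as good as the oracle -/

/-- The oracle of a pair. -/
noncomputable def pairOracle {n : ℕ} (m : Fin n → (Fin n → ℝ) → ℝ) (i : Fin n) (p : Pair n) : ℝ :=
  m i (pairObs p) + oracleDecision (Finset.Iic i) (pairCentred m p) (resid m (pairObs p) i)

lemma pairOracle_sub (i : Fin n) (p : Pair n) :
    pairOracle m i p - p.1 i = oracleDecision (Finset.Iic i) (pairCentred m p)
      (pairCentred m p i + p.2 i) - pairCentred m p i := by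
  rw [pairOracle, resid_pairObs]
  simp only [pairCentred]; ring

lemma estimIS_sub (i : Fin n) (p : Pair n) :
    estimIS m i (pairObs p) - p.1 i = estDecision (1 / Real.log n) (Finset.Iio i)
      (fun j => pairCentred m p j + p.2 j) (pairCentred m p i + p.2 i) - pairCentred m p i := by
  have : resid m (pairObs p) = fun j => pairCentred m p j + p.2 j := funext fun j => resid_pairObs p j
  rw [estimIS, this]
  simp only [pairCentred]; ring

/-- The event that the estimated decision function may be off at time `i`. -/
def badEvent {n : ℕ} (m : Fin n → (Fin n → ℝ) → ℝ) (x : ℝ) (i : Fin n) : Set (Pair n) :=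
  {_p | ((i : ℕ) : ℝ) < x ^ 80} ∪ {p | x ^ 4 < |pairCentred m p i + p.2 i|} ∪
  {p | |pairCentred m p i + p.2 i| ≤ x ^ 4 ∧ mixDensity (Finset.Iic i) (pairCentred m p)
    (pairCentred m p i + p.2 i) < (x ^ 16)⁻¹} ∪
  {p | x ^ 80 ≤ ((i : ℕ) : ℝ) ∧ |pairCentred m p i + p.2 i| ≤ x ^ 4 ∧ (x ^ 19)⁻¹ <
    |kernelDev m (fun t => (x ^ 4)⁻¹⁻¹ * kern (t / (x ^ 4)⁻¹)) i p (pairCentred m p i + p.2 i)|} ∪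
  {p | x ^ 80 ≤ ((i : ℕ) : ℝ) ∧ |pairCentred m p i + p.2 i| ≤ x ^ 4 ∧ (x ^ 19)⁻¹ <
    |kernelDev m (fun t => -((x ^ 4)⁻¹⁻¹ * (x ^ 4)⁻¹⁻¹ * kernDeriv (t / (x ^ 4)⁻¹))) i p
      (pairCentred m p i + p.2 i)|}

lemma measurableSet_badEvent (hm : ∀ i, Measurable (m i)) (x : ℝ) (i : Fin n) :
    MeasurableSet (badEvent m x i) := by
  have hr := measurable_pair_resid hm i
  have hr2 : Measurable fun p : Pair n => |pairCentred m p i + p.2 i| := (measurable_snd.comp hr).abs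
  have hd : ∀ g : ℝ → ℝ, Measurable g → Measurable fun p : Pair n =>
      |kernelDev m g i p (pairCentred m p i + p.2 i)| := fun g hg =>
    ((measurable_kernelDev hm hg i).comp hr).abs
  have hk := continuous_kern.measurable
  have hk' := continuous_kernDeriv.measurable
  refine ((((MeasurableSet.const _).union (measurableSet_lt measurable_const hr2)).union
    ((measurableSet_le hr2 measurable_const).inter (measurableSet_lt
      ((measurable_mixDensity_pair hm _).comp hr) measurable_const))).union
    ((MeasurableSet.const _).inter ((measurableSet_le hr2 measurable_const).inter
      (measurableSet_lt measurable_const (hd _ ?_))))).union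
    ((MeasurableSet.const _).inter ((measurableSet_le hr2 measurable_const).inter
      (measurableSet_lt measurable_const (hd _ ?_))))
  · exact measurable_const.mul (hk.comp (by fun_prop))
  · exact (measurable_const.mul (hk'.comp (by fun_prop))).neg

/-- The five pieces contribute at most `2x⁸⁰`, `n x⁻³²`, `2n x⁻¹²` and twice `8n x⁻²²`. An order of
`x⁻⁹` suffices against a loss of order `x⁸` on the event; the constant `43` is not tight. -/
lemma StdNormalNoise.sum_measure_badEvent_le [IsProbabilityMeasure Q] (hQ : StdNormalNoise Q)
    (hm : ∀ i, Measurable (m i)) (hdep : ∀ i, DependsOn (m i) (Set.Iio i)) {x : ℝ} (hx : 1 ≤ x)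
    (htail : ∑ i, Q.real {p | x ^ 4 < |pairCentred m p i + p.2 i|} ≤ n * (x ^ 32)⁻¹) :
    ∑ i, Q (badEvent m x i) ≤ ENNReal.ofReal (43 * n * (x ^ 9)⁻¹ + 2 * x ^ 80) := by
  have hx0 : 0 < x := by linarith
  have h1 : ∑ i : Fin n, Q {p : Pair n | ((i : ℕ) : ℝ) < x ^ 80} ≤ ENNReal.ofReal (2 * x ^ 80) := by
    have e : ∀ i : Fin n, Q {p : Pair n | ((i : ℕ) : ℝ) < x ^ 80}
        = ENNReal.ofReal (if ((i : ℕ) : ℝ) < x ^ 80 then 1 else 0) := by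
      intro i
      by_cases h : ((i : ℕ) : ℝ) < x ^ 80 <;> simp [h]
    simp only [e]
    rw [← ENNReal.ofReal_sum_of_nonneg fun i _ => by split_ifs <;> norm_num]
    refine ENNReal.ofReal_le_ofReal ?_
    rw [Finset.sum_boole]
    have h80 : 1 ≤ x ^ 80 := one_le_pow₀ hx
    have : (Finset.univ.filter fun i : Fin n => ((i : ℕ) : ℝ) < x ^ 80).card ≤ ⌈x ^ 80⌉₊ := by
      rw [← Finset.card_range ⌈x ^ 80⌉₊]
      refine Finset.card_le_card_of_injOn (fun i => (i : ℕ)) (fun i hi => ?_)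
        (fun i _ j _ h => Fin.ext h)
      have hi' := (Finset.mem_filter.1 (Finset.mem_coe.1 hi)).2
      simp only [Finset.coe_range, Set.mem_Iio]
      exact Nat.lt_ceil.2 hi'
    have h2 : ((Finset.univ.filter fun i : Fin n => ((i : ℕ) : ℝ) < x ^ 80).card : ℝ)
        ≤ (⌈x ^ 80⌉₊ : ℝ) := by exact_mod_cast this
    have h3 := Nat.ceil_lt_add_one (a := x ^ 80) (by positivity)
    linarith
  have h2 : ∑ i, Q {p | x ^ 4 < |pairCentred m p i + p.2 i|}
      ≤ ENNReal.ofReal (n * (x ^ 32)⁻¹) := by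
    refine le_trans (le_of_eq ?_) (ENNReal.ofReal_le_ofReal htail)
    rw [ENNReal.ofReal_sum_of_nonneg fun i _ => measureReal_nonneg]
    exact Finset.sum_congr rfl fun i _ => (ofReal_measureReal).symm
  have h3 := hQ.sum_measure_small_density_le hm hdep (L := x ^ 4) (θ := (x ^ 16)⁻¹) (by positivity)
  have hdev : ∀ (g : ℝ → ℝ), Measurable g → (∀ t, |g t| ≤ x ^ 8) →
      ∑ i : Fin n, Q {p | x ^ 80 ≤ ((i : ℕ) : ℝ) ∧ |pairCentred m p i + p.2 i| ≤ x ^ 4 ∧ (x ^ 19)⁻¹ <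
        |kernelDev m g i p (pairCentred m p i + p.2 i)|} ≤ ENNReal.ofReal (n * (8 * (x ^ 22)⁻¹)) := by
    intro g hg hB
    have : ∀ i : Fin n, Q {p | x ^ 80 ≤ ((i : ℕ) : ℝ) ∧ |pairCentred m p i + p.2 i| ≤ x ^ 4 ∧ (x ^ 19)⁻¹ <
        |kernelDev m g i p (pairCentred m p i + p.2 i)|} ≤ ENNReal.ofReal (8 * (x ^ 22)⁻¹) := by
      intro i
      by_cases hi : x ^ 80 ≤ ((i : ℕ) : ℝ)
      · simp only [hi, true_and]
        refine (hQ.measure_kernelDev_large_le hm hdep hg hB i (by positivity)).trans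
          (ENNReal.ofReal_le_ofReal ?_)
        rw [Fin.card_Iio]
        calc 2 * x ^ 4 * (4 * (x ^ 8) ^ 2 * ((i : ℕ) : ℝ)⁻¹) / (x ^ 19)⁻¹ ^ 2
            ≤ 2 * x ^ 4 * (4 * (x ^ 8) ^ 2 * (x ^ 80)⁻¹) / (x ^ 19)⁻¹ ^ 2 := by gcongr
          _ = 8 * (x ^ 22)⁻¹ := by field_simp; norm_num
      · simp [hi]
    calc _ ≤ ∑ i : Fin n, ENNReal.ofReal (8 * (x ^ 22)⁻¹) := Finset.sum_le_sum fun i _ => this i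
      _ = _ := by
        rw [Finset.sum_const, Finset.card_univ, Fintype.card_fin, nsmul_eq_mul,
          ENNReal.ofReal_mul (p := (n : ℝ)) (by positivity), ENNReal.ofReal_natCast]
  have hk := continuous_kern.measurable
  have hk' := continuous_kernDeriv.measurable
  have h4 := hdev (fun t => (x ^ 4)⁻¹⁻¹ * kern (t / (x ^ 4)⁻¹))
    (measurable_const.mul (hk.comp (by fun_prop))) (fun t => by
      rw [abs_mul, abs_of_pos (kern_pos _), inv_inv, abs_of_pos (by positivity)]
      calc x ^ 4 * kern (t / (x ^ 4)⁻¹) ≤ x ^ 4 * 1 := by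
            gcongr; linarith [kern_le_half (t / (x ^ 4)⁻¹)]
        _ ≤ x ^ 8 := by rw [mul_one]; exact pow_le_pow_right₀ hx (by norm_num))
  have h5 := hdev (fun t => -((x ^ 4)⁻¹⁻¹ * (x ^ 4)⁻¹⁻¹ * kernDeriv (t / (x ^ 4)⁻¹)))
    (measurable_const.mul (hk'.comp (by fun_prop))).neg (fun t => by
      rw [abs_neg, abs_mul, inv_inv, abs_of_pos (by positivity)]
      have := abs_kernDeriv_le (t / (x ^ 4)⁻¹)
      calc x ^ 4 * x ^ 4 * |kernDeriv (t / (x ^ 4)⁻¹)| ≤ x ^ 4 * x ^ 4 * 1 := by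
            gcongr; linarith [kern_le_half (t / (x ^ 4)⁻¹)]
        _ ≤ x ^ 8 := by rw [mul_one]; exact le_of_eq (by ring))
  have hn : (0 : ℝ) ≤ n := Nat.cast_nonneg n
  calc ∑ i, Q (badEvent m x i) ≤ ENNReal.ofReal (2 * x ^ 80) + ENNReal.ofReal (n * (x ^ 32)⁻¹)
        + ENNReal.ofReal (2 * x ^ 4 * (n * (x ^ 16)⁻¹)) + ENNReal.ofReal (n * (8 * (x ^ 22)⁻¹))
        + ENNReal.ofReal (n * (8 * (x ^ 22)⁻¹)) := by
        refine le_trans ?_ (add_le_add (add_le_add (add_le_add (add_le_add h1 h2) h3) h4) h5)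
        simp only [← Finset.sum_add_distrib]
        refine Finset.sum_le_sum fun i _ => ?_
        refine (measure_union_le _ _).trans (add_le_add_left ?_ _)
        refine (measure_union_le _ _).trans (add_le_add_left ?_ _)
        refine (measure_union_le _ _).trans (add_le_add_left ?_ _)
        exact measure_union_le _ _
    _ = ENNReal.ofReal (2 * x ^ 80 + n * (x ^ 32)⁻¹ + 2 * x ^ 4 * (n * (x ^ 16)⁻¹)
        + n * (8 * (x ^ 22)⁻¹) + n * (8 * (x ^ 22)⁻¹)) := by
        rw [← ENNReal.ofReal_add, ← ENNReal.ofReal_add, ← ENNReal.ofReal_add,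
          ← ENNReal.ofReal_add] <;> positivity
    _ ≤ _ := by
        refine ENNReal.ofReal_le_ofReal ?_
        set y := x⁻¹ with hy
        have hy0 : 0 < y := by positivity
        have hy1 : y ≤ 1 := inv_le_one_of_one_le₀ hx
        have e : x ^ 4 * (x ^ 16)⁻¹ = y ^ 12 := by
          rw [hy]; field_simp
        have e1 : 2 * x ^ 4 * (n * (x ^ 16)⁻¹) = 2 * n * (x ^ 4 * (x ^ 16)⁻¹) := by ring
        rw [e1, e]
        simp only [← inv_pow]
        rw [← hy]
        have a1 : n * y ^ 32 ≤ n * y ^ 9 := by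
          gcongr ?_ * ?_; exact pow_le_pow_of_le_one hy0.le hy1 (by norm_num)
        have a2 : n * y ^ 22 ≤ n * y ^ 9 := by
          gcongr ?_ * ?_; exact pow_le_pow_of_le_one hy0.le hy1 (by norm_num)
        have a3 : n * y ^ 12 ≤ n * y ^ 9 := by
          gcongr ?_ * ?_; exact pow_le_pow_of_le_one hy0.le hy1 (by norm_num)
        have a4 : 0 ≤ n * y ^ 9 := by positivity
        linarith

/-- On the complement of `badEvent` the loss of the estimator is close to that of the oracle. -/
lemma exists_estimIS_loss_le : ∃ C : ℝ, 1 ≤ C ∧ ∀ {n : ℕ} (m : Fin n → (Fin n → ℝ) → ℝ) (x : ℝ),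
    C ≤ x → x ^ 4 = Real.log n → ∀ (i : Fin n) (p : Pair n),
    (estimIS m i (pairObs p) - p.1 i) ^ 2 ≤ (pairOracle m i p - p.1 i) ^ 2
      + (C * x⁻¹ * (2 + p.2 i ^ 2) + (badEvent m x i).indicator (fun _ => 10 * x ^ 8) p
        + 2 * p.2 i ^ 4 * (x ^ 8)⁻¹) := by
  obtain ⟨C, hC1, hC⟩ := exists_decision_bound
  refine ⟨3 * C ^ 2, by nlinarith, ?_⟩
  intro n m x hCx hx i p
  have hCx' : C ≤ x := by nlinarith
  have hx1 : 1 ≤ x := hC1.trans hCx'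
  have hx0 : 0 < x := by linarith
  rw [estimIS_sub, pairOracle_sub, ← hx, one_div]
  set z := pairCentred m p i + p.2 i with hz
  have hb0 : 0 ≤ (badEvent m x i).indicator (fun _ => 10 * x ^ 8) p :=
    Set.indicator_nonneg (fun _ _ => by positivity) _
  have habs : |p.2 i| ≤ 1 + p.2 i ^ 2 := by
    have := abs_le_sq_add_one (p.2 i); linarith
  by_cases hbad : p ∈ badEvent m x i
  · rw [Set.indicator_of_mem hbad]
    have h1 := abs_estDecision_sub_le (σ := (x ^ 4)⁻¹) (by positivity) (Finset.Iio i)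
      (fun j => pairCentred m p j + p.2 j) z
    rw [div_inv_eq_mul] at h1
    set a := estDecision (x ^ 4)⁻¹ (Finset.Iio i) (fun j => pairCentred m p j + p.2 j) z - z
    have e1 : estDecision (x ^ 4)⁻¹ (Finset.Iio i) (fun j => pairCentred m p j + p.2 j) z
        - pairCentred m p i = a + p.2 i := by simp only [a, hz]; ring
    rw [e1]
    have h2 : a ^ 2 ≤ 4 * x ^ 8 := by
      rw [← sq_abs]
      calc |a| ^ 2 ≤ (2 * x ^ 4) ^ 2 := pow_le_pow_left₀ (abs_nonneg _) h1 2
        _ = _ := by ring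
    -- The noise is unbounded and correlated with the event. Splitting at `x⁸` leaves a term bounded
    -- on the event and one that a fourth moment controls without reference to the event.
    have h3 : p.2 i ^ 2 ≤ x ^ 8 + p.2 i ^ 4 * (x ^ 8)⁻¹ := by
      have h8 : 0 < x ^ 8 := by positivity
      rcases le_total (p.2 i ^ 2) (x ^ 8) with h | h
      · have : 0 ≤ p.2 i ^ 4 * (x ^ 8)⁻¹ := by positivity
        linarith
      · have : p.2 i ^ 2 ≤ p.2 i ^ 4 * (x ^ 8)⁻¹ := by
          rw [← div_eq_mul_inv, le_div_iff₀ h8]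
          nlinarith [sq_nonneg (p.2 i)]
        linarith
    have h4 : 0 ≤ (oracleDecision (Finset.Iic i) (pairCentred m p) z - pairCentred m p i) ^ 2 :=
      sq_nonneg _
    have h5 : 0 ≤ 3 * C ^ 2 * x⁻¹ * (2 + p.2 i ^ 2) := by positivity
    nlinarith [sq_nonneg (a - p.2 i)]
  · simp only [badEvent, Set.mem_union, Set.mem_ofPred_eq, not_or, not_and, not_lt, ← hz] at hbad
    obtain ⟨⟨⟨⟨g1, g2⟩, g3⟩, g4⟩, g5⟩ := hbad
    have hins : insert i (Finset.Iio i) = Finset.Iic i := by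
      ext j; simp [le_iff_eq_or_lt]
    -- The predictable means subtracted in `kernelDev` are exactly the smoothed densities in the
    -- pathwise comparison.
    have e4 : ∀ j, (∫ e, (x ^ 4)⁻¹⁻¹ * kern ((e - (z - pairCentred m p j)) / (x ^ 4)⁻¹) ∂γ)
        = smoothPDF (x ^ 4)⁻¹ (z - pairCentred m p j) := fun j => by
      rw [← integral_kern_stdNormal (by positivity)]
      refine integral_congr_ae (ae_of_all _ fun e => ?_)
      simp only; congr 3; ring
    have e5 : ∀ j, (∫ e, -((x ^ 4)⁻¹⁻¹ * (x ^ 4)⁻¹⁻¹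
          * kernDeriv ((e - (z - pairCentred m p j)) / (x ^ 4)⁻¹)) ∂γ)
        = smoothPDFDeriv (x ^ 4)⁻¹ (z - pairCentred m p j) := fun j => by
      rw [← integral_kernDeriv_stdNormal (by positivity)]
      refine integral_congr_ae (ae_of_all _ fun e => ?_)
      simp only; congr 4; ring
    have h4 := g4 g1 g2
    have h5 := g5 g1 g2
    simp only [kernelDev, e4, e5] at h4 h5
    have hres := hC (Finset.Iio i) i (pairCentred m p) (fun j => pairCentred m p j + p.2 j) x z
      (by simp) (by nlinarith) (by rw [Fin.card_Iio]; exact g1) (by rw [hins]; exact g3 g2) h4 h5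
    rw [hins] at hres
    have := sq_le_sq_add_of_close (C := C) (x := x) (e := p.2 i)
      (a := estDecision (x ^ 4)⁻¹ (Finset.Iio i) (fun j => pairCentred m p j + p.2 j) z
        - pairCentred m p i)
      (b := oracleDecision (Finset.Iic i) (pairCentred m p) z - pairCentred m p i) hC1 hx1
      (by rw [sub_sub_sub_cancel_right]; exact hres.1) (by
        have e6 : oracleDecision (Finset.Iic i) (pairCentred m p) z - pairCentred m p i
          = (oracleDecision (Finset.Iic i) (pairCentred m p) z - z) + p.2 i := by rw [hz]; ring
        rw [e6]
        exact (abs_add_le _ _).trans (by linarith [hres.2]))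
    refine this.trans ?_
    have h6 : 3 * C ^ 2 * x⁻¹ * (1 + |p.2 i|) ≤ 3 * C ^ 2 * x⁻¹ * (2 + p.2 i ^ 2) := by
      gcongr ?_ * ?_; linarith
    have h7 : 0 ≤ 2 * p.2 i ^ 4 * (x ^ 8)⁻¹ := by positivity
    linarith

/-- At a fixed horizon, the risk of the estimator exceeds that of the oracle by little. -/
lemma exists_estimIS_excess : ∃ K : ℝ, 1 ≤ K ∧ ∀ {n : ℕ} (m : Fin n → (Fin n → ℝ) → ℝ)
    (Q : Measure (Pair n)) [IsProbabilityMeasure Q], StdNormalNoise Q → (∀ i, Measurable (m i)) →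
    (∀ i, DependsOn (m i) (Set.Iio i)) → ∀ x : ℝ, K ≤ x → x ^ 4 = Real.log n →
    ∑ i, Q.real {p | x ^ 4 < |pairCentred m p i + p.2 i|} ≤ n * (x ^ 32)⁻¹ →
    ∃ Err : Pair n → ℝ≥0∞, Measurable Err ∧
      (∀ p, ENNReal.ofReal (∑ i, (estimIS m i (pairObs p) - p.1 i) ^ 2)
        ≤ ENNReal.ofReal (∑ i, (pairOracle m i p - p.1 i) ^ 2) + Err p) ∧
      ∫⁻ p, Err p ∂Q ≤ ENNReal.ofReal (K * n * x⁻¹ + 20 * x ^ 88) := by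
  obtain ⟨C, hC1, hC⟩ := exists_estimIS_loss_le
  -- `3C` comes from `E(2 + ε²) = 3`, `430` from the loss bound `10x⁸` times the probability bound
  -- `43n x⁻⁹`, and the last term from the fourth moment of the noise.
  refine ⟨3 * C + 430 + 2 * stdNormalFourth, by linarith [stdNormalFourth_nonneg], ?_⟩
  intro n m Q _ hQ hm hdep x hKx hx htail
  have h4 := stdNormalFourth_nonneg
  have hx1 : 1 ≤ x := by linarith
  have hx0 : 0 < x := by linarith
  set E : Fin n → Pair n → ℝ≥0∞ := fun i p =>
    ENNReal.ofReal (C * x⁻¹) * (2 + ENNReal.ofReal (p.2 i ^ 2))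
      + ENNReal.ofReal (10 * x ^ 8) * (badEvent m x i).indicator 1 p
      + ENNReal.ofReal (2 * (x ^ 8)⁻¹) * ENNReal.ofReal (p.2 i ^ 4) with hE
  have hbm := measurableSet_badEvent hm x
  have hm1 : ∀ i : Fin n, Measurable fun p : Pair n =>
      ENNReal.ofReal (C * x⁻¹) * (2 + ENNReal.ofReal (p.2 i ^ 2)) := fun i => by fun_prop
  have hm2 : ∀ i : Fin n, Measurable fun p : Pair n =>
      ENNReal.ofReal (10 * x ^ 8) * (badEvent m x i).indicator (1 : Pair n → ℝ≥0∞) p := fun i =>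
    (measurable_one.indicator (hbm i)).const_mul _
  have hm3 : ∀ i : Fin n, Measurable fun p : Pair n =>
      ENNReal.ofReal (2 * (x ^ 8)⁻¹) * ENNReal.ofReal (p.2 i ^ 4) := fun i => by fun_prop
  have hEm : ∀ i, Measurable (E i) := fun i => ((hm1 i).add (hm2 i)).add (hm3 i)
  refine ⟨fun p => ∑ i, E i p, Finset.measurable_fun_sum _ fun i _ => hEm i, fun p => ?_, ?_⟩
  · have hE' : ∀ i, E i p = ENNReal.ofReal (C * x⁻¹ * (2 + p.2 i ^ 2)
        + (badEvent m x i).indicator (fun _ => 10 * x ^ 8) p + 2 * p.2 i ^ 4 * (x ^ 8)⁻¹) := by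
      intro i
      have hb0 : 0 ≤ (badEvent m x i).indicator (fun _ => 10 * x ^ 8) p :=
        Set.indicator_nonneg (fun _ _ => by positivity) _
      rw [ENNReal.ofReal_add (by positivity) (by positivity),
        ENNReal.ofReal_add (by positivity) hb0,
        ENNReal.ofReal_mul (p := C * x⁻¹) (by positivity),
        ENNReal.ofReal_add (by norm_num) (by positivity), mul_right_comm 2,
        ENNReal.ofReal_mul (p := 2 * (x ^ 8)⁻¹) (by positivity)]
      simp only [hE]
      congr 2
      · simp
      · by_cases h : p ∈ badEvent m x i <;> simp [h]
    have hE0 : ∀ i, 0 ≤ C * x⁻¹ * (2 + p.2 i ^ 2)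
        + (badEvent m x i).indicator (fun _ => 10 * x ^ 8) p + 2 * p.2 i ^ 4 * (x ^ 8)⁻¹ := by
      intro i
      have hb0 : 0 ≤ (badEvent m x i).indicator (fun _ => 10 * x ^ 8) p :=
        Set.indicator_nonneg (fun _ _ => by positivity) _
      positivity
    simp only [hE']
    rw [← ENNReal.ofReal_sum_of_nonneg fun i _ => hE0 i,
      ← ENNReal.ofReal_add (Finset.sum_nonneg fun i _ => sq_nonneg _)
        (Finset.sum_nonneg fun i _ => hE0 i), ← Finset.sum_add_distrib]
    exact ENNReal.ofReal_le_ofReal (Finset.sum_le_sum fun i _ => hC m x (by linarith) hx i p)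
  · have hint : ∀ i, ∫⁻ p, E i p ∂Q = ENNReal.ofReal (3 * C * x⁻¹
        + 2 * (x ^ 8)⁻¹ * stdNormalFourth) + ENNReal.ofReal (10 * x ^ 8) * Q (badEvent m x i) := by
      intro i
      have hind : Measurable ((badEvent m x i).indicator (1 : Pair n → ℝ≥0∞)) :=
        measurable_one.indicator (hbm i)
      simp only [hE]
      rw [lintegral_add_right _ (hm3 i), lintegral_add_right _ (hm2 i),
        lintegral_const_mul _ (by fun_prop), lintegral_const_mul _ hind,
        lintegral_const_mul _ (by fun_prop), lintegral_indicator_one (hbm i),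
        lintegral_add_right _ (by fun_prop),
        hQ.lintegral_noise i (G := fun x => ENNReal.ofReal (x ^ 2)) (by fun_prop),
        hQ.lintegral_noise i (G := fun x => ENNReal.ofReal (x ^ 4)) (by fun_prop),
        lintegral_sq_stdNormal, lintegral_fourth_stdNormal, lintegral_const, measure_univ, mul_one,
        ← ENNReal.ofReal_mul (by positivity), add_right_comm,
        ENNReal.ofReal_add (by positivity) (by positivity)]
      congr 2
      rw [show 3 * C * x⁻¹ = C * x⁻¹ * 3 by ring,
        ENNReal.ofReal_mul (p := C * x⁻¹) (by positivity)]
      norm_num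
    rw [lintegral_finsetSum _ fun i _ => hEm i]
    simp only [hint]
    rw [Finset.sum_add_distrib, ← Finset.mul_sum, Finset.sum_const, Finset.card_univ,
      Fintype.card_fin, nsmul_eq_mul, ← ENNReal.ofReal_natCast,
      ← ENNReal.ofReal_mul (Nat.cast_nonneg n)]
    have hbad := hQ.sum_measure_badEvent_le hm hdep hx1 htail
    have hn : (0 : ℝ) ≤ n := Nat.cast_nonneg n
    calc _ ≤ ENNReal.ofReal (n * (3 * C * x⁻¹ + 2 * (x ^ 8)⁻¹ * stdNormalFourth))
          + ENNReal.ofReal (10 * x ^ 8) * ENNReal.ofReal (43 * n * (x ^ 9)⁻¹ + 2 * x ^ 80) := by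
          gcongr
      _ = ENNReal.ofReal (n * (3 * C * x⁻¹ + 2 * (x ^ 8)⁻¹ * stdNormalFourth)
          + 10 * x ^ 8 * (43 * n * (x ^ 9)⁻¹ + 2 * x ^ 80)) := by
          rw [← ENNReal.ofReal_mul (by positivity), ← ENNReal.ofReal_add (by positivity)
            (by positivity)]
      _ ≤ _ := by
          refine ENNReal.ofReal_le_ofReal ?_
          have e1 : x ^ 8 * (x ^ 9)⁻¹ = x⁻¹ := by field_simp
          have e2 : (x ^ 8)⁻¹ ≤ x⁻¹ := by
            gcongr; exact le_self_pow₀ hx1 (by norm_num)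
          have e3 : 10 * x ^ 8 * (43 * n * (x ^ 9)⁻¹ + 2 * x ^ 80)
              = 430 * n * (x ^ 8 * (x ^ 9)⁻¹) + 20 * x ^ 88 := by ring
          rw [e3, e1]
          have e4 : n * stdNormalFourth * (x ^ 8)⁻¹ ≤ n * stdNormalFourth * x⁻¹ := by gcongr
          nlinarith

end SeqEB

namespace SeqEB

local notation "φ" => gaussianPDFReal 0 1
local notation "γ" => gaussianReal 0 1

/-! ### Risks of decision functions -/

lemma oracleDecision_eq {ι : Type*} (s : Finset ι) (ν : ι → ℝ) (z : ℝ) :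
    oracleDecision s ν z = z + ((s.card : ℝ)⁻¹ * ∑ j ∈ s, φ (z - ν j) * (ν j - z))
      / mixDensity s ν z := by
  rw [oracleDecision, (mixDensity_hasDerivAt s ν z).deriv]

lemma measurable_oracleDecision {ι : Type*} (s : Finset ι) (ν : ι → ℝ) :
    Measurable (oracleDecision s ν) := by
  have h1 := (measurable_gaussianPDFReal 0 1)
  have : oracleDecision s ν = fun z => z + ((s.card : ℝ)⁻¹ * ∑ j ∈ s, φ (z - ν j) * (ν j - z))
      / mixDensity s ν z := funext fun z => oracleDecision_eq s ν z
  rw [this]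
  unfold mixDensity
  fun_prop

lemma sum_normalRisk_eq_lintegral {ι : Type*} (s : Finset ι) (ν : ι → ℝ) {g : ℝ → ℝ}
    (hg : Measurable g) : ∑ j ∈ s, normalRisk g (ν j)
      = ∫⁻ z, ENNReal.ofReal (∑ j ∈ s, φ (z - ν j) * (g z - ν j) ^ 2) := by
  rw [Finset.sum_congr rfl fun j _ => normalRisk_eq hg (ν j), ← lintegral_finsetSum]
  · refine lintegral_congr fun z => ?_
    rw [ENNReal.ofReal_sum_of_nonneg]
    exact fun j _ => mul_nonneg (gaussianPDFReal_nonneg _ _ _) (sq_nonneg _)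
  · intro j _
    exact (((measurable_gaussianPDFReal 0 1).comp (measurable_id.sub_const _)).mul
      ((hg.sub_const _).pow_const 2)).ennreal_ofReal

/-- The risks of the successive oracles add up to no more than the risk of the last oracle. -/
lemma sum_normalRisk_sequential_le {n : ℕ} (ν : Fin n → ℝ) :
    ∑ i, normalRisk (oracleDecision (Finset.Iic i) ν) (ν i)
      ≤ ∑ i, normalRisk (oracleDecision Finset.univ ν) (ν i) := by
  -- Induction on the number of times. The newest time already uses the minimizer for the enlarged
  -- set. On the earlier times the minimizer for the smaller set does no worse than that for the
  -- enlarged set.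
  have key : ∀ k : ℕ, k ≤ n →
      ∑ i ∈ Finset.univ.filter (fun i : Fin n => (i : ℕ) < k),
        normalRisk (oracleDecision (Finset.Iic i) ν) (ν i)
      ≤ ∑ i ∈ Finset.univ.filter (fun i : Fin n => (i : ℕ) < k),
        normalRisk (oracleDecision (Finset.univ.filter (fun i : Fin n => (i : ℕ) < k)) ν) (ν i) := by
    intro k
    induction k with
    | zero => intro _; simp
    | succ k ih =>
      intro hk
      set S := Finset.univ.filter (fun i : Fin n => (i : ℕ) < k) with hS
      set i₀ : Fin n := ⟨k, hk⟩ with hi₀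
      have h1 : Finset.univ.filter (fun i : Fin n => (i : ℕ) < k + 1) = insert i₀ S := by
        ext j
        simp only [Finset.mem_filter, Finset.mem_univ, true_and, Finset.mem_insert, hS, hi₀,
          Fin.ext_iff]
        omega
      have h2 : insert i₀ S = Finset.Iic i₀ := by
        ext j
        simp only [Finset.mem_filter, Finset.mem_univ, true_and, Finset.mem_insert, hS, hi₀,
          Fin.ext_iff, Finset.mem_Iic, Fin.le_def]
        omega
      have h3 : i₀ ∉ S := by simp [hS, hi₀]
      rw [h1, Finset.sum_insert h3, Finset.sum_insert h3, h2]
      refine add_le_add le_rfl ?_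
      exact (ih (by omega)).trans (oracleDecision_isMin S ν _ (measurable_oracleDecision _ ν))
  have := key n le_rfl
  simpa using this

lemma sq_clip_sub_le {T : ℝ} (hT : 0 < T) (w : ℝ) :
    (max (-T) (min w T) - w) ^ 2 ≤ w ^ 4 / T ^ 2 := by
  have hp : 0 ≤ w ^ 4 / T ^ 2 := by positivity
  have hbig : T ^ 2 ≤ w ^ 2 → w ^ 2 ≤ w ^ 4 / T ^ 2 := fun h => by
    rw [le_div_iff₀ (by positivity)]; nlinarith [sq_nonneg w]
  rcases le_total w T with h1 | h1
  · rw [min_eq_left h1]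
    rcases le_total (-T) w with h2 | h2
    · rw [max_eq_right h2]; simpa using hp
    · rw [max_eq_left h2]
      exact le_trans (by nlinarith) (hbig (by nlinarith))
  · rw [min_eq_right h1, max_eq_right (by linarith)]
    exact le_trans (by nlinarith) (hbig (by nlinarith))

lemma sq_clip_le {T : ℝ} (hT : 0 < T) (w : ℝ) : (max (-T) (min w T)) ^ 2 ≤ T ^ 2 :=
  sq_le_sq' (le_max_left _ _) (max_le (by linarith) (min_le_right _ _))

lemma lintegral_stdPDF_fourth (v : ℝ) :
    ∫⁻ z, ENNReal.ofReal (φ (z - v) * (z - v) ^ 4) = ENNReal.ofReal stdNormalFourth := by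
  have := lintegral_stdNormal_add (G := fun z => ENNReal.ofReal ((z - v) ^ 4)) (by fun_prop) v
  simp only [add_sub_cancel_left, lintegral_fourth_stdNormal] at this
  rw [this]
  refine lintegral_congr fun z => ENNReal.ofReal_mul (stdPDF_pos _).le

/-- The displacement of the oracle is the posterior mean of `ν - z`. Jensen's inequality bounds its
fourth power by the posterior fourth moment, and multiplying by the density turns this into a sum
whose integral is explicit. -/
lemma sum_stdPDF_mul_clip_le {ι : Type*} (s : Finset ι) (ν : ι → ℝ) {T : ℝ} (hT : 0 < T) (z : ℝ) :
    (max (-T) (min (oracleDecision s ν z - z) T) - (oracleDecision s ν z - z)) ^ 2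
        * ∑ j ∈ s, φ (z - ν j)
      ≤ ∑ j ∈ s, φ (z - ν j) * (z - ν j) ^ 4 / T ^ 2 := by
  rcases s.eq_empty_or_nonempty with rfl | hs
  · simp
  set w := oracleDecision s ν z - z with hw
  set F := ∑ j ∈ s, φ (z - ν j) with hF
  have hF0 : 0 < F := Finset.sum_pos (fun j _ => stdPDF_pos _) hs
  have hwsum : w = ∑ j ∈ s, φ (z - ν j) / F * (ν j - z) := by
    have hc : (s.card : ℝ)⁻¹ ≠ 0 := by simpa using hs.ne_empty
    rw [hw, oracleDecision_eq, mixDensity, mul_div_mul_left _ _ hc, add_sub_cancel_left,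
      Finset.sum_div]
    exact Finset.sum_congr rfl fun j _ => by ring
  have hpow : w ^ 4 ≤ ∑ j ∈ s, φ (z - ν j) / F * (ν j - z) ^ 4 := by
    rw [hwsum]
    refine Real.pow_arith_mean_le_arith_mean_pow_of_even s _ _ (fun j _ => ?_) ?_ (by decide)
    · exact div_nonneg (stdPDF_pos _).le hF0.le
    · rw [← Finset.sum_div, ← hF, div_self hF0.ne']
  calc (max (-T) (min w T) - w) ^ 2 * F ≤ w ^ 4 / T ^ 2 * F := by
        gcongr; exact sq_clip_sub_le hT w
    _ ≤ (∑ j ∈ s, φ (z - ν j) / F * (ν j - z) ^ 4) / T ^ 2 * F := by gcongr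
    _ = _ := by
        rw [div_mul_eq_mul_div, Finset.sum_mul, Finset.sum_div]
        refine Finset.sum_congr rfl fun j _ => ?_
        field_simp
        ring

/-- The oracle risk on all points is at most the risk on a subset of any decision function, plus a
moderate cost for each additional point. -/
lemma sum_normalRisk_oracle_le {n : ℕ} (ν : Fin n → ℝ) (s : Finset (Fin n)) {T : ℝ} (hT : 0 < T)
    {δ : ℝ → ℝ} (hδ : Measurable δ) :
    ∑ i, normalRisk (oracleDecision Finset.univ ν) (ν i)
      ≤ ∑ j ∈ s, normalRisk δ (ν j)
        + ENNReal.ofReal (n * (stdNormalFourth / T ^ 2) + 2 * (T ^ 2 + 1) * sᶜ.card) := by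
  have ho := measurable_oracleDecision s ν
  set o := oracleDecision s ν with ho'
  -- The oracle of `s` is clipped to move an observation by at most `T`. Its risk is then bounded at
  -- every state, even outside `s`, while on `s` clipping costs only a fourth moment over `T²`.
  set g : ℝ → ℝ := fun z => z + max (-T) (min (o z - z) T) with hgdef
  have hg : Measurable g := by fun_prop
  have h4 := stdNormalFourth_nonneg
  have hin : ∑ j ∈ s, normalRisk g (ν j)
      ≤ ∑ j ∈ s, normalRisk δ (ν j) + ENNReal.ofReal (s.card * (stdNormalFourth / T ^ 2)) := by
    refine le_trans ?_ (add_le_add_left (oracleDecision_isMin s ν δ hδ) _)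
    rw [sum_normalRisk_eq_lintegral s ν hg, sum_normalRisk_eq_lintegral s ν ho]
    have hsum : ENNReal.ofReal (s.card * (stdNormalFourth / T ^ 2))
        = ∫⁻ z, ENNReal.ofReal (∑ j ∈ s, φ (z - ν j) * (z - ν j) ^ 4 / T ^ 2) := by
      have e : ∀ z, ENNReal.ofReal (∑ j ∈ s, φ (z - ν j) * (z - ν j) ^ 4 / T ^ 2)
          = ∑ j ∈ s, ENNReal.ofReal (φ (z - ν j) * (z - ν j) ^ 4) * ENNReal.ofReal ((T ^ 2)⁻¹) := by
        intro z
        have h0 : ∀ j, 0 ≤ φ (z - ν j) * (z - ν j) ^ 4 := fun j =>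
          mul_nonneg (stdPDF_pos _).le (by positivity)
        rw [ENNReal.ofReal_sum_of_nonneg fun j _ => div_nonneg (h0 j) (by positivity)]
        exact Finset.sum_congr rfl fun j _ => by rw [div_eq_mul_inv, ENNReal.ofReal_mul (h0 j)]
      simp only [e]
      have hmeas : ∀ j, Measurable fun z => ENNReal.ofReal (φ (z - ν j) * (z - ν j) ^ 4) := fun j =>
        (((measurable_gaussianPDFReal 0 1).comp (measurable_id.sub_const _)).mul
          ((measurable_id.sub_const _).pow_const 4)).ennreal_ofReal
      rw [lintegral_finsetSum _ fun j _ => (hmeas j).mul_const _]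
      simp only [lintegral_mul_const' _ _ ENNReal.ofReal_ne_top, lintegral_stdPDF_fourth]
      rw [Finset.sum_const, nsmul_eq_mul, ENNReal.ofReal_mul (Nat.cast_nonneg _),
        ENNReal.ofReal_natCast, div_eq_mul_inv, ENNReal.ofReal_mul h4]
    rw [hsum, ← lintegral_add_left]
    · refine lintegral_mono fun z => ?_
      rw [← ENNReal.ofReal_add]
      · refine ENNReal.ofReal_le_ofReal ?_
        -- Orthogonality of the Bayes residual removes the cross term, so clipping costs exactly the
        -- squared distance to the oracle.
        have h0 := sum_weight_oracle s ν z
        have hexp : ∑ j ∈ s, φ (z - ν j) * (g z - ν j) ^ 2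
            = ∑ j ∈ s, φ (z - ν j) * (o z - ν j) ^ 2
              + 2 * (g z - o z) * ∑ j ∈ s, φ (z - ν j) * (o z - ν j)
              + (g z - o z) ^ 2 * ∑ j ∈ s, φ (z - ν j) := by
          rw [Finset.mul_sum, Finset.mul_sum, ← Finset.sum_add_distrib, ← Finset.sum_add_distrib]
          exact Finset.sum_congr rfl fun j _ => by ring
        have hclip := sum_stdPDF_mul_clip_le s ν hT z
        have e2 : g z - o z = max (-T) (min (o z - z) T) - (o z - z) := by simp only [hgdef]; ring
        rw [hexp, h0, mul_zero, add_zero, e2]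
        gcongr
      · exact Finset.sum_nonneg fun j _ => mul_nonneg (stdPDF_pos _).le (sq_nonneg _)
      · exact Finset.sum_nonneg fun j _ => div_nonneg
          (mul_nonneg (stdPDF_pos _).le (by positivity)) (by positivity)
    · refine Measurable.ennreal_ofReal (Finset.measurable_fun_sum s fun j _ => ?_)
      exact ((measurable_gaussianPDFReal 0 1).comp (measurable_id.sub_const _)).mul
        ((ho.sub_const _).pow_const 2)
  have hout : ∀ v, normalRisk g v ≤ ENNReal.ofReal (2 * (T ^ 2 + 1)) := by
    intro v
    calc normalRisk g v ≤ ∫⁻ e, (ENNReal.ofReal (2 * T ^ 2) + 2 * ENNReal.ofReal (e ^ 2)) ∂γ := by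
          refine lintegral_mono fun e => ?_
          have e2 : (2 : ℝ≥0∞) = ENNReal.ofReal 2 := by norm_num
          rw [e2, ← ENNReal.ofReal_mul (by norm_num), ← ENNReal.ofReal_add (by positivity)
            (by positivity)]
          refine ENNReal.ofReal_le_ofReal ?_
          have h1 := sq_clip_le hT (o (v + e) - (v + e))
          simp only [hgdef]
          nlinarith [sq_nonneg (e - max (-T) (min (o (v + e) - (v + e)) T))]
      _ = _ := by
          rw [lintegral_add_left measurable_const, lintegral_const, measure_univ, mul_one,
            lintegral_const_mul _ (by fun_prop), lintegral_sq_stdNormal, mul_one, mul_add,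
            ENNReal.ofReal_add (by positivity) (by norm_num)]
          norm_num
  calc ∑ i, normalRisk (oracleDecision Finset.univ ν) (ν i)
      ≤ ∑ i, normalRisk g (ν i) := oracleDecision_isMin _ ν g hg
    _ = ∑ i ∈ s, normalRisk g (ν i) + ∑ i ∈ sᶜ, normalRisk g (ν i) :=
        (Finset.sum_add_sum_compl s _).symm
    _ ≤ (∑ j ∈ s, normalRisk δ (ν j) + ENNReal.ofReal (s.card * (stdNormalFourth / T ^ 2)))
        + ∑ i ∈ sᶜ, ENNReal.ofReal (2 * (T ^ 2 + 1)) :=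
        add_le_add hin (Finset.sum_le_sum fun i _ => hout _)
    _ ≤ _ := by
        rw [add_assoc, Finset.sum_const, nsmul_eq_mul, ← ENNReal.ofReal_natCast,
          ← ENNReal.ofReal_mul (Nat.cast_nonneg _), ← ENNReal.ofReal_add (by positivity)
            (by positivity), mul_comm (sᶜ.card : ℝ)]
        gcongr
        exact (Finset.card_le_univ s).trans (by simp)

/-- The inner product of a perturbation with the residual of the linear rule `z ↦ β z`. -/
noncomputable def linearScore (h : ℝ → ℝ) (β v : ℝ) : ℝ := ∫ e, h (v + e) * (β * (v + e) - v) ∂γ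

/-- The risk of a bounded perturbation of a linear decision function. -/
lemma normalRisk_linear_sub {h : ℝ → ℝ} (hh : Measurable h) {H : ℝ} (hH : ∀ z, |h z| ≤ H)
    (β t v : ℝ) :
    0 ≤ (1 - β) ^ 2 * v ^ 2 + β ^ 2
      - (2 * t * linearScore h β v - t ^ 2 * ∫ e, h (v + e) ^ 2 ∂γ) ∧
    normalRisk (fun z => β * z - t * h z) v = ENNReal.ofReal ((1 - β) ^ 2 * v ^ 2 + β ^ 2
      - (2 * t * linearScore h β v - t ^ 2 * ∫ e, h (v + e) ^ 2 ∂γ)) := by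
  have i1 : Integrable (fun e : ℝ => e) γ := by simpa using integrable_pow_stdNormal 1
  have i2 := integrable_pow_stdNormal 2
  have hhv : Measurable fun e => h (v + e) := hh.comp (by fun_prop)
  have ih : Integrable (fun e => h (v + e)) γ :=
    Integrable.of_bound hhv.aestronglyMeasurable H (ae_of_all _ fun e => hH _)
  have ih1 : Integrable (fun e => h (v + e) * (β * (v + e) - v)) γ := by
    refine Integrable.bdd_mul (c := H) ?_ hhv.aestronglyMeasurable (ae_of_all _ fun e => hH _)
    exact (((integrable_const v).add i1).const_mul β).sub (integrable_const v)
  have ih2 : Integrable (fun e => h (v + e) ^ 2) γ := by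
    simp only [sq]
    exact ih.bdd_mul hhv.aestronglyMeasurable (ae_of_all _ fun e => hH _)
  have e1 : ∀ e, (β * (v + e) - t * h (v + e) - v) ^ 2
      = ((1 - β) ^ 2 * v ^ 2 - 2 * β * (1 - β) * v * e + β ^ 2 * e ^ 2)
        - (2 * t * (h (v + e) * (β * (v + e) - v)) - t ^ 2 * h (v + e) ^ 2) := fun e => by ring
  have i5 : Integrable (fun e : ℝ => (1 - β) ^ 2 * v ^ 2 - 2 * β * (1 - β) * v * e) γ :=
    (integrable_const _).sub (i1.const_mul _)
  have i3 : Integrable (fun e : ℝ =>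
      (1 - β) ^ 2 * v ^ 2 - 2 * β * (1 - β) * v * e + β ^ 2 * e ^ 2) γ :=
    i5.add (i2.const_mul _)
  have i4 : Integrable (fun e => 2 * t * (h (v + e) * (β * (v + e) - v))
      - t ^ 2 * h (v + e) ^ 2) γ := (ih1.const_mul _).sub (ih2.const_mul _)
  have e2 : ∫ e, (β * (v + e) - t * h (v + e) - v) ^ 2 ∂γ = (1 - β) ^ 2 * v ^ 2 + β ^ 2
      - (2 * t * linearScore h β v - t ^ 2 * ∫ e, h (v + e) ^ 2 ∂γ) := by
    simp only [e1]
    rw [integral_sub i3 i4, integral_sub (ih1.const_mul _) (ih2.const_mul _),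
      integral_add i5 (i2.const_mul _),
      integral_sub (integrable_const _) (i1.const_mul _), integral_const_mul, integral_const_mul,
      integral_const_mul, integral_const_mul, integral_self_stdNormal, integral_sq_stdNormal]
    simp [linearScore, integral_const_mul]
  rw [normalRisk, ← ofReal_integral_eq_lintegral_ofReal _ (ae_of_all _ fun e => sq_nonneg _), e2]
  · exact ⟨e2 ▸ integral_nonneg fun e => sq_nonneg _, rfl⟩
  · simp only [e1]
    exact i3.sub i4

lemma normalRisk_linear (β v : ℝ) :
    normalRisk (fun z => β * z) v = ENNReal.ofReal ((1 - β) ^ 2 * v ^ 2 + β ^ 2) := by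
  simpa using
    (normalRisk_linear_sub (h := fun _ => 0) (H := 0) measurable_const (by simp) β 0 v).2

/-- The realized loss of a linear rule bounds the best linear risk from above, up to the
fluctuations of two sums. -/
lemma sum_linear_risk_le {ι : Type*} (s : Finset ι) (ν e : ι → ℝ) {β : ℝ} (hβ : 0 < β) :
    ∑ i ∈ s, ((1 - min β 1) ^ 2 * ν i ^ 2 + (min β 1) ^ 2)
      ≤ ∑ i ∈ s, (β * (ν i + e i) - ν i) ^ 2 + |∑ i ∈ s, ν i * e i| + |∑ i ∈ s, (e i ^ 2 - 1)| := by
  set W := ∑ i ∈ s, ν i * e i with hW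
  set q := ∑ i ∈ s, (e i ^ 2 - 1) with hq
  set S := ∑ i ∈ s, ν i ^ 2 with hS
  have hS0 : 0 ≤ S := Finset.sum_nonneg fun i _ => sq_nonneg _
  have h1 : ∀ b : ℝ, ∑ i ∈ s, ((1 - b) ^ 2 * ν i ^ 2 + b ^ 2) = (1 - b) ^ 2 * S + s.card * b ^ 2 := by
    intro b
    rw [Finset.sum_add_distrib, ← Finset.mul_sum, Finset.sum_const, nsmul_eq_mul]
  have h2 : ∑ i ∈ s, (β * (ν i + e i) - ν i) ^ 2
      = (1 - β) ^ 2 * S - 2 * β * (1 - β) * W + β ^ 2 * (s.card + q) := by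
    have : (s.card : ℝ) + q = ∑ i ∈ s, e i ^ 2 := by
      rw [hq, Finset.sum_sub_distrib, Finset.sum_const, nsmul_eq_mul]; ring
    rw [this, hS, hW, Finset.mul_sum, Finset.mul_sum, Finset.mul_sum, ← Finset.sum_sub_distrib,
      ← Finset.sum_add_distrib]
    exact Finset.sum_congr rfl fun i _ => by ring
  have h3 : 0 ≤ ∑ i ∈ s, (β * (ν i + e i) - ν i) ^ 2 := Finset.sum_nonneg fun i _ => sq_nonneg _
  have h4 : 0 ≤ S + 2 * W + (s.card + q) := by
    have : S + 2 * W + (s.card + q) = ∑ i ∈ s, (ν i + e i) ^ 2 := by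
      have : (s.card : ℝ) + q = ∑ i ∈ s, e i ^ 2 := by
        rw [hq, Finset.sum_sub_distrib, Finset.sum_const, nsmul_eq_mul]; ring
      rw [this, hS, hW, Finset.mul_sum, ← Finset.sum_add_distrib, ← Finset.sum_add_distrib]
      exact Finset.sum_congr rfl fun i _ => by ring
    rw [this]
    exact Finset.sum_nonneg fun i _ => sq_nonneg _
  have hWa := neg_abs_le W
  have hWb := le_abs_self W
  have hqa := neg_abs_le q
  have hW0 := abs_nonneg W
  have hq0 := abs_nonneg q
  rw [h1]
  rcases le_total β 1 with hb | hb
  · rw [min_eq_left hb, h2]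
    have a1 : 2 * β * (1 - β) * W ≤ |W| := by
      have : 2 * β * (1 - β) ≤ 1 := by nlinarith [sq_nonneg (2 * β - 1)]
      have h0 : 0 ≤ 2 * β * (1 - β) := by
        have : 0 ≤ 1 - β := by linarith
        positivity
      nlinarith
    have a2 : -(β ^ 2 * q) ≤ |q| := by
      have : β ^ 2 ≤ 1 := by nlinarith
      nlinarith [sq_nonneg β]
    linarith
  · rw [min_eq_right hb]
    -- The loss is convex in `β` with slope `2(W + |s| + q)` at `β = 1` and value `|s| + q` there.
    -- If the slope is nonnegative, the loss at `β ≥ 1` is at least that value. Otherwise `|s| ≤ |W|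
    -- + |q|` and the claim is trivial.
    rcases le_total 0 (W + (s.card + q)) with h | h
    · rw [h2]
      have a1 : 0 ≤ (β - 1) * (W + (s.card + q)) := mul_nonneg (by linarith) h
      have a2 : 0 ≤ (β - 1) ^ 2 * (S + 2 * W + (s.card + q)) := mul_nonneg (sq_nonneg _) h4
      nlinarith
    · linarith

lemma measurable_pairOracle {n : ℕ} {m : Fin n → (Fin n → ℝ) → ℝ} (hm : ∀ i, Measurable (m i))
    (i : Fin n) : Measurable (pairOracle m i) := by
  have h1 : Measurable fun q : Pair n × ℝ => oracleDecision (Finset.Iic i) (pairCentred m q.1) q.2 := by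
    simp only [oracleDecision_eq]
    have hφ := measurable_gaussianPDFReal 0 1
    have hν : ∀ j, Measurable fun q : Pair n × ℝ => pairCentred m q.1 j := fun j =>
      (measurable_pairCentred_apply hm j).comp measurable_fst
    refine measurable_snd.add ((measurable_const.mul (Finset.measurable_fun_sum _ fun j _ =>
      (hφ.comp (measurable_snd.sub (hν j))).mul ((hν j).sub measurable_snd))).div
        (measurable_mixDensity_pair hm _))
  have h2 := h1.comp (measurable_pair_resid hm i)
  have h3 : pairOracle m i = fun p => m i (pairObs p) + oracleDecision (Finset.Iic i)
      (pairCentred m p) (pairCentred m p i + p.2 i) := by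
    ext p; rw [pairOracle, resid_pairObs]
  rw [h3]
  exact ((hm i).comp measurable_pairObs).add h2

/-- The risk of the sequential oracle is at most that of the final oracle. -/
lemma StdNormalNoise.lintegral_pairOracle_le {n : ℕ} {m : Fin n → (Fin n → ℝ) → ℝ}
    {Q : Measure (Pair n)} (hQ : StdNormalNoise Q) (hm : ∀ i, Measurable (m i))
    (hdep : ∀ i, DependsOn (m i) (Set.Iio i)) :
    ∫⁻ p, ENNReal.ofReal (∑ i, (pairOracle m i p - p.1 i) ^ 2) ∂Q
      ≤ ∫⁻ p, ∑ i, normalRisk (oracleDecision Finset.univ (pairCentred m p)) (pairCentred m p i) ∂Q := by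
  have hmeas : ∀ i, Measurable fun p : Pair n =>
      ENNReal.ofReal ((pairOracle m i p - p.1 i) ^ 2) := fun i =>
    (((measurable_pairOracle hm i).sub (by fun_prop)).pow_const 2).ennreal_ofReal
  have hrisk : ∀ i p, ∫⁻ x, ENNReal.ofReal ((pairOracle m i (resample i p x)
      - (resample i p x).1 i) ^ 2) ∂γ
      = normalRisk (oracleDecision (Finset.Iic i) (pairCentred m p)) (pairCentred m p i) := by
    intro i p
    rw [normalRisk]
    refine lintegral_congr fun x => ?_
    rw [pairOracle_sub, pairCentred_resample hdep le_rfl, resample_noise_self]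
    have : ∀ z, oracleDecision (Finset.Iic i) (pairCentred m (resample i p x)) z
        = oracleDecision (Finset.Iic i) (pairCentred m p) z := by
      intro z
      rw [oracleDecision_eq, oracleDecision_eq, mixDensity_resample hdep]
      congr 3
      refine Finset.sum_congr rfl fun j hj => ?_
      rw [pairCentred_resample hdep (Finset.mem_Iic.1 hj)]
    rw [this]
  have h1 : ∫⁻ p, ENNReal.ofReal (∑ i, (pairOracle m i p - p.1 i) ^ 2) ∂Q
      = ∑ i, ∫⁻ p, normalRisk (oracleDecision (Finset.Iic i) (pairCentred m p))
          (pairCentred m p i) ∂Q := by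
    simp only [ENNReal.ofReal_sum_of_nonneg fun i _ => sq_nonneg _]
    rw [lintegral_finsetSum _ fun i _ => hmeas i]
    refine Finset.sum_congr rfl fun i _ => ?_
    rw [hQ.lintegral_eq i (hmeas i)]
    exact lintegral_congr fun p => hrisk i p
  rw [h1]
  have h2 : ∀ i, Measurable fun p : Pair n =>
      normalRisk (oracleDecision (Finset.Iic i) (pairCentred m p)) (pairCentred m p i) := by
    intro i
    simp only [← hrisk i]
    exact ((hmeas i).comp (measurable_resample i)).lintegral_prod_right'
  rw [← lintegral_finsetSum _ fun i _ => h2 i]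
  exact lintegral_mono fun p => sum_normalRisk_sequential_le _

end SeqEB

namespace SeqEB

local notation "φ" => gaussianPDFReal 0 1
local notation "γ" => gaussianReal 0 1

/-! ### Lower bound for the risk of the benchmark -/

/-- The time points that are far from both ends. -/
noncomputable def midTimes (n : ℕ) (κ : ℝ) : Finset (Fin n) :=
  Finset.univ.filter fun i => κ * n ≤ (i : ℕ) + 1 ∧ ((i : ℕ) + 1 : ℝ) ≤ (1 - κ) * n

lemma card_compl_midTimes_le (n : ℕ) {κ : ℝ} (hκ : 0 ≤ κ) :
    ((midTimes n κ)ᶜ.card : ℝ) ≤ 2 * κ * n + 1 := by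
  set A := Finset.univ.filter fun i : Fin n => ((i : ℕ) + 1 : ℝ) < κ * n with hA
  set B := Finset.univ.filter fun i : Fin n => (1 - κ) * n < ((i : ℕ) + 1 : ℝ) with hB
  have hsub : (midTimes n κ)ᶜ ⊆ A ∪ B := by
    intro i hi
    simp only [midTimes, Finset.mem_compl, Finset.mem_filter, Finset.mem_univ, true_and,
      not_and_or, not_le] at hi
    simpa [hA, hB] using hi
  have hκn : 0 ≤ κ * n := by positivity
  have hAc : (A.card : ℝ) ≤ κ * n := by
    have : A.card ≤ ⌊κ * n⌋₊ := by
      rw [← Finset.card_range ⌊κ * n⌋₊]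
      refine Finset.card_le_card_of_injOn (fun i => (i : ℕ)) (fun i hi => ?_)
        (fun i _ j _ h => Fin.ext h)
      have hi' := (Finset.mem_filter.1 (Finset.mem_coe.1 hi)).2
      simp only [Finset.coe_range, Set.mem_Iio]
      exact Nat.lt_of_succ_le (Nat.le_floor (by push_cast; exact hi'.le))
    exact le_trans (by exact_mod_cast this) (Nat.floor_le hκn)
  have hBc : (B.card : ℝ) ≤ κ * n + 1 := by
    have : B.card ≤ ⌈κ * n⌉₊ := by
      rw [← Finset.card_range ⌈κ * n⌉₊]
      refine Finset.card_le_card_of_injOn (fun i => n - 1 - (i : ℕ)) (fun i hi => ?_)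
        (fun i _ j _ h => Fin.ext ?_)
      · have hi' := (Finset.mem_filter.1 (Finset.mem_coe.1 hi)).2
        simp only [Finset.coe_range, Set.mem_Iio]
        refine Nat.lt_ceil.2 ?_
        have e : ((n - 1 - (i : ℕ) : ℕ) : ℝ) = n - 1 - (i : ℕ) := by
          have := i.2
          rw [Nat.cast_sub (by omega), Nat.cast_sub (by omega)]; simp
        rw [e]; linarith
      · have h1 := i.2
        have h2 := j.2
        simp only at h
        omega
    exact le_trans (by exact_mod_cast this) (Nat.ceil_lt_add_one hκn).le
  calc ((midTimes n κ)ᶜ.card : ℝ) ≤ (A.card : ℝ) + B.card := by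
        exact_mod_cast (Finset.card_le_card hsub).trans (Finset.card_union_le _ _)
    _ ≤ _ := by linarith

variable {n : ℕ} {m : Fin n → (Fin n → ℝ) → ℝ}

/-- The time points far from both ends at which the centred state is not large. -/
noncomputable def tameTimes (m : Fin n → (Fin n → ℝ) → ℝ) (κ L : ℝ) (p : Pair n) :
    Finset (Fin n) :=
  (midTimes n κ).filter fun i => |pairCentred m p i| ≤ 2 * L

/-- The difference of the benchmark and the weighted average of the prediction and the
observation. -/
def remainderTerm (m h : Fin n → (Fin n → ℝ) → ℝ) (α : (Fin n → ℝ) → ℝ) (i : Fin n)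
    (p : Pair n) : ℝ :=
  h i (pairObs p) - (α (pairObs p) * m i (pairObs p) + (1 - α (pairObs p)) * pairObs p i)

/-- A sum over the tame time points, as a sum over all of them. -/
noncomputable def tameSum (m : Fin n → (Fin n → ℝ) → ℝ) (κ L : ℝ) (D : Fin n → Pair n → ℝ)
    (p : Pair n) : ℝ :=
  ∑ i, if i ∈ tameTimes m κ L p then D i p else 0

lemma sq_le_of_remainder {a b r : ℝ} (hr : 0 < r) :
    (a - b) ^ 2 ≤ (1 + r) * a ^ 2 + (1 + r⁻¹) * b ^ 2 := by
  have h : 0 ≤ (r * a + b) ^ 2 * r⁻¹ := by positivity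
  have e : (r * a + b) ^ 2 * r⁻¹ = r * a ^ 2 + 2 * a * b + r⁻¹ * b ^ 2 := by
    field_simp
    ring
  nlinarith

lemma card_compl_tameTimes_le {κ L : ℝ} (p : Pair n) :
    ((tameTimes m κ L p)ᶜ.card : ℝ) ≤ ((midTimes n κ)ᶜ.card : ℝ)
      + ∑ i, {p | 2 * L < |pairCentred m p i|}.indicator (fun _ => (1 : ℝ)) p := by
  have e : ∑ i, {p | 2 * L < |pairCentred m p i|}.indicator (fun _ => (1 : ℝ)) p
      = ((Finset.univ.filter fun i => 2 * L < |pairCentred m p i|).card : ℝ) := by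
    rw [← Finset.sum_boole]
    exact Finset.sum_congr rfl fun i _ => by simp [Set.indicator]
  rw [e]
  have hsub : (tameTimes m κ L p)ᶜ
      ⊆ (midTimes n κ)ᶜ ∪ Finset.univ.filter fun i => 2 * L < |pairCentred m p i| := by
    intro i hi
    simp only [tameTimes, Finset.mem_compl, Finset.mem_filter, not_and_or, not_le] at hi
    simpa using hi
  exact_mod_cast (Finset.card_le_card hsub).trans (Finset.card_union_le _ _)

/-- The comparison is made pathwise because `α` depends on the data and cannot be held fixed under
an expectation; the error terms are free of `α`. The competitor in `hg` may vary with `p` and `s`,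
since the risks are taken with the states frozen at `p`. The allowance `c` per discarded time covers
a gain earned outside `s`. -/
lemma oracle_add_gain_le (h : Fin n → (Fin n → ℝ) → ℝ) (α : (Fin n → ℝ) → ℝ) (hα : ∀ y, α y < 1)
    {κ L T r c : ℝ} (hκ : 0 ≤ κ) (hT : 0 < T) (hr : 0 < r) (hc : 0 ≤ c) (p : Pair n) (g : ℝ)
    (hg : ∀ s : Finset (Fin n), ∃ δ : ℝ → ℝ, Measurable δ ∧
      ∑ j ∈ s, normalRisk δ (pairCentred m p j) + ENNReal.ofReal g ≤ ENNReal.ofReal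
        (∑ j ∈ s, ((1 - min (1 - α (pairObs p)) 1) ^ 2 * pairCentred m p j ^ 2
          + (min (1 - α (pairObs p)) 1) ^ 2) + c * sᶜ.card)) :
    ∑ i, normalRisk (oracleDecision Finset.univ (pairCentred m p)) (pairCentred m p i)
        + ENNReal.ofReal g
      ≤ ENNReal.ofReal (1 + r) * ENNReal.ofReal (∑ i, (h i (pairObs p) - p.1 i) ^ 2)
        + (ENNReal.ofReal (1 + r⁻¹) * ∑ i ∈ midTimes n κ,
            ENNReal.ofReal (remainderTerm m h α i p ^ 2)
          + ENNReal.ofReal |tameSum m κ L (fun i p => pairCentred m p i * p.2 i) p|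
          + ENNReal.ofReal |tameSum m κ L (fun i p => p.2 i ^ 2 - 1) p|
          + ENNReal.ofReal (n * (stdNormalFourth / T ^ 2) + (2 * (T ^ 2 + 1) + c) * (2 * κ * n + 1))
          + ENNReal.ofReal (2 * (T ^ 2 + 1) + c) *
            ∑ i, {p | 2 * L < |pairCentred m p i|}.indicator 1 p) := by
  set s := tameTimes m κ L p with hs
  obtain ⟨δ, hδ, hgδ⟩ := hg s
  have h4 := stdNormalFourth_nonneg
  set β := 1 - α (pairObs p) with hβ
  have hβ0 : 0 < β := by have := hα (pairObs p); linarith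
  have h1 := sum_normalRisk_oracle_le (pairCentred m p) s hT hδ
  have hlin := sum_linear_risk_le s (pairCentred m p) p.2 hβ0
  have hW : tameSum m κ L (fun i p => pairCentred m p i * p.2 i) p
      = ∑ i ∈ s, pairCentred m p i * p.2 i := by
    rw [tameSum, Finset.sum_ite_mem, Finset.univ_inter]
  have hq : tameSum m κ L (fun i p => p.2 i ^ 2 - 1) p = ∑ i ∈ s, (p.2 i ^ 2 - 1) := by
    rw [tameSum, Finset.sum_ite_mem, Finset.univ_inter]
  rw [hW, hq]
  set X := ∑ i, (h i (pairObs p) - p.1 i) ^ 2 with hX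
  set Y := ∑ i ∈ midTimes n κ, remainderTerm m h α i p ^ 2 with hY
  set I := ∑ i, {p | 2 * L < |pairCentred m p i|}.indicator (fun _ => (1 : ℝ)) p with hI
  have hX0 : 0 ≤ X := Finset.sum_nonneg fun i _ => sq_nonneg _
  have hY0 : 0 ≤ Y := Finset.sum_nonneg fun i _ => sq_nonneg _
  have hI0 : 0 ≤ I := Finset.sum_nonneg fun i _ => Set.indicator_nonneg (fun _ _ => zero_le_one) _
  have hIe : ∑ i, {p | 2 * L < |pairCentred m p i|}.indicator (1 : Pair n → ℝ≥0∞) p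
      = ENNReal.ofReal I := by
    rw [hI, ENNReal.ofReal_sum_of_nonneg fun i _ => Set.indicator_nonneg (fun _ _ => zero_le_one) _]
    refine Finset.sum_congr rfl fun i _ => ?_
    by_cases hi : 2 * L < |pairCentred m p i| <;> simp [Set.indicator, hi]
  have hYe : ∑ i ∈ midTimes n κ, ENNReal.ofReal (remainderTerm m h α i p ^ 2)
      = ENNReal.ofReal Y := (ENNReal.ofReal_sum_of_nonneg fun i _ => sq_nonneg _).symm
  have hloss : ∑ i ∈ s, (β * (pairCentred m p i + p.2 i) - pairCentred m p i) ^ 2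
      ≤ (1 + r) * X + (1 + r⁻¹) * Y := by
    have e : ∀ i, β * (pairCentred m p i + p.2 i) - pairCentred m p i
        = (h i (pairObs p) - p.1 i) - remainderTerm m h α i p := by
      intro i
      simp only [remainderTerm, hβ, pairCentred, pairObs]; ring
    calc _ ≤ ∑ i ∈ s, ((1 + r) * (h i (pairObs p) - p.1 i) ^ 2
          + (1 + r⁻¹) * remainderTerm m h α i p ^ 2) := by
          refine Finset.sum_le_sum fun i _ => ?_
          rw [e]; exact sq_le_of_remainder hr
      _ = (1 + r) * ∑ i ∈ s, (h i (pairObs p) - p.1 i) ^ 2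
          + (1 + r⁻¹) * ∑ i ∈ s, remainderTerm m h α i p ^ 2 := by
          rw [Finset.sum_add_distrib, ← Finset.mul_sum, ← Finset.mul_sum]
      _ ≤ _ := by
          have a1 : ∑ i ∈ s, (h i (pairObs p) - p.1 i) ^ 2 ≤ X :=
            Finset.sum_le_sum_of_subset_of_nonneg (Finset.subset_univ _) fun i _ _ => sq_nonneg _
          have a2 : ∑ i ∈ s, remainderTerm m h α i p ^ 2 ≤ Y :=
            Finset.sum_le_sum_of_subset_of_nonneg (Finset.filter_subset _ _)
              fun i _ _ => sq_nonneg _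
          gcongr
  have hcard := card_compl_tameTimes_le (m := m) (κ := κ) (L := L) p
  have hmid := card_compl_midTimes_le n hκ
  rw [← hs, ← hI] at hcard
  set W := |∑ i ∈ s, pairCentred m p i * p.2 i|
  set q := |∑ i ∈ s, (p.2 i ^ 2 - 1)|
  have hW0 : 0 ≤ W := abs_nonneg _
  have hq0 : 0 ≤ q := abs_nonneg _
  rw [hIe, hYe]
  rw [← ENNReal.ofReal_mul (by positivity), ← ENNReal.ofReal_mul (by positivity),
    ← ENNReal.ofReal_mul (by positivity), ← ENNReal.ofReal_add (by positivity) (by positivity),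
    ← ENNReal.ofReal_add (by positivity) (by positivity),
    ← ENNReal.ofReal_add (by positivity) (by positivity),
    ← ENNReal.ofReal_add (by positivity) (by positivity),
    ← ENNReal.ofReal_add (by positivity) (by positivity)]
  calc _ ≤ ∑ j ∈ s, normalRisk δ (pairCentred m p j)
        + ENNReal.ofReal (n * (stdNormalFourth / T ^ 2) + 2 * (T ^ 2 + 1) * sᶜ.card)
        + ENNReal.ofReal g := by gcongr
    _ = (∑ j ∈ s, normalRisk δ (pairCentred m p j) + ENNReal.ofReal g)
        + ENNReal.ofReal (n * (stdNormalFourth / T ^ 2) + 2 * (T ^ 2 + 1) * sᶜ.card) :=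
        add_right_comm _ _ _
    _ ≤ ENNReal.ofReal (∑ j ∈ s, ((1 - min β 1) ^ 2 * pairCentred m p j ^ 2
          + (min β 1) ^ 2) + c * sᶜ.card)
        + ENNReal.ofReal (n * (stdNormalFourth / T ^ 2) + 2 * (T ^ 2 + 1) * sᶜ.card) := by gcongr
    _ = ENNReal.ofReal ((∑ j ∈ s, ((1 - min β 1) ^ 2 * pairCentred m p j ^ 2
          + (min β 1) ^ 2) + c * sᶜ.card)
        + (n * (stdNormalFourth / T ^ 2) + 2 * (T ^ 2 + 1) * sᶜ.card)) := by
        have a1 : 0 ≤ ∑ j ∈ s, ((1 - min β 1) ^ 2 * pairCentred m p j ^ 2 + (min β 1) ^ 2) :=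
          Finset.sum_nonneg fun i _ => by positivity
        exact (ENNReal.ofReal_add (by positivity) (by positivity)).symm
    _ ≤ _ := by
        refine ENNReal.ofReal_le_ofReal ?_
        have h5 : (2 * (T ^ 2 + 1) + c) * sᶜ.card
            ≤ (2 * (T ^ 2 + 1) + c) * (2 * κ * n + 1 + I) := by
          gcongr; linarith
        linarith

lemma measurable_remainderTerm {h : Fin n → (Fin n → ℝ) → ℝ} {α : (Fin n → ℝ) → ℝ}
    (hm : ∀ i, Measurable (m i)) (hh : ∀ i, Measurable (h i)) (hα : Measurable α) (i : Fin n) :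
    Measurable (remainderTerm m h α i) := by
  have ho := measurable_pairObs (n := n)
  have hoi : Measurable fun p : Pair n => pairObs p i := (measurable_pi_apply i).comp ho
  exact ((hh i).comp ho).sub (((hα.comp ho).mul ((hm i).comp ho)).add
    ((measurable_const.sub (hα.comp ho)).mul hoi))

lemma measurable_tameSum_term (hm : ∀ i, Measurable (m i)) {κ L : ℝ} {D : Fin n → Pair n → ℝ}
    (hD : ∀ i, Measurable (D i)) (i : Fin n) :
    Measurable fun p => if i ∈ tameTimes m κ L p then D i p else 0 := by
  refine Measurable.ite ?_ (hD i) measurable_const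
  simp only [tameTimes, Finset.mem_filter]
  exact (MeasurableSet.const _).inter
    (measurableSet_le (measurable_pairCentred_apply hm i).abs measurable_const)

lemma measurable_tameSum (hm : ∀ i, Measurable (m i)) {κ L : ℝ} {D : Fin n → Pair n → ℝ}
    (hD : ∀ i, Measurable (D i)) : Measurable (tameSum m κ L D) :=
  Finset.measurable_fun_sum _ fun i _ => measurable_tameSum_term hm hD i

/-- Membership of `j` depends on `ν_j` only and is predictable, so restricting to tame times
preserves the martingale structure. -/
lemma mem_tameTimes_resample (hdep : ∀ i, DependsOn (m i) (Set.Iio i)) {κ L : ℝ} {i j : Fin n}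
    (hij : j ≤ i) (p : Pair n) (x : ℝ) :
    j ∈ tameTimes m κ L (resample i p x) ↔ j ∈ tameTimes m κ L p := by
  simp only [tameTimes, Finset.mem_filter, pairCentred_resample hdep hij]

variable {Q : Measure (Pair n)} [IsProbabilityMeasure Q]

/-- Uses `|f| ≤ a + f²/a`. With `a` a small multiple of `n`, a variance that is `o(n²)` yields a
mean absolute value below any prescribed multiple of `n` eventually. -/
lemma lintegral_abs_le_of_sq {f : Pair n → ℝ} (hf : Measurable f) {a c : ℝ} (ha : 0 < a)
    (hc : ∫⁻ p, ENNReal.ofReal (f p ^ 2) ∂Q ≤ ENNReal.ofReal (a * c)) (hc0 : 0 ≤ c) :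
    ∫⁻ p, ENNReal.ofReal |f p| ∂Q ≤ ENNReal.ofReal (a + c) := by
  have h1 : ∀ p, ENNReal.ofReal |f p|
      ≤ ENNReal.ofReal a + ENNReal.ofReal a⁻¹ * ENNReal.ofReal (f p ^ 2) := by
    intro p
    rw [← ENNReal.ofReal_mul (by positivity), ← ENNReal.ofReal_add ha.le (by positivity)]
    refine ENNReal.ofReal_le_ofReal ?_
    have h0 : 0 ≤ (|f p| - a) ^ 2 * a⁻¹ := by positivity
    have e : (|f p| - a) ^ 2 * a⁻¹ = a⁻¹ * f p ^ 2 - 2 * |f p| + a := by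
      rw [← sq_abs (f p)]; field_simp; ring
    have := abs_nonneg (f p)
    linarith
  calc ∫⁻ p, ENNReal.ofReal |f p| ∂Q
      ≤ ∫⁻ p, (ENNReal.ofReal a + ENNReal.ofReal a⁻¹ * ENNReal.ofReal (f p ^ 2)) ∂Q :=
        lintegral_mono h1
    _ = ENNReal.ofReal a + ENNReal.ofReal a⁻¹ * ∫⁻ p, ENNReal.ofReal (f p ^ 2) ∂Q := by
        rw [lintegral_add_left measurable_const, lintegral_const, measure_univ, mul_one,
          lintegral_const_mul _ (hf.pow_const 2).ennreal_ofReal]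
    _ ≤ ENNReal.ofReal a + ENNReal.ofReal a⁻¹ * ENNReal.ofReal (a * c) := by gcongr
    _ = _ := by
        rw [← ENNReal.ofReal_mul (by positivity), ← ENNReal.ofReal_add ha.le (by positivity),
          inv_mul_cancel_left₀ ha.ne']

lemma lintegral_add_error_terms {F f₁ f₂ f₃ f₄ : Pair n → ℝ≥0∞} (c : ℝ≥0∞) (h₁ : Measurable f₁)
    (h₂ : Measurable f₂) (h₃ : Measurable f₃) (h₄ : Measurable f₄) :
    ∫⁻ p, (F p + (f₁ p + f₂ p + f₃ p + c + f₄ p)) ∂Q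
      = ∫⁻ p, F p ∂Q + (∫⁻ p, f₁ p ∂Q + ∫⁻ p, f₂ p ∂Q + ∫⁻ p, f₃ p ∂Q + c + ∫⁻ p, f₄ p ∂Q) := by
  rw [lintegral_add_right _ (by fun_prop), lintegral_add_right _ h₄,
    lintegral_add_right _ measurable_const, lintegral_add_right _ h₃, lintegral_add_right _ h₂,
    lintegral_const, measure_univ, mul_one]

lemma StdNormalNoise.lintegral_tameSum_linear_le (hQ : StdNormalNoise Q)
    (hm : ∀ i, Measurable (m i)) (hdep : ∀ i, DependsOn (m i) (Set.Iio i)) {κ L : ℝ} :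
    ∫⁻ p, ENNReal.ofReal (tameSum m κ L (fun i p => pairCentred m p i * p.2 i) p ^ 2) ∂Q
      ≤ ENNReal.ofReal (n * (4 * L ^ 2)) := by
  have hD : ∀ i, Measurable fun p : Pair n => pairCentred m p i * p.2 i := fun i =>
    (measurable_pairCentred_apply hm i).mul (by fun_prop)
  have h := hQ.lintegral_sq_sum_le
    (D := fun i p => if i ∈ tameTimes m κ L p then pairCentred m p i * p.2 i else 0)
    (c := fun _ => 4 * L ^ 2) (fun k => measurable_tameSum_term hm hD k)
    (fun j k hjk p x => by
      simp only [mem_tameTimes_resample hdep hjk.le, pairCentred_resample hdep hjk.le,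
        resample_noise_of_ne hjk.ne])
    (fun k p => by
      simp only [mem_tameTimes_resample hdep le_rfl, pairCentred_resample hdep le_rfl,
        resample_noise_self]
      split_ifs
      · rw [integral_const_mul, integral_self_stdNormal, mul_zero]
      · simp)
    (fun k => by
      calc _ ≤ ∫⁻ p, ENNReal.ofReal (4 * L ^ 2) * ENNReal.ofReal (p.2 k ^ 2) ∂Q := by
            refine lintegral_mono fun p => ?_
            rw [← ENNReal.ofReal_mul (by positivity)]
            refine ENNReal.ofReal_le_ofReal ?_
            split_ifs with hk
            · have h1 := (Finset.mem_filter.1 hk).2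
              have h2 : pairCentred m p k ^ 2 ≤ 4 * L ^ 2 := by
                rw [← sq_abs]
                calc |pairCentred m p k| ^ 2 ≤ (2 * L) ^ 2 :=
                      pow_le_pow_left₀ (abs_nonneg _) h1 2
                  _ = _ := by ring
              rw [mul_pow]; gcongr
            · rw [zero_pow two_ne_zero]; positivity
        _ = _ := by
            rw [lintegral_const_mul _ (by fun_prop),
              hQ.lintegral_noise k (G := fun x => ENNReal.ofReal (x ^ 2)) (by fun_prop),
              lintegral_sq_stdNormal, mul_one])
    (fun k => by positivity)
  simp only [Finset.sum_const, Finset.card_univ, Fintype.card_fin, nsmul_eq_mul] at h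
  exact h

lemma StdNormalNoise.lintegral_tameSum_sq_le (hQ : StdNormalNoise Q)
    (hm : ∀ i, Measurable (m i)) (hdep : ∀ i, DependsOn (m i) (Set.Iio i)) {κ L : ℝ} :
    ∫⁻ p, ENNReal.ofReal (tameSum m κ L (fun i p => p.2 i ^ 2 - 1) p ^ 2) ∂Q
      ≤ ENNReal.ofReal (n * (stdNormalFourth + 1)) := by
  have hD : ∀ i, Measurable fun p : Pair n => p.2 i ^ 2 - 1 := fun i => by fun_prop
  have h4 := stdNormalFourth_nonneg
  have h := hQ.lintegral_sq_sum_le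
    (D := fun i p => if i ∈ tameTimes m κ L p then p.2 i ^ 2 - 1 else 0)
    (c := fun _ => stdNormalFourth + 1) (fun k => measurable_tameSum_term hm hD k)
    (fun j k hjk p x => by
      simp only [mem_tameTimes_resample hdep hjk.le, resample_noise_of_ne hjk.ne])
    (fun k p => by
      simp only [mem_tameTimes_resample hdep le_rfl, resample_noise_self]
      split_ifs
      · rw [integral_sub (integrable_pow_stdNormal 2) (integrable_const _),
          integral_sq_stdNormal]; simp
      · simp)
    (fun k => by
      calc _ ≤ ∫⁻ p, (ENNReal.ofReal (p.2 k ^ 4) + 1) ∂Q := by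
            refine lintegral_mono fun p => ?_
            rw [← ENNReal.ofReal_one, ← ENNReal.ofReal_add (by positivity) (by norm_num)]
            refine ENNReal.ofReal_le_ofReal ?_
            split_ifs
            · nlinarith [sq_nonneg (p.2 k)]
            · rw [zero_pow two_ne_zero]; positivity
        _ = _ := by
            rw [lintegral_add_right _ measurable_const,
              hQ.lintegral_noise k (G := fun x => ENNReal.ofReal (x ^ 4)) (by fun_prop),
              lintegral_fourth_stdNormal, ENNReal.ofReal_add h4 (by norm_num)]
            simp)
    (fun k => by positivity)
  simp only [Finset.sum_const, Finset.card_univ, Fintype.card_fin, nsmul_eq_mul] at h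
  exact h

/-- A large `ν_i` forces a large residual or a large noise, and the latter is handled by Chebyshev's
inequality. -/
lemma StdNormalNoise.sum_measure_large_centred_le (hQ : StdNormalNoise Q)
    {L b : ℝ} (hL : 0 < L) (hb : 0 ≤ b)
    (htail : ∑ i, Q.real {p | L < |pairCentred m p i + p.2 i|} ≤ n * b) :
    ∑ i, Q {p | 2 * L < |pairCentred m p i|} ≤ ENNReal.ofReal (n * (b + (L ^ 2)⁻¹)) := by
  have h1 : ∀ i, Q {p | L < |p.2 i|} ≤ ENNReal.ofReal ((L ^ 2)⁻¹) := by
    intro i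
    have hS : MeasurableSet {p : Pair n | L < |p.2 i|} :=
      measurableSet_lt measurable_const (Measurable.abs (by fun_prop))
    rw [← lintegral_indicator_one hS]
    calc _ ≤ ∫⁻ p, ENNReal.ofReal ((L ^ 2)⁻¹) * ENNReal.ofReal (p.2 i ^ 2) ∂Q := by
          refine lintegral_mono fun p => ?_
          by_cases hp : L < |p.2 i|
          · rw [Set.indicator_of_mem (by exact hp), ← ENNReal.ofReal_mul (by positivity)]
            rw [Pi.one_apply, ENNReal.one_le_ofReal, ← div_eq_inv_mul, one_le_div (by positivity),
              ← sq_abs (p.2 i)]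
            exact pow_le_pow_left₀ hL.le hp.le 2
          · rw [Set.indicator_of_notMem (by exact hp)]; exact zero_le
      _ = _ := by
          rw [lintegral_const_mul _ (by fun_prop),
            hQ.lintegral_noise i (G := fun x => ENNReal.ofReal (x ^ 2)) (by fun_prop),
            lintegral_sq_stdNormal, mul_one]
  have h2 : ∑ i, Q {p | L < |pairCentred m p i + p.2 i|} ≤ ENNReal.ofReal (n * b) := by
    refine le_trans (le_of_eq ?_) (ENNReal.ofReal_le_ofReal htail)
    rw [ENNReal.ofReal_sum_of_nonneg fun i _ => measureReal_nonneg]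
    exact Finset.sum_congr rfl fun i _ => (ofReal_measureReal).symm
  calc ∑ i, Q {p | 2 * L < |pairCentred m p i|}
      ≤ ∑ i, (Q {p | L < |pairCentred m p i + p.2 i|} + ENNReal.ofReal ((L ^ 2)⁻¹)) := by
        refine Finset.sum_le_sum fun i _ => ?_
        refine le_trans (measure_mono fun p hp => ?_) ((measure_union_le
          {p : Pair n | L < |pairCentred m p i + p.2 i|} {p | L < |p.2 i|}).trans
          (add_le_add_right (h1 i) _))
        by_contra hcon
        simp only [Set.mem_union, Set.mem_ofPred_eq, not_or, not_lt] at hcon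
        have hp' : 2 * L < |pairCentred m p i| := hp
        have := abs_sub (pairCentred m p i + p.2 i) (p.2 i)
        rw [add_sub_cancel_right] at this
        linarith [hcon.1, hcon.2]
    _ ≤ ENNReal.ofReal (n * b) + ENNReal.ofReal (n * (L ^ 2)⁻¹) := by
        rw [Finset.sum_add_distrib]
        gcongr
        rw [Finset.sum_const, Finset.card_univ, Fintype.card_fin, nsmul_eq_mul,
          ENNReal.ofReal_mul (Nat.cast_nonneg n), ENNReal.ofReal_natCast]
    _ = _ := by rw [← ENNReal.ofReal_add (by positivity) (by positivity), mul_add]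

/-- The oracle risk plus a gain is at most the risk of the benchmark, up to small terms. -/
lemma StdNormalNoise.lintegral_oracle_add_gain_le (hQ : StdNormalNoise Q)
    (hm : ∀ i, Measurable (m i)) (hdep : ∀ i, DependsOn (m i) (Set.Iio i))
    {h : Fin n → (Fin n → ℝ) → ℝ} (hh : ∀ i, Measurable (h i)) {α : (Fin n → ℝ) → ℝ}
    (hαm : Measurable α) (hα : ∀ y, α y < 1) (hn : 0 < n)
    {κ L T r c b ζ : ℝ} (hκ : 0 ≤ κ) (hL : 0 < L) (hT : 0 < T) (hr : 0 < r) (hc : 0 ≤ c)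
    (hb : 0 ≤ b) (hζ0 : 0 ≤ ζ) (g : Pair n → ℝ)
    (hg : ∀ p, ∀ s : Finset (Fin n), ∃ δ : ℝ → ℝ, Measurable δ ∧
      ∑ j ∈ s, normalRisk δ (pairCentred m p j) + ENNReal.ofReal (g p) ≤ ENNReal.ofReal
        (∑ j ∈ s, ((1 - min (1 - α (pairObs p)) 1) ^ 2 * pairCentred m p j ^ 2
          + (min (1 - α (pairObs p)) 1) ^ 2) + c * sᶜ.card))
    (htail : ∑ i, Q.real {p | L < |pairCentred m p i + p.2 i|} ≤ n * b)
    (hζ : ∀ i ∈ midTimes n κ,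
      ∫⁻ p, ENNReal.ofReal (remainderTerm m h α i p ^ 2) ∂Q ≤ ENNReal.ofReal ζ) :
    ∫⁻ p, ENNReal.ofReal (∑ i, (pairOracle m i p - p.1 i) ^ 2) ∂Q + ∫⁻ p, ENNReal.ofReal (g p) ∂Q
      ≤ ENNReal.ofReal (1 + r) * ∫⁻ p, ENNReal.ofReal (∑ i, (h i (pairObs p) - p.1 i) ^ 2) ∂Q
        + ENNReal.ofReal ((1 + r⁻¹) * (n * ζ) + (r * n + 4 * L ^ 2 / r)
          + (r * n + (stdNormalFourth + 1) / r)
          + (n * (stdNormalFourth / T ^ 2) + (2 * (T ^ 2 + 1) + c) * (2 * κ * n + 1))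
          + (2 * (T ^ 2 + 1) + c) * (n * (b + (L ^ 2)⁻¹))) := by
  have h4 := stdNormalFourth_nonneg
  have hn' : (0 : ℝ) < n := Nat.cast_pos.2 hn
  have hDW : ∀ i, Measurable fun p : Pair n => pairCentred m p i * p.2 i := fun i =>
    (measurable_pairCentred_apply hm i).mul (by fun_prop)
  have hDq : ∀ i, Measurable fun p : Pair n => p.2 i ^ 2 - 1 := fun i => by fun_prop
  have mW := measurable_tameSum hm (κ := κ) (L := L) hDW
  have mq := measurable_tameSum hm (κ := κ) (L := L) hDq
  have mR : ∀ i, Measurable fun p => ENNReal.ofReal (remainderTerm m h α i p ^ 2) := fun i =>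
    ((measurable_remainderTerm hm hh hαm i).pow_const 2).ennreal_ofReal
  have mI : ∀ i, MeasurableSet {p : Pair n | 2 * L < |pairCentred m p i|} := fun i =>
    measurableSet_lt measurable_const (measurable_pairCentred_apply hm i).abs
  have iW : ∫⁻ p, ENNReal.ofReal |tameSum m κ L (fun i p => pairCentred m p i * p.2 i) p| ∂Q
      ≤ ENNReal.ofReal (r * n + 4 * L ^ 2 / r) := by
    refine lintegral_abs_le_of_sq mW (by positivity) ?_ (by positivity)
    convert hQ.lintegral_tameSum_linear_le hm hdep (κ := κ) (L := L) using 2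
    field_simp
  have iq : ∫⁻ p, ENNReal.ofReal |tameSum m κ L (fun i p => p.2 i ^ 2 - 1) p| ∂Q
      ≤ ENNReal.ofReal (r * n + (stdNormalFourth + 1) / r) := by
    refine lintegral_abs_le_of_sq mq (by positivity) ?_ (by positivity)
    convert hQ.lintegral_tameSum_sq_le hm hdep (κ := κ) (L := L) using 2
    field_simp
  have iR : ∑ i ∈ midTimes n κ, ∫⁻ p, ENNReal.ofReal (remainderTerm m h α i p ^ 2) ∂Q
      ≤ ENNReal.ofReal (n * ζ) := by
    refine (Finset.sum_le_sum hζ).trans ?_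
    rw [Finset.sum_const, nsmul_eq_mul, ENNReal.ofReal_mul hn'.le, ENNReal.ofReal_natCast]
    gcongr
    exact (Finset.card_le_univ _).trans (by simp)
  have iI := hQ.sum_measure_large_centred_le hL hb htail
  calc _ ≤ ∫⁻ p, ∑ i, normalRisk (oracleDecision Finset.univ (pairCentred m p))
          (pairCentred m p i) ∂Q + ∫⁻ p, ENNReal.ofReal (g p) ∂Q := by
        exact add_le_add_left (hQ.lintegral_pairOracle_le hm hdep) _
    -- Superadditivity of the lower integral needs no measurability of either summand.
    _ ≤ ∫⁻ p, (∑ i, normalRisk (oracleDecision Finset.univ (pairCentred m p))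
          (pairCentred m p i) + ENNReal.ofReal (g p)) ∂Q := le_lintegral_add _ _
    _ ≤ _ := lintegral_mono fun p => oracle_add_gain_le h α hα hκ hT hr hc p (g p) (hg p) (L := L)
    _ = ENNReal.ofReal (1 + r) * ∫⁻ p, ENNReal.ofReal (∑ i, (h i (pairObs p) - p.1 i) ^ 2) ∂Q
        + (ENNReal.ofReal (1 + r⁻¹) * ∑ i ∈ midTimes n κ,
            ∫⁻ p, ENNReal.ofReal (remainderTerm m h α i p ^ 2) ∂Q
          + ∫⁻ p, ENNReal.ofReal |tameSum m κ L (fun i p => pairCentred m p i * p.2 i) p| ∂Q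
          + ∫⁻ p, ENNReal.ofReal |tameSum m κ L (fun i p => p.2 i ^ 2 - 1) p| ∂Q
          + ENNReal.ofReal (n * (stdNormalFourth / T ^ 2) + (2 * (T ^ 2 + 1) + c) * (2 * κ * n + 1))
          + ENNReal.ofReal (2 * (T ^ 2 + 1) + c) * ∑ i, Q {p | 2 * L < |pairCentred m p i|}) := by
        have mI' : ∀ i, Measurable ({p : Pair n | 2 * L < |pairCentred m p i|}.indicator
            (1 : Pair n → ℝ≥0∞)) := fun i => measurable_one.indicator (mI i)
        have m1 : Measurable fun p => ENNReal.ofReal (1 + r⁻¹) * ∑ i ∈ midTimes n κ,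
            ENNReal.ofReal (remainderTerm m h α i p ^ 2) :=
          (Finset.measurable_fun_sum _ fun i _ => mR i).const_mul _
        have m2 := mW.abs.ennreal_ofReal
        have m3 := mq.abs.ennreal_ofReal
        have m5 : Measurable fun p => ENNReal.ofReal (2 * (T ^ 2 + 1) + c) *
            ∑ i, {p : Pair n | 2 * L < |pairCentred m p i|}.indicator (1 : Pair n → ℝ≥0∞) p :=
          (Finset.measurable_fun_sum _ fun i _ => mI' i).const_mul _
        rw [lintegral_add_error_terms _ m1 m2 m3 m5, lintegral_const_mul' _ _ ENNReal.ofReal_ne_top,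
          lintegral_const_mul' _ _ ENNReal.ofReal_ne_top,
          lintegral_const_mul' _ _ ENNReal.ofReal_ne_top, lintegral_finsetSum _ fun i _ => mR i,
          lintegral_finsetSum _ fun i _ => mI' i]
        simp only [lintegral_indicator_one (mI _)]
    _ ≤ ENNReal.ofReal (1 + r) * ∫⁻ p, ENNReal.ofReal (∑ i, (h i (pairObs p) - p.1 i) ^ 2) ∂Q
        + (ENNReal.ofReal (1 + r⁻¹) * ENNReal.ofReal (n * ζ)
          + ENNReal.ofReal (r * n + 4 * L ^ 2 / r)
          + ENNReal.ofReal (r * n + (stdNormalFourth + 1) / r)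
          + ENNReal.ofReal (n * (stdNormalFourth / T ^ 2) + (2 * (T ^ 2 + 1) + c) * (2 * κ * n + 1))
          + ENNReal.ofReal (2 * (T ^ 2 + 1) + c) * ENNReal.ofReal (n * (b + (L ^ 2)⁻¹))) := by
        gcongr
    _ = _ := by
        congr 1
        rw [← ENNReal.ofReal_mul (by positivity), ← ENNReal.ofReal_mul (by positivity),
          ← ENNReal.ofReal_add (by positivity) (by positivity),
          ← ENNReal.ofReal_add (by positivity) (by positivity),
          ← ENNReal.ofReal_add (by positivity) (by positivity),
          ← ENNReal.ofReal_add (by positivity) (by positivity)]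

end SeqEB

namespace SeqEB

local notation "φ" => gaussianPDFReal 0 1
local notation "γ" => gaussianReal 0 1

/-! ### Linear rules are improvable unless the prior is normal -/

section Mixture

variable (G : Measure ℝ)

/-- The density of `G ∗ N(0,1)`. -/
noncomputable def mixtureDensity (z : ℝ) : ℝ := ∫ v, φ (z - v) ∂G

/-- Minus the derivative of the density of `G ∗ N(0,1)`. -/
noncomputable def mixtureSlope (z : ℝ) : ℝ := ∫ v, (z - v) * φ (z - v) ∂G

lemma abs_mul_stdPDF_le_one (u : ℝ) : |u * φ u| ≤ 1 := by
  simpa using abs_stdPDF_deriv_le_one u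

variable [IsProbabilityMeasure G]

lemma integrable_stdPDF_sub (z : ℝ) : Integrable (fun v => φ (z - v)) G := by
  have hφ := continuous_stdPDF
  refine Integrable.of_bound (Continuous.aestronglyMeasurable (by fun_prop)) 1
    (ae_of_all _ fun v => ?_)
  rw [Real.norm_eq_abs, abs_of_pos (stdPDF_pos _)]
  exact stdPDF_le_one _

lemma integrable_mul_stdPDF_sub (z : ℝ) : Integrable (fun v => (z - v) * φ (z - v)) G := by
  have hφ := continuous_stdPDF
  exact Integrable.of_bound (Continuous.aestronglyMeasurable (by fun_prop)) 1
    (ae_of_all _ fun v => abs_mul_stdPDF_le_one _)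

lemma hasDerivAt_mixtureDensity (z : ℝ) :
    HasDerivAt (mixtureDensity G) (-mixtureSlope G z) z := by
  have hφ := continuous_stdPDF
  have := (hasDerivAt_integral_of_dominated_loc_of_deriv_le (μ := G) (𝕜 := ℝ)
    (F := fun z v => φ (z - v)) (F' := fun z v => -(z - v) * φ (z - v)) (x₀ := z) (s := Set.univ)
    (bound := fun _ => 1) univ_mem
    (Eventually.of_forall fun x => (integrable_stdPDF_sub G x).aestronglyMeasurable)
    (integrable_stdPDF_sub G z) (Continuous.aestronglyMeasurable (by fun_prop))
    (ae_of_all _ fun v x _ => by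
      simpa only [Real.norm_eq_abs, neg_mul, abs_neg] using abs_mul_stdPDF_le_one (x - v))
    (integrable_const _)
    (ae_of_all _ fun v x _ => (hasDerivAt_stdPDF (x - v)).comp_sub_const x v)).2
  refine this.congr_deriv ?_
  simp only [mixtureSlope, neg_mul]
  rw [integral_neg]

lemma continuous_mixtureSlope : Continuous (mixtureSlope G) := by
  have hφ := continuous_stdPDF
  exact continuous_of_dominated (bound := fun _ => 1)
    (fun z => (integrable_mul_stdPDF_sub G z).aestronglyMeasurable)
    (fun z => ae_of_all _ fun v => abs_mul_stdPDF_le_one _) (integrable_const _)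
    (ae_of_all _ fun v => by fun_prop)

lemma conv_stdNormal_eq_withDensity :
    G ∗ γ = (volume : Measure ℝ).withDensity fun z => ENNReal.ofReal (mixtureDensity G z) := by
  have hφ := measurable_gaussianPDFReal 0 1
  ext S hS
  have hind : Measurable (S.indicator (1 : ℝ → ℝ≥0∞)) := measurable_one.indicator hS
  rw [← lintegral_indicator_one hS, Measure.lintegral_conv hind, withDensity_apply _ hS,
    ← lintegral_indicator hS]
  simp only [lintegral_stdNormal_add hind]
  rw [lintegral_lintegral_swap]
  · refine lintegral_congr fun z => ?_
    have h1 : ENNReal.ofReal (mixtureDensity G z) = ∫⁻ v, ENNReal.ofReal (φ (z - v)) ∂G :=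
      ofReal_integral_eq_lintegral_ofReal (integrable_stdPDF_sub G z)
        (ae_of_all _ fun v => (stdPDF_pos _).le)
    by_cases h : z ∈ S <;> simp [h, h1]
  · refine Measurable.aemeasurable ?_
    exact ((hφ.comp (measurable_snd.sub measurable_fst)).ennreal_ofReal).mul
      (hind.comp measurable_snd)

/-- The hypothesis is the differential equation `f' = -a z f` for the density of `G ∗ N(0,1)`. Its
only probability solution is the `N(0, 1/a)` density, and deconvolution leaves variance `1/a - 1`.
-/
lemma eq_gaussianReal_of_mixtureSlope_eq {a : ℝ} (ha : 0 < a) (ha1 : a < 1)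
    (h : ∀ z, mixtureSlope G z = a * z * mixtureDensity G z) :
    G = gaussianReal 0 (Real.toNNReal ((1 - a) / a)) := by
  set w : ℝ≥0 := Real.toNNReal a⁻¹ with hw
  have hwa : (w : ℝ) = a⁻¹ := Real.coe_toNNReal _ (inv_pos.2 ha).le
  have hw0 : w ≠ 0 := by
    rw [hw, Ne, Real.toNNReal_eq_zero, not_le]; exact inv_pos.2 ha
  -- Multiplication by the integrating factor `exp(a z²/2)` makes the density constant.
  have hder : ∀ z, HasDerivAt (fun z => mixtureDensity G z * Real.exp (a * z ^ 2 / 2)) 0 z := by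
    intro z
    have h1 : HasDerivAt (fun z : ℝ => a * z ^ 2 / 2) (a * z) z := by
      have := ((hasDerivAt_pow 2 z).const_mul a).div_const 2
      exact this.congr_deriv (by push_cast; ring)
    refine ((hasDerivAt_mixtureDensity G z).mul h1.exp).congr_deriv ?_
    rw [h z]; ring
  have hconst : ∀ z, mixtureDensity G z
      = mixtureDensity G 0 * √(2 * Real.pi * w) * gaussianPDFReal 0 w z := by
    intro z
    have := is_const_of_deriv_eq_zero (fun z => (hder z).differentiableAt)
      (fun z => (hder z).deriv) z 0
    have hs : √(2 * Real.pi * w) ≠ 0 := by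
      rw [hwa]; positivity
    simp only [ne_eq, OfNat.ofNat_ne_zero, not_false_eq_true, zero_pow, mul_zero, zero_div,
      Real.exp_zero, mul_one] at this
    rw [gaussianPDFReal, ← this, ← mul_assoc, mul_assoc _ (√_) (√_)⁻¹, mul_inv_cancel₀ hs, mul_one,
      mul_assoc, ← Real.exp_add, hwa]
    have e : a * z ^ 2 / 2 + -(z - 0) ^ 2 / (2 * a⁻¹) = 0 := by
      field_simp
      ring
    rw [e, Real.exp_zero, mul_one]
  have hsmul : G ∗ γ = ENNReal.ofReal (mixtureDensity G 0 * √(2 * Real.pi * w))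
      • gaussianReal 0 w := by
    rw [conv_stdNormal_eq_withDensity, gaussianReal_of_var_ne_zero 0 hw0,
      ← withDensity_smul _ (measurable_gaussianPDF 0 w)]
    congr 1
    funext z
    have h0 : 0 ≤ mixtureDensity G 0 := integral_nonneg fun v => (stdPDF_pos _).le
    rw [Pi.smul_apply, smul_eq_mul, gaussianPDF, ← ENNReal.ofReal_mul (by positivity), hconst z]
  -- Both measures have total mass one, which fixes the constant of integration.
  have hone : ENNReal.ofReal (mixtureDensity G 0 * √(2 * Real.pi * w)) = 1 := by
    have := congrArg (fun ν : Measure ℝ => ν Set.univ) hsmul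
    simpa using this.symm
  rw [hone, one_smul] at hsmul
  refine Measure.ext_of_charFun (funext fun t => ?_)
  have hc := congrArg (fun ν => charFun ν t) hsmul
  simp only [charFun_conv, charFun_gaussianReal] at hc
  rw [charFun_gaussianReal, Real.coe_toNNReal _ (div_nonneg (by linarith) ha.le)]
  -- The characteristic function of the noise vanishes nowhere, so it can be cancelled.
  have hne := Complex.exp_ne_zero ((t : ℂ) * (0 : ℝ) * Complex.I - ((1 : ℝ≥0) : ℝ) * (t : ℂ) ^ 2 / 2)
  refine mul_right_cancel₀ hne (hc.trans ?_)
  rw [← Complex.exp_add, hwa]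
  congr 1
  have : (a : ℂ) ≠ 0 := by exact_mod_cast ha.ne'
  push_cast
  field_simp
  ring

end Mixture

lemma linearScore_eq (h : ℝ → ℝ) (β v : ℝ) :
    linearScore h β v = ∫ z, h z * (φ (z - v) * (β * z - v)) := by
  rw [linearScore, integral_gaussianReal_eq_integral_smul one_ne_zero,
    ← integral_add_left_eq_self (fun z => h z * (φ (z - v) * (β * z - v))) v]
  refine integral_congr_ae (ae_of_all _ fun e => ?_)
  simp only [smul_eq_mul, add_sub_cancel_left]
  ring

lemma abs_stdPDF_mul_linear_le (b z v : ℝ) :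
    |φ (z - v) * (b * z - v)| ≤ 1 + |1 - b| * |z| := by
  have e : φ (z - v) * (b * z - v) = (z - v) * φ (z - v) - (1 - b) * z * φ (z - v) := by ring
  rw [e]
  refine (abs_sub _ _).trans (add_le_add (abs_mul_stdPDF_le_one _) ?_)
  rw [abs_mul, abs_mul, abs_of_pos (stdPDF_pos _)]
  exact mul_le_of_le_one_right (by positivity) (stdPDF_le_one _)

lemma abs_integral_le_of_abs_le {Q : Measure ℝ} [IsProbabilityMeasure Q] {f : ℝ → ℝ} {C : ℝ}
    (h : ∀ x, |f x| ≤ C) : |∫ x, f x ∂Q| ≤ C := by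
  have := norm_integral_le_of_norm_le_const (μ := Q) (f := f) (C := C) (ae_of_all _ h)
  rwa [probReal_univ, mul_one] at this

/-- If `∫ ν dG(ν) φ(z - ν)(b z - ν)` is not identically zero, then the rule `z ↦ b z` can be
improved by a perturbation along which the risk is a bounded continuous function of the state. -/
lemma exists_linear_improvement (G : Measure ℝ) [IsProbabilityMeasure G] {a : ℝ} (ha : 0 < a)
    (ha1 : a < 1) (hG : G ≠ gaussianReal 0 (Real.toNNReal ((1 - a) / a))) :
    ∃ (k : ℝ → ℝ) (g : ℝ →ᵇ ℝ) (C : ℝ), Measurable k ∧ 0 ≤ C ∧ 0 < ∫ v, g v ∂G ∧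
      ∀ β v, 0 ≤ (1 - β) ^ 2 * v ^ 2 + β ^ 2 - g v + C * |β - (1 - a)| ∧
        normalRisk (fun z => β * z - k z) v
          ≤ ENNReal.ofReal ((1 - β) ^ 2 * v ^ 2 + β ^ 2 - g v + C * |β - (1 - a)|) := by
  set b := 1 - a with hb
  obtain ⟨z₀, hz₀⟩ : ∃ z, mixtureSlope G z - a * z * mixtureDensity G z ≠ 0 := by
    by_contra! hcon
    exact hG (eq_gaussianReal_of_mixtureSlope_eq G ha ha1 fun z => sub_eq_zero.1 (hcon z))
  set u : ℝ → ℝ := fun z => mixtureSlope G z - a * z * mixtureDensity G z with hu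
  have hucont : Continuous u := by
    have h1 := continuous_mixtureSlope G
    have h2 : Continuous (mixtureDensity G) :=
      continuous_iff_continuousAt.2 fun z => (hasDerivAt_mixtureDensity G z).continuousAt
    fun_prop
  have hφ := continuous_stdPDF
  have hu_eq : ∀ z, ∫ v, φ (z - v) * (b * z - v) ∂G = u z := by
    intro z
    rw [hu]
    simp only [mixtureSlope, mixtureDensity]
    rw [← integral_const_mul, ← integral_sub (integrable_mul_stdPDF_sub G z)
      ((integrable_stdPDF_sub G z).const_mul _)]
    refine integral_congr_ae (ae_of_all _ fun v => ?_)
    simp only [hb]; ring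
  set A := |z₀| + 1 with hA
  have hA0 : 0 < A := by positivity
  -- A tent whose value at `z₀` is one. It localizes the perturbation without changing its sign.
  set χ : ℝ → ℝ := fun z => max 0 (A - |z|) with hχ
  have hχ0 : ∀ z, 0 ≤ χ z := fun z => le_max_left _ _
  have hχc : Continuous χ := by fun_prop
  have hχout : ∀ z, A < |z| → χ z = 0 := fun z hz => max_eq_left (by linarith)
  have hχs : HasCompactSupport χ :=
    HasCompactSupport.intro (isCompact_Icc (a := -A) (b := A)) fun z hz => hχout z (by
      by_contra! hc
      exact hz (Set.mem_Icc.2 (abs_le.1 hc)))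
  -- Up to a factor, `u` is the gradient of the `G`-risk at the rule `z ↦ bz`; subtracting a
  -- multiple of `h` is a localized descent step.
  set h : ℝ → ℝ := fun z => u z * χ z with hh
  have hhc : Continuous h := hucont.mul hχc
  have hhs : HasCompactSupport h := hχs.mul_left
  obtain ⟨H, hH⟩ := hhs.exists_bound_of_continuous hhc
  simp only [Real.norm_eq_abs] at hH
  have hH0 : 0 ≤ H := (abs_nonneg _).trans (hH 0)
  have hzh : ∀ z, |z * h z| ≤ A * H := by
    intro z
    rcases lt_or_ge A |z| with hz | hz
    · have : h z = 0 := by simp [hh, hχout z hz]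
      rw [this]; simp; positivity
    · rw [abs_mul]; exact mul_le_mul hz (hH z) (abs_nonneg _) hA0.le
  set B : ℝ → ℝ := fun z => |h z| * (1 + a * |z|) with hB
  have hBint : Integrable B := by
    refine Continuous.integrable_of_hasCompactSupport (by fun_prop) ?_
    exact (hhs.comp_left (g := fun x => |x|) abs_zero).mul_right
  have hkern : ∀ z v, ‖h z * (φ (z - v) * (b * z - v))‖ ≤ B z := by
    intro z v
    rw [Real.norm_eq_abs, abs_mul]
    refine mul_le_mul_of_nonneg_left ((abs_stdPDF_mul_linear_le b z v).trans_eq ?_) (abs_nonneg _)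
    rw [hb, sub_sub_cancel, abs_of_pos ha]
  have hψc : Continuous (linearScore h b) := by
    have : linearScore h b = fun v => ∫ z, h z * (φ (z - v) * (b * z - v)) :=
      funext fun v => linearScore_eq h b v
    rw [this]
    exact continuous_of_dominated (fun v => Continuous.aestronglyMeasurable (by fun_prop))
      (fun v => ae_of_all _ fun z => hkern z v) hBint (ae_of_all _ fun z => by fun_prop)
  have hψb : ∀ v, |linearScore h b v| ≤ ∫ z, B z := by
    intro v
    rw [linearScore_eq]
    exact norm_integral_le_of_norm_le hBint (ae_of_all _ fun z => hkern z v)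
  -- By Fubini this integral equals `∫ χ u²`, which is positive because the integrand is continuous
  -- and nonzero at `z₀`.
  have hpos : 0 < ∫ v, linearScore h b v ∂G := by
    simp only [linearScore_eq]
    rw [integral_integral_swap]
    · simp only [integral_const_mul, hu_eq]
      refine Continuous.integral_pos_of_hasCompactSupport_nonneg_nonzero (x := z₀) (by fun_prop)
        hhs.mul_right (fun z => ?_) ?_
      · have : h z * u z = χ z * (u z) ^ 2 := by simp only [hh]; ring
        rw [this]; exact mul_nonneg (hχ0 z) (sq_nonneg _)
      · have : χ z₀ = 1 := by simp [hχ, hA]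
        simp only [hh, this, mul_one]
        exact mul_ne_zero hz₀ hz₀
    · refine Integrable.mono' (hBint.comp_snd G) (Continuous.aestronglyMeasurable ?_)
        (ae_of_all _ fun q => hkern q.2 q.1)
      simp only [Function.uncurry_def]
      fun_prop
  have hχ2c : Continuous fun v => ∫ e, h (v + e) ^ 2 ∂γ := by
    refine continuous_of_dominated (bound := fun _ => H ^ 2)
      (fun v => Continuous.aestronglyMeasurable (by fun_prop)) (fun v => ae_of_all _ fun e => ?_)
      (integrable_const _) (ae_of_all _ fun e => by fun_prop)
    rw [Real.norm_eq_abs, abs_pow]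
    exact pow_le_pow_left₀ (abs_nonneg _) (hH _) 2
  have hχ2b : ∀ v, |∫ e, h (v + e) ^ 2 ∂γ| ≤ H ^ 2 := by
    intro v
    refine abs_integral_le_of_abs_le fun e => ?_
    rw [abs_pow]
    exact pow_le_pow_left₀ (abs_nonneg _) (hH _) 2
  set p := ∫ v, linearScore h b v ∂G with hp
  -- This step makes the linear gain `2tp` dominate the quadratic cost, which is at most `t² H²`;
  -- what remains is at least `t²(H² + 2)`.
  set t : ℝ := p / (H ^ 2 + 1) with ht
  have ht0 : 0 < t := by positivity
  set S := ∫ z, B z with hS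
  let g : ℝ →ᵇ ℝ := BoundedContinuousFunction.ofNormedAddCommGroup
    (fun v => 2 * t * linearScore h b v - t ^ 2 * ∫ e, h (v + e) ^ 2 ∂γ) (by fun_prop)
    (2 * t * S + t ^ 2 * H ^ 2) (fun v => by
      refine (abs_sub _ _).trans (add_le_add ?_ ?_)
      · rw [abs_mul, abs_of_pos (by positivity : 0 < 2 * t)]
        exact mul_le_mul_of_nonneg_left (hψb v) (by positivity)
      · rw [abs_mul, abs_of_pos (by positivity : 0 < t ^ 2)]
        exact mul_le_mul_of_nonneg_left (hχ2b v) (by positivity))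
  have hgv : ∀ v, g v = 2 * t * linearScore h b v - t ^ 2 * ∫ e, h (v + e) ^ 2 ∂γ := fun v => rfl
  -- Changing `β` multiplies its increment by `z h(z)`, which compact support keeps bounded. The
  -- estimate is therefore uniform in the state.
  have hdiff : ∀ β v, |linearScore h β v - linearScore h b v| ≤ |β - b| * (A * H) := by
    intro β v
    have hint : ∀ β : ℝ, Integrable (fun e => h (v + e) * (β * (v + e) - v)) γ := by
      intro β
      refine Integrable.of_bound (Continuous.aestronglyMeasurable (by fun_prop))
        (|β| * (A * H) + H * |v|) (ae_of_all _ fun e => ?_)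
      have e1 : h (v + e) * (β * (v + e) - v) = β * ((v + e) * h (v + e)) - h (v + e) * v := by
        ring
      rw [Real.norm_eq_abs, e1]
      refine (abs_sub _ _).trans (add_le_add ?_ ?_)
      · rw [abs_mul]; exact mul_le_mul_of_nonneg_left (hzh _) (abs_nonneg _)
      · rw [abs_mul]; exact mul_le_mul_of_nonneg_right (hH _) (abs_nonneg _)
    rw [linearScore, linearScore, ← integral_sub (hint β) (hint b)]
    refine abs_integral_le_of_abs_le fun e => ?_
    have e1 : h (v + e) * (β * (v + e) - v) - h (v + e) * (b * (v + e) - v)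
        = (β - b) * ((v + e) * h (v + e)) := by ring
    rw [e1, abs_mul]
    exact mul_le_mul_of_nonneg_left (hzh _) (abs_nonneg _)
  refine ⟨fun z => t * h z, g, 2 * t * (A * H), by fun_prop, by positivity, ?_, fun β v => ?_⟩
  · simp only [hgv]
    have hi2 : Integrable (fun v => ∫ e, h (v + e) ^ 2 ∂γ) G :=
      Integrable.of_bound hχ2c.aestronglyMeasurable (H ^ 2) (ae_of_all _ hχ2b)
    rw [integral_sub ((Integrable.of_bound hψc.aestronglyMeasurable S
      (ae_of_all _ hψb)).const_mul _) (hi2.const_mul _), integral_const_mul, integral_const_mul,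
      ← hp]
    have hle : ∫ v, ∫ e, h (v + e) ^ 2 ∂γ ∂G ≤ H ^ 2 :=
      (le_abs_self _).trans (abs_integral_le_of_abs_le hχ2b)
    have hpt : p = t * (H ^ 2 + 1) := by rw [ht]; field_simp
    have : t ^ 2 * ∫ v, ∫ e, h (v + e) ^ 2 ∂γ ∂G ≤ t ^ 2 * H ^ 2 :=
      mul_le_mul_of_nonneg_left hle (by positivity)
    have h3 : 0 < t ^ 2 * (H ^ 2 + 2) := by positivity
    rw [hpt]
    nlinarith
  · obtain ⟨h0, he⟩ := normalRisk_linear_sub hhc.measurable hH β t v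
    have hle : (1 - β) ^ 2 * v ^ 2 + β ^ 2
        - (2 * t * linearScore h β v - t ^ 2 * ∫ e, h (v + e) ^ 2 ∂γ)
        ≤ (1 - β) ^ 2 * v ^ 2 + β ^ 2 - g v + 2 * t * (A * H) * |β - b| := by
      rw [hgv]
      have := mul_le_mul_of_nonneg_left ((abs_le.1 (hdiff β v)).1) (by positivity : 0 ≤ 2 * t)
      nlinarith
    exact ⟨h0.trans hle, he.trans_le (ENNReal.ofReal_le_ofReal hle)⟩

end SeqEB

namespace SeqEB

/-! ### Asymptotics -/

/-- The witness is the truncated difference of the two risks, eventually finite by the case `r = 1`;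
the risks themselves may be infinite. -/
lemma leUpToLittleO_of_forall_eventually_le {A B : ℕ → ℝ≥0∞}
    (hle : ∀ r : ℝ, 0 < r → ∀ᶠ n in atTop, A n ≤ B n + ENNReal.ofReal (r * n)) :
    LeUpToLittleO A B := by
  have hsub : ∀ r : ℝ, 0 < r → ∀ᶠ n in atTop, A n - B n ≤ ENNReal.ofReal (r * n) := fun r hr =>
    (hle r hr).mono fun n hn => tsub_le_iff_left.2 hn
  refine ⟨fun n => (A n - B n).toReal, Asymptotics.isLittleO_iff.2 fun c hc => ?_, ?_⟩
  · filter_upwards [hsub c hc] with n hn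
    rw [Real.norm_of_nonneg ENNReal.toReal_nonneg, Real.norm_of_nonneg (Nat.cast_nonneg n)]
    exact ENNReal.toReal_le_of_le_ofReal (by positivity) hn
  · filter_upwards [hsub 1 one_pos] with n hn
    rw [ENNReal.ofReal_toReal (ne_top_of_le_ne_top ENNReal.ofReal_ne_top hn)]
    exact le_add_tsub

/-- If `E ≤ O + o(n)`, `O ≤ n` and `O` is smaller than `B` by a multiple of `n`, then the ratio of
`E` to `B` is bounded away from one. -/
lemma exists_ratio_lt_one {E O B : ℕ → ℝ≥0∞} {q : ℝ} (hq : 0 < q)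
    (hEO : ∀ r : ℝ, 0 < r → ∀ᶠ n in atTop, E n ≤ O n + ENNReal.ofReal (r * n))
    (hO : ∀ n : ℕ, O n ≤ ENNReal.ofReal n)
    (hgain : ∀ r : ℝ, 0 < r → ∀ᶠ n in atTop,
      O n + ENNReal.ofReal (q * n) ≤ ENNReal.ofReal (1 + r) * B n + ENNReal.ofReal (r * n)) :
    ∃ c : ℝ, 0 < c ∧ c < 1 ∧ ∀ᶠ n in atTop, E n ≤ ENNReal.ofReal c * B n := by
  -- If `B ≥ 4n`, then `E ≤ 2n ≤ B/2`. If `B < 4n`, then `E ≤ B + qB/12 - 10qn/12`, and `n > B/4`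
  -- turns this into `(1 - q/8)B`.
  refine ⟨max (1 / 2) (1 - q / 8), lt_max_of_lt_left (by norm_num),
    max_lt (by norm_num) (by linarith), ?_⟩
  filter_upwards [hEO 1 one_pos, hEO (q / 12) (by positivity), hgain (q / 12) (by positivity)]
    with n h1 h2 h3
  have hn : (0 : ℝ) ≤ n := Nat.cast_nonneg n
  rcases le_or_gt (ENNReal.ofReal (4 * n)) (B n) with hB | hB
  · calc E n ≤ ENNReal.ofReal n + ENNReal.ofReal (1 * n) :=
          h1.trans (add_le_add_left (hO n) _)
      _ = ENNReal.ofReal (1 / 2) * ENNReal.ofReal (4 * n) := by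
          rw [← ENNReal.ofReal_add hn (by positivity), ← ENNReal.ofReal_mul (by norm_num)]
          congr 1; ring
      _ ≤ _ := mul_le_mul' (ENNReal.ofReal_le_ofReal (le_max_left _ _)) hB
  · have hBt : B n ≠ ∞ := ne_top_of_lt hB
    have hOt : O n ≠ ∞ := ne_top_of_le_ne_top ENNReal.ofReal_ne_top (hO n)
    obtain ⟨b, hb0, hb⟩ : ∃ b : ℝ, 0 ≤ b ∧ B n = ENNReal.ofReal b :=
      ⟨_, ENNReal.toReal_nonneg, (ENNReal.ofReal_toReal hBt).symm⟩
    obtain ⟨o, ho0, ho⟩ : ∃ o : ℝ, 0 ≤ o ∧ O n = ENNReal.ofReal o :=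
      ⟨_, ENNReal.toReal_nonneg, (ENNReal.ofReal_toReal hOt).symm⟩
    rw [hb] at hB h3 ⊢
    rw [ho] at h2 h3
    have hb4 : b < 4 * n := (ENNReal.ofReal_lt_ofReal_iff_of_nonneg hb0).1 hB
    rw [← ENNReal.ofReal_mul (by positivity), ← ENNReal.ofReal_add (by positivity) (by positivity),
      ← ENNReal.ofReal_add (by positivity) (by positivity),
      ENNReal.ofReal_le_ofReal_iff (by positivity)] at h3
    rw [← ENNReal.ofReal_add (by positivity) (by positivity)] at h2
    rw [← ENNReal.ofReal_mul (le_max_of_le_left (by norm_num))]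
    refine h2.trans (ENNReal.ofReal_le_ofReal ?_)
    refine le_trans ?_ (mul_le_mul_of_nonneg_right (le_max_right _ _) hb0)
    nlinarith

/-! ### Transfer between the sample space and the law of states and noise. -/

section Law

variable {Ω : Type*} [MeasurableSpace Ω] (P : Measure Ω) {n : ℕ}

/-- The law of the states and the noise. -/
noncomputable def jointLaw (μ ε : Fin n → Ω → ℝ) : Measure (Pair n) :=
  P.map fun ω => (fun i => μ i ω, fun i => ε i ω)

variable {P} {μ ε : Fin n → Ω → ℝ} {m : Fin n → (Fin n → ℝ) → ℝ}

lemma NoiseModel.risk_eq_lintegral (hM : NoiseModel P μ ε) {D : Fin n → Pair n → ℝ}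
    (hD : ∀ i, Measurable (D i)) :
    risk P μ (fun i ω => D i (fun i => μ i ω, fun i => ε i ω))
      = ∫⁻ p, ENNReal.ofReal (∑ i, (D i p - p.1 i) ^ 2) ∂jointLaw P μ ε := by
  rw [jointLaw, lintegral_map (by fun_prop) hM.measurable_pair]
  rfl

lemma NoiseModel.risk_oracleIS (hM : NoiseModel P μ ε) (hm : ∀ i, Measurable (m i)) :
    risk P μ (oracleIS μ ε m)
      = ∫⁻ p, ENNReal.ofReal (∑ i, (pairOracle m i p - p.1 i) ^ 2) ∂jointLaw P μ ε :=
  hM.risk_eq_lintegral (measurable_pairOracle hm)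

lemma NoiseModel.risk_filter (hM : NoiseModel P μ ε) {h : Fin n → (Fin n → ℝ) → ℝ}
    (hh : ∀ i, Measurable (h i)) :
    risk P μ (fun i ω => h i (obs μ ε ω))
      = ∫⁻ p, ENNReal.ofReal (∑ i, (h i (pairObs p) - p.1 i) ^ 2) ∂jointLaw P μ ε :=
  hM.risk_eq_lintegral (D := fun i p => h i (pairObs p)) fun i => (hh i).comp measurable_pairObs

lemma NoiseModel.sum_tail_eq (hM : NoiseModel P μ ε) (hm : ∀ i, Measurable (m i)) (L : ℝ) :
    ∑ i, (jointLaw P μ ε).real {p | L < |pairCentred m p i + p.2 i|}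
      = ∑ i, P.real {ω | L < |resid m (obs μ ε ω) i|} := by
  refine Finset.sum_congr rfl fun i _ => ?_
  rw [jointLaw, map_measureReal_apply hM.measurable_pair]
  · congr 1
    ext ω
    simp only [Set.mem_preimage, Set.mem_ofPred_eq]
    rw [← resid_pairObs]
    rfl
  · exact measurableSet_lt measurable_const
      ((measurable_pairCentred_apply hm i).add (by fun_prop)).abs

variable [IsProbabilityMeasure P]

lemma NoiseModel.isProbabilityMeasure_jointLaw (hM : NoiseModel P μ ε) :
    IsProbabilityMeasure (jointLaw P μ ε) :=
  Measure.isProbabilityMeasure_map hM.measurable_pair.aemeasurable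

/-- The oracle is at least as good as estimating every state by its observation. -/
lemma NoiseModel.risk_oracleIS_le (hM : NoiseModel P μ ε) (hm : ∀ i, Measurable (m i))
    (hdep : ∀ i, DependsOn (m i) (Set.Iio i)) :
    risk P μ (oracleIS μ ε m) ≤ ENNReal.ofReal n := by
  have := hM.isProbabilityMeasure_jointLaw
  rw [hM.risk_oracleIS hm]
  refine (hM.stdNormalNoise.lintegral_pairOracle_le hm hdep).trans ?_
  calc ∫⁻ p, ∑ i, normalRisk (oracleDecision Finset.univ (pairCentred m p)) (pairCentred m p i)
        ∂jointLaw P μ ε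
      ≤ ∫⁻ _, ENNReal.ofReal n ∂jointLaw P μ ε := by
        refine lintegral_mono fun p => (oracleDecision_isMin _ _ id measurable_id).trans_eq ?_
        simp [normalRisk, lintegral_sq_stdNormal]
    _ = ENNReal.ofReal n := by simp

end Law

end SeqEB

namespace SeqEB

/-! ### The two comparisons along the triangular array. -/

section Arrays

variable {Ω : Type*} [MeasurableSpace Ω] {P : Measure Ω}
  {μ ε : ∀ n : ℕ, Fin n → Ω → ℝ} {m h : ∀ n : ℕ, Fin n → (Fin n → ℝ) → ℝ}

lemma tendsto_log_natCast : Tendsto (fun n : ℕ => Real.log n) atTop atTop :=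
  Real.tendsto_log_atTop.comp tendsto_natCast_atTop_atTop

lemma TightResiduals.eventually_sum_tail_le (h3 : TightResiduals P μ ε m)
    (hM : ∀ n, NoiseModel P (μ n) (ε n)) (hm : ∀ n i, Measurable (m n i)) :
    ∀ᶠ n : ℕ in atTop, ∑ i, (jointLaw P (μ n) (ε n)).real
      {p | Real.log n < |pairCentred (m n) p i + p.2 i|} ≤ n * (Real.log n ^ 8)⁻¹ := by
  filter_upwards [h3, eventually_gt_atTop 0] with n hn hn0
  rw [(hM n).sum_tail_eq (hm n)]
  have hn' : (0 : ℝ) < n := Nat.cast_pos.2 hn0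
  rwa [one_div, one_div, inv_mul_le_iff₀ hn'] at hn

variable [IsProbabilityMeasure P]

/-- The empirical Bayes estimator is asymptotically as good as the oracle. -/
lemma eventually_risk_estimIS_le (hM : ∀ n, NoiseModel P (μ n) (ε n)) (hm : ∀ n i, Measurable (m n i))
    (hdep : ∀ n i, DependsOn (m n i) (Set.Iio i))
    (h3 : TightResiduals P μ ε m) {r : ℝ} (hr : 0 < r) :
    ∀ᶠ n : ℕ in atTop, risk P (μ n) (fun i ω => estimIS (m n) i (obs (μ n) (ε n) ω))
      ≤ risk P (μ n) (oracleIS (μ n) (ε n) (m n)) + ENNReal.ofReal (r * n) := by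
  obtain ⟨K, hK1, hK⟩ := exists_estimIS_excess
  have hx : Tendsto (fun n : ℕ => √(√(Real.log n))) atTop atTop :=
    Real.tendsto_sqrt_atTop.comp (Real.tendsto_sqrt_atTop.comp tendsto_log_natCast)
  have hlog : ∀ᶠ n : ℕ in atTop, 20 * Real.log n ^ 22 ≤ r / 2 * n := by
    have := (Real.isLittleO_pow_log_id_atTop (n := 22)).comp_tendsto
      (tendsto_natCast_atTop_atTop (R := ℝ))
    filter_upwards [this.def (show 0 < r / 40 by positivity),
      tendsto_log_natCast.eventually_ge_atTop 0] with n hn hl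
    simp only [Function.comp, id, Real.norm_eq_abs, abs_of_nonneg (pow_nonneg hl 22),
      Nat.abs_cast] at hn
    linarith
  filter_upwards [h3.eventually_sum_tail_le hM hm, hx.eventually_ge_atTop K,
    hx.eventually_ge_atTop (2 * K / r), hlog, tendsto_log_natCast.eventually_ge_atTop 0]
    with n ht hxK hxr hl hl0
  -- In this scale the bandwidth is `x⁻⁴`, the residual cutoff `log n` is `x⁴`, the tail bound `(log
  -- n)⁻⁸` is `x⁻³²`, and `x⁸⁸` is `(log n)²²`.
  set x := √(√(Real.log n)) with hxdef
  have hx4 : x ^ 4 = Real.log n := by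
    rw [hxdef, show (4 : ℕ) = 2 * 2 from rfl, pow_mul, Real.sq_sqrt (Real.sqrt_nonneg _),
      Real.sq_sqrt hl0]
  have hx0 : 0 < x := by linarith
  have := (hM n).isProbabilityMeasure_jointLaw
  obtain ⟨Err, hE, hle, hint⟩ := hK (m n) (jointLaw P (μ n) (ε n)) (hM n).stdNormalNoise (hm n)
    (hdep n) x hxK hx4 (by rw [hx4, show (32 : ℕ) = 4 * 8 from rfl, pow_mul, hx4]; exact ht)
  have hX := (hM n).measurable_pair
  calc risk P (μ n) (fun i ω => estimIS (m n) i (obs (μ n) (ε n) ω))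
      ≤ ∫⁻ ω, (ENNReal.ofReal (∑ i, (oracleIS (μ n) (ε n) (m n) i ω - μ n i ω) ^ 2)
          + Err (fun i => μ n i ω, fun i => ε n i ω)) ∂P :=
        lintegral_mono fun ω => hle (fun i => μ n i ω, fun i => ε n i ω)
    _ = risk P (μ n) (oracleIS (μ n) (ε n) (m n)) + ∫⁻ p, Err p ∂jointLaw P (μ n) (ε n) := by
        have hEX : Measurable fun ω => Err (fun i => μ n i ω, fun i => ε n i ω) := hE.comp hX
        rw [lintegral_add_right _ hEX, jointLaw, lintegral_map hE hX]
        rfl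
    _ ≤ _ := by
        refine add_le_add_right (hint.trans (ENNReal.ofReal_le_ofReal ?_)) _
        have h1 : K * n * x⁻¹ ≤ r / 2 * n := by
          rw [← div_eq_mul_inv, div_le_iff₀ hx0]
          rw [div_le_iff₀ hr] at hxr
          nlinarith [(Nat.cast_nonneg n : (0 : ℝ) ≤ n)]
        have h2 : 20 * x ^ 88 ≤ r / 2 * n := by
          rw [show (88 : ℕ) = 4 * 22 from rfl, pow_mul, hx4]; exact hl
        linarith

/-- The oracle is asymptotically at least as good as the benchmark, and better by the gain of any
perturbation of the linear rules. -/
lemma eventually_oracle_add_gain_le (hM : ∀ n, NoiseModel P (μ n) (ε n)) (hm : ∀ n i, Measurable (m n i))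
    (hdep : ∀ n i, DependsOn (m n i) (Set.Iio i))
    (hh : ∀ n i, Measurable (h n i))
    {α : ∀ n, (Fin n → ℝ) → ℝ} (hα : AsympWeightedAverage P μ ε m h α)
    (h3 : TightResiduals P μ ε m) {c : ℝ} (hc : 0 ≤ c) (g : ∀ n, Pair n → ℝ)
    (hg : ∀ n p s, ∃ δ, Measurable δ ∧
      ∑ j ∈ s, normalRisk δ (pairCentred (m n) p j) + ENNReal.ofReal (g n p)
        ≤ ENNReal.ofReal (∑ j ∈ s, ((1 - min (1 - α n (pairObs p)) 1) ^ 2 * pairCentred (m n) p j ^ 2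
          + (min (1 - α n (pairObs p)) 1) ^ 2) + c * sᶜ.card)) {r : ℝ} (hr : 0 < r) :
    ∀ᶠ n : ℕ in atTop, risk P (μ n) (oracleIS (μ n) (ε n) (m n))
        + ∫⁻ p, ENNReal.ofReal (g n p) ∂jointLaw P (μ n) (ε n)
      ≤ ENNReal.ofReal (1 + r) * risk P (μ n) (fun i ω => h n i (obs (μ n) (ε n) ω))
        + ENNReal.ofReal (r * n) := by
  set F := stdNormalFourth with hF
  have hF0 : 0 ≤ F := stdNormalFourth_nonneg
  -- Six error terms, from the remainder, the two martingales, the clipping, the end times and the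
  -- large states, are each at most `qn`. The lower-order leftovers add `qn/2` twice, so the total
  -- stays below `8qn = rn`.
  set q := r / 8 with hq
  have hq0 : 0 < q := by positivity
  set T : ℝ := √(F / q) + 1 with hT
  have hT0 : 0 < T := by positivity
  have hTq : F / T ^ 2 ≤ q := by
    rw [div_le_iff₀ (by positivity), mul_comm, ← div_le_iff₀ hq0]
    have h1 := Real.sq_sqrt (show 0 ≤ F / q by positivity)
    have h2 := Real.sqrt_nonneg (F / q)
    rw [hT]; nlinarith
  set D : ℝ := 2 * (T ^ 2 + 1) + c with hD
  have hD0 : 0 < D := by positivity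
  set κ : ℝ := q / (2 * D) with hκ
  have hκ0 : 0 < κ := by positivity
  set ζ : ℝ := q / (1 + q⁻¹) with hζ
  have hζ0 : 0 < ζ := by positivity
  have ht1 : ∀ᶠ n : ℕ in atTop, 4 * Real.log n ^ 2 / q ≤ q * n / 2 := by
    have := (Real.isLittleO_pow_log_id_atTop (n := 2)).comp_tendsto
      (tendsto_natCast_atTop_atTop (R := ℝ))
    filter_upwards [this.def (show 0 < q ^ 2 / 8 by positivity)] with n hn
    simp only [Function.comp, id, Real.norm_eq_abs, abs_pow, sq_abs, Nat.abs_cast] at hn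
    rw [div_le_iff₀ hq0]
    nlinarith
  have ht2 : ∀ᶠ n : ℕ in atTop, (F + 1) / q + D ≤ q * n / 2 := by
    filter_upwards [tendsto_natCast_atTop_atTop.eventually_ge_atTop (((F + 1) / q + D) * 2 / q)]
      with n hn
    rw [div_le_iff₀ hq0] at hn
    linarith
  have ht3 : ∀ᶠ n : ℕ in atTop, D * ((Real.log n ^ 8)⁻¹ + (Real.log n ^ 2)⁻¹) ≤ q := by
    have h1 : Tendsto (fun n : ℕ => D * ((Real.log n ^ 8)⁻¹ + (Real.log n ^ 2)⁻¹)) atTop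
        (𝓝 (D * (0 + 0))) :=
      (((tendsto_pow_atTop (by norm_num)).comp tendsto_log_natCast).inv_tendsto_atTop.add
        ((tendsto_pow_atTop (by norm_num)).comp tendsto_log_natCast).inv_tendsto_atTop).const_mul D
    exact h1.eventually_le_const (by simpa using hq0)
  filter_upwards [h3.eventually_sum_tail_le hM hm, ht1, ht2, ht3, eventually_gt_atTop 0,
    tendsto_log_natCast.eventually_gt_atTop 0,
    hα.remainder κ hκ0 (ENNReal.ofReal ζ) (ENNReal.ofReal_pos.2 hζ0)]
    with n ht h1 h2 h4 hn0 hl0 hrem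
  have := (hM n).isProbabilityMeasure_jointLaw
  have hmid : ∀ i ∈ midTimes n κ, ∫⁻ p, ENNReal.ofReal (remainderTerm (m n) (h n) (α n) i p ^ 2)
      ∂jointLaw P (μ n) (ε n) ≤ ENNReal.ofReal ζ := by
    intro i hi
    have hi' := (Finset.mem_filter.1 hi).2
    refine le_trans (le_of_eq ?_) (hrem i hi'.1 hi'.2)
    have hmeas : Measurable fun p : Pair n =>
        ENNReal.ofReal (remainderTerm (m n) (h n) (α n) i p ^ 2) := by
      have e1 := (hh n i).comp (measurable_pairObs (n := n))
      have e2 := (hm n i).comp (measurable_pairObs (n := n))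
      have e3 := (hα.measurable n).comp (measurable_pairObs (n := n))
      have e4 : Measurable fun p : Pair n => pairObs p i :=
        (measurable_pi_apply i).comp measurable_pairObs
      exact ((e1.sub ((e3.mul e2).add ((measurable_const.sub e3).mul e4))).pow_const
        2).ennreal_ofReal
    rw [jointLaw, lintegral_map hmeas (hM n).measurable_pair]
    rfl
  have hQ : StdNormalNoise (jointLaw P (μ n) (ε n)) := (hM n).stdNormalNoise
  have key := hQ.lintegral_oracle_add_gain_le (hm n) (hdep n) (hh n)
    (hα.measurable n) (hα.lt_one n) hn0 hκ0.le hl0 hT0 hq0 hc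
    (inv_nonneg.2 (pow_nonneg hl0.le 8)) hζ0.le (g n) (hg n) ht hmid
  rw [(hM n).risk_oracleIS (hm n), (hM n).risk_filter (hh n)]
  refine key.trans (add_le_add (mul_le_mul_left (ENNReal.ofReal_le_ofReal ?_) _)
    (ENNReal.ofReal_le_ofReal ?_))
  · rw [hq]; linarith
  · have hn : (0 : ℝ) < n := Nat.cast_pos.2 hn0
    have e1 : (1 + q⁻¹) * (n * ζ) = q * n := by
      rw [hζ]; field_simp
    have e2 : D * (2 * κ * n + 1) = q * n + D := by
      rw [hκ]; field_simp
    have e3 : n * (F / T ^ 2) ≤ q * n := by nlinarith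
    have e4 : D * (n * ((Real.log n ^ 8)⁻¹ + (Real.log n ^ 2)⁻¹)) ≤ q * n := by nlinarith
    have e5 : r = 8 * q := by rw [hq]; ring
    have e6 : 0 < q * n := by positivity
    rw [e1, ← hF, ← hD, e2, e5]
    linarith

/-- The oracle is asymptotically at least as good as the benchmark. -/
lemma eventually_risk_oracleIS_le (hM : ∀ n, NoiseModel P (μ n) (ε n)) (hm : ∀ n i, Measurable (m n i))
    (hdep : ∀ n i, DependsOn (m n i) (Set.Iio i))
    (hh : ∀ n i, Measurable (h n i))
    {α : ∀ n, (Fin n → ℝ) → ℝ} (hα : AsympWeightedAverage P μ ε m h α)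
    (h3 : TightResiduals P μ ε m) {r : ℝ} (hr : 0 < r) :
    ∀ᶠ n : ℕ in atTop, risk P (μ n) (oracleIS (μ n) (ε n) (m n))
      ≤ risk P (μ n) (fun i ω => h n i (obs (μ n) (ε n) ω)) + ENNReal.ofReal (r * n) := by
  -- With zero gain the competitor is the linear rule itself and nothing needs to be allowed for
  -- discarded times.
  have key := eventually_oracle_add_gain_le hM hm hdep hh hα h3 le_rfl (fun _ _ => 0)
    (fun n p s => ⟨fun z => min (1 - α n (pairObs p)) 1 * z, by fun_prop, by
      simp only [normalRisk_linear]
      rw [← ENNReal.ofReal_sum_of_nonneg fun j _ => by positivity]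
      simp⟩) (half_pos hr)
  filter_upwards [key] with n hn
  set B := risk P (μ n) (fun i ω => h n i (obs (μ n) (ε n) ω)) with hB
  -- The factor `1 + r/2` is an `o(n)` matter only when the benchmark risk is at most `n`. In the
  -- other case the oracle risk, at most `n`, is already smaller.
  rcases le_total (ENNReal.ofReal n) B with h1 | h1
  · exact ((hM n).risk_oracleIS_le (hm n) (hdep n)).trans (h1.trans le_self_add)
  · refine (le_self_add.trans hn).trans ?_
    rw [ENNReal.ofReal_add one_pos.le (half_pos hr).le, ENNReal.ofReal_one, add_mul, one_mul,
      add_assoc]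
    refine add_le_add_right ?_ _
    calc ENNReal.ofReal (r / 2) * B + ENNReal.ofReal (r / 2 * n)
        ≤ ENNReal.ofReal (r / 2) * ENNReal.ofReal n + ENNReal.ofReal (r / 2 * n) := by gcongr
      _ = ENNReal.ofReal (r * n) := by
        rw [← ENNReal.ofReal_mul (half_pos hr).le, ← ENNReal.ofReal_add (by positivity)
          (by positivity)]
        congr 1; ring

end Arrays

/-- Of the total gain `3qn/4`, the drift of `β` away from `1 - a` consumes at most `qn/4`, which
leaves `qn/2`. The part of the gain located outside `s` is charged to `‖g‖` per missing point. -/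
lemma sum_normalRisk_perturbed_add_le {n : ℕ} {k : ℝ → ℝ} {g : ℝ →ᵇ ℝ} {C a β q : ℝ}
    (hk : ∀ v, 0 ≤ (1 - β) ^ 2 * v ^ 2 + β ^ 2 - g v + C * |β - (1 - a)| ∧
      normalRisk (fun z => β * z - k z) v
        ≤ ENNReal.ofReal ((1 - β) ^ 2 * v ^ 2 + β ^ 2 - g v + C * |β - (1 - a)|))
    (hq : 0 < q) (hβ : C * |β - (1 - a)| ≤ q / 4) (ν : Fin n → ℝ)
    (hsum : 3 / 4 * q * n ≤ ∑ i, g (ν i)) (s : Finset (Fin n)) :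
    ∑ j ∈ s, normalRisk (fun z => β * z - k z) (ν j) + ENNReal.ofReal (q / 2 * n)
      ≤ ENNReal.ofReal (∑ j ∈ s, ((1 - β) ^ 2 * ν j ^ 2 + β ^ 2) + ‖g‖ * sᶜ.card) := by
  have hn : (0 : ℝ) ≤ n := Nat.cast_nonneg n
  have h0 : 0 ≤ ∑ j ∈ s, ((1 - β) ^ 2 * ν j ^ 2 + β ^ 2 - g (ν j) + C * |β - (1 - a)|) :=
    Finset.sum_nonneg fun j _ => (hk _).1
  refine (add_le_add_left (Finset.sum_le_sum fun j _ => (hk (ν j)).2) _).trans ?_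
  rw [← ENNReal.ofReal_sum_of_nonneg fun j _ => (hk _).1, ← ENNReal.ofReal_add h0 (by positivity)]
  refine ENNReal.ofReal_le_ofReal ?_
  have h1 : ∑ j ∈ sᶜ, g (ν j) ≤ ‖g‖ * sᶜ.card := by
    refine (Finset.sum_le_card_nsmul _ _ ‖g‖ fun j _ => ?_).trans_eq (by
      rw [nsmul_eq_mul, mul_comm])
    exact (le_abs_self _).trans (g.norm_coe_le_norm _)
  have h2 := Finset.sum_add_sum_compl s fun j => g (ν j)
  have h3 : (s.card : ℝ) * (C * |β - (1 - a)|) ≤ n * (q / 4) := by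
    have h4 : (s.card : ℝ) ≤ n := by
      exact_mod_cast (Finset.card_le_univ s).trans (by simp)
    calc (s.card : ℝ) * (C * |β - (1 - a)|) ≤ s.card * (q / 4) := by gcongr
      _ ≤ n * (q / 4) := by gcongr
  rw [Finset.sum_add_distrib, Finset.sum_sub_distrib, Finset.sum_const, nsmul_eq_mul]
  linarith

lemma integral_empirical {n : ℕ} (v : Fin n → ℝ) (g : ℝ →ᵇ ℝ) :
    ∫ x, g x ∂empirical v = (n : ℝ)⁻¹ * ∑ i, g (v i) := by
  rw [empirical, integral_smul_measure, integral_finsetSum_measure fun i _ =>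
    integrable_dirac (by simp)]
  simp [ENNReal.toReal_inv]

/-! ### A linear gain when the limiting prior is not the normal one. -/

section Normality

variable {Ω : Type*} [MeasurableSpace Ω] {P : Measure Ω} [IsProbabilityMeasure P]
  {μ ε : ∀ n : ℕ, Fin n → Ω → ℝ} {m h : ∀ n : ℕ, Fin n → (Fin n → ℝ) → ℝ}

/-- Unless the limiting empirical distribution is the normal distribution for which the benchmark
is the Bayes rule, the oracle is asymptotically better than the benchmark by a multiple of `n`. -/
lemma exists_oracle_gain (hM : ∀ n, NoiseModel P (μ n) (ε n)) (hm : ∀ n i, Measurable (m n i))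
    (hdep : ∀ n i, DependsOn (m n i) (Set.Iio i)) (hh : ∀ n i, Measurable (h n i))
    {α : ∀ n, (Fin n → ℝ) → ℝ} (hα : AsympWeightedAverage P μ ε m h α)
    (h3 : TightResiduals P μ ε m) {a : ℝ} (ha : 0 < a) (ha1 : a < 1)
    (hαa : TendstoInMeasure P (fun n ω => α n (obs (μ n) (ε n) ω)) atTop (fun _ => a))
    {G : Measure ℝ} [IsProbabilityMeasure G]
    (hG : EmpiricalTendsto P (fun n => centred (μ n) (ε n) (m n)) G)
    (hGne : G ≠ gaussianReal 0 (Real.toNNReal ((1 - a) / a))) :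
    ∃ q : ℝ, 0 < q ∧ ∀ r : ℝ, 0 < r → ∀ᶠ n : ℕ in atTop,
      risk P (μ n) (oracleIS (μ n) (ε n) (m n)) + ENNReal.ofReal (q * n)
        ≤ ENNReal.ofReal (1 + r) * risk P (μ n) (fun i ω => h n i (obs (μ n) (ε n) ω))
          + ENNReal.ofReal (r * n) := by
  obtain ⟨k, g, C, hkm, hC, hΓ, hk⟩ := exists_linear_improvement G ha ha1 hGne
  set Γ := ∫ v, g v ∂G with hΓdef
  set η := Γ / (4 * (C + 1)) with hη
  have hη0 : 0 < η := by positivity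
  have hCη : C * η ≤ Γ / 4 := by
    rw [hη, ← mul_div_assoc, div_le_div_iff₀ (by positivity) (by norm_num)]
    nlinarith
  -- On this event both the weight and the empirical average of `g` are close to their limits, so
  -- the perturbed rule gains. Off it the linear rule with zero gain is used.
  let E : ∀ n, Set (Pair n) := fun n =>
    {p | |α n (pairObs p) - a| ≤ η ∧ 3 / 4 * Γ * n ≤ ∑ i, g (pairCentred (m n) p i)}
  have hE : ∀ n, MeasurableSet (E n) := fun n => by
    have e1 : Measurable fun p : Pair n => α n (pairObs p) :=
      (hα.measurable n).comp measurable_pairObs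
    have e2 : Measurable fun p : Pair n => ∑ i, g (pairCentred (m n) p i) :=
      Finset.measurable_fun_sum _ fun i _ =>
        g.continuous.measurable.comp (measurable_pairCentred_apply (hm n) i)
    exact (measurableSet_le (e1.sub_const a).abs measurable_const).inter
      (measurableSet_le measurable_const e2)
  let gain : ∀ n, Pair n → ℝ := fun n => (E n).indicator fun _ => Γ / 2 * n
  -- Capping at one never increases the distance to `1 - a`, which lies below the cap.
  have hsmall : ∀ p : ℝ, |min (1 - p) 1 - (1 - a)| ≤ |p - a| := fun p => by
    rcases le_total (1 - p) 1 with h1 | h1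
    · rw [min_eq_left h1, abs_sub_comm p a]; apply le_of_eq; congr 1; ring
    · rw [min_eq_right h1, abs_of_nonneg (by linarith), abs_of_nonpos (by linarith)]; linarith
  have hgain : ∀ n p s, ∃ δ, Measurable δ ∧
      ∑ j ∈ s, normalRisk δ (pairCentred (m n) p j) + ENNReal.ofReal (gain n p)
        ≤ ENNReal.ofReal (∑ j ∈ s, ((1 - min (1 - α n (pairObs p)) 1) ^ 2 * pairCentred (m n) p j ^ 2
          + (min (1 - α n (pairObs p)) 1) ^ 2) + ‖g‖ * sᶜ.card) := by
    intro n p s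
    by_cases hp : p ∈ E n
    · refine ⟨fun z => min (1 - α n (pairObs p)) 1 * z - k z, by fun_prop, ?_⟩
      simp only [gain, Set.indicator_of_mem hp]
      refine sum_normalRisk_perturbed_add_le (hk _) hΓ ?_ _ hp.2 s
      exact (mul_le_mul_of_nonneg_left ((hsmall _).trans hp.1) hC).trans hCη
    · refine ⟨fun z => min (1 - α n (pairObs p)) 1 * z, by fun_prop, ?_⟩
      simp only [gain, Set.indicator_of_notMem hp, normalRisk_linear]
      rw [← ENNReal.ofReal_sum_of_nonneg fun j _ => by positivity, ENNReal.ofReal_zero, add_zero]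
      exact ENNReal.ofReal_le_ofReal (le_add_of_nonneg_right (by positivity))
  -- The gain is `Γn/2` on an event of probability at least one half: each of its two conditions
  -- eventually fails with probability at most one quarter.
  refine ⟨Γ / 4, by positivity, fun r hr => ?_⟩
  have hα' := (tendstoInMeasure_iff_dist.1 hαa η hη0).eventually_le_const
    (show (0 : ℝ≥0∞) < 4⁻¹ by simp)
  have hG' := (tendstoInMeasure_iff_dist.1 (hG g) (Γ / 4) (by positivity)).eventually_le_const
    (show (0 : ℝ≥0∞) < 4⁻¹ by simp)
  filter_upwards [eventually_oracle_add_gain_le hM hm hdep hh hα h3 (norm_nonneg g) gain hgain hr,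
    hα', hG', eventually_gt_atTop 0] with n hn h1 h2 hn0
  refine le_trans (add_le_add_right ?_ _) hn
  have hn' : (0 : ℝ) < n := Nat.cast_pos.2 hn0
  have hX := (hM n).measurable_pair
  have hcompl : jointLaw P (μ n) (ε n) (E n)ᶜ ≤ 2⁻¹ := by
    rw [jointLaw, Measure.map_apply hX (hE n).compl]
    calc P _ ≤ P ({ω | η ≤ dist (α n (obs (μ n) (ε n) ω)) a}
          ∪ {ω | Γ / 4 ≤ dist (∫ x, g x ∂empirical (centred (μ n) (ε n) (m n) ω)) Γ}) := by
          refine measure_mono fun ω hω => ?_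
          by_contra hcon
          simp only [Set.mem_union, Set.mem_ofPred_eq, not_or, not_le, Real.dist_eq] at hcon
          refine hω ⟨hcon.1.le, ?_⟩
          have h5 := (abs_lt.1 hcon.2).1
          rw [integral_empirical] at h5
          have h6 : 3 / 4 * Γ ≤ (n : ℝ)⁻¹ * ∑ i, g (centred (μ n) (ε n) (m n) ω i) := by linarith
          rw [le_inv_mul_iff₀ hn'] at h6
          exact (mul_comm _ _).trans_le h6
      _ ≤ 4⁻¹ + 4⁻¹ := (measure_union_le _ _).trans (add_le_add h1 h2)
      _ = 2⁻¹ := by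
          rw [← two_mul, show (4 : ℝ≥0∞) = 2 * 2 by norm_num, ENNReal.mul_inv (by simp) (by simp),
            ← mul_assoc, ENNReal.mul_inv_cancel (by simp) (by simp), one_mul]
  have := (hM n).isProbabilityMeasure_jointLaw
  have hprob : 2⁻¹ ≤ jointLaw P (μ n) (ε n) (E n) := by
    have h5 := prob_add_prob_compl (μ := jointLaw P (μ n) (ε n)) (hE n)
    have h6 : (2⁻¹ : ℝ≥0∞) + 2⁻¹ ≤ jointLaw P (μ n) (ε n) (E n) + 2⁻¹ := by
      rw [ENNReal.inv_two_add_inv_two, ← h5]; gcongr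
    exact (ENNReal.add_le_add_iff_right (by simp)).1 h6
  have hind : ∀ p, ENNReal.ofReal (gain n p)
      = (E n).indicator (fun _ => ENNReal.ofReal (Γ / 2 * n)) p := fun p => by
    by_cases hp : p ∈ E n <;> simp [gain, hp]
  simp only [hind]
  rw [lintegral_indicator_const (hE n)]
  refine le_trans (le_of_eq ?_) (mul_le_mul_right hprob _)
  rw [show (2⁻¹ : ℝ≥0∞) = ENNReal.ofReal 2⁻¹ by
    rw [ENNReal.ofReal_inv_of_pos two_pos]; simp, ← ENNReal.ofReal_mul (by positivity)]
  congr 1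
  ring

end Normality

end SeqEB

open SeqEB in
theorem theorem2 {Ω : Type*} [MeasurableSpace Ω] (P : Measure Ω) [IsProbabilityMeasure P]
    (μ ε : ∀ n : ℕ, Fin n → Ω → ℝ)
    (μt μh : ∀ n : ℕ, Fin n → (Fin n → ℝ) → ℝ) (ρ : ℕ → ℝ)
    (hmodel : ∀ n, NoiseModel P (μ n) (ε n))
    (hfilter : SequentialFilter μh)
    (hA1 : LipschitzPredictor μt ρ)
    (hA3 : TightResiduals P μ ε μt) :
    (LeUpToLittleO
        (fun n => risk P (μ n) (fun i ω => estimIS (μt n) i (obs (μ n) (ε n) ω)))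
        (fun n => risk P (μ n) (oracleIS (μ n) (ε n) (μt n)))) ∧
    (∀ α : ∀ n : ℕ, (Fin n → ℝ) → ℝ, AsympWeightedAverage P μ ε μt μh α →
      (LeUpToLittleO
        (fun n => risk P (μ n) (oracleIS (μ n) (ε n) (μt n)))
        (fun n => risk P (μ n) (fun i ω => μh n i (obs (μ n) (ε n) ω)))) ∧
      (∀ a : ℝ, 0 < a → a < 1 →
        TendstoInMeasure P (fun n ω => α n (obs (μ n) (ε n) ω)) atTop (fun _ => a) →
        ∀ G : Measure ℝ, IsProbabilityMeasure G →
          EmpiricalTendsto P (fun n => centred (μ n) (ε n) (μt n)) G →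
          G ≠ gaussianReal 0 (Real.toNNReal ((1 - a) / a)) →
          ∃ c : ℝ, 0 < c ∧ c < 1 ∧ ∀ᶠ n : ℕ in atTop,
            risk P (μ n) (fun i ω => estimIS (μt n) i (obs (μ n) (ε n) ω))
              ≤ ENNReal.ofReal c
                * risk P (μ n) (fun i ω => μh n i (obs (μ n) (ε n) ω)))) := by
  have hm := hA1.measurable
  have hdep := hA1.dependsOn
  have hh := hfilter.measurable
  have hest := fun (r : ℝ) (hr : 0 < r) => eventually_risk_estimIS_le hmodel hm hdep hA3 hr
  refine ⟨leUpToLittleO_of_forall_eventually_le hest, fun α hα => ⟨?_, ?_⟩⟩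
  · exact leUpToLittleO_of_forall_eventually_le fun r hr =>
      eventually_risk_oracleIS_le hmodel hm hdep hh hα hA3 hr
  · intro a ha ha1 hαa G _ hG hGne
    obtain ⟨q, hq, hgain⟩ := exists_oracle_gain hmodel hm hdep hh hα hA3 ha ha1 hαa hG hGne
    exact exists_ratio_lt_one hq hest (fun n => (hmodel n).risk_oracleIS_le (hm n) (hdep n)) hgain
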